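/- For a topological group $G$ and $n\ge 1$, let $r_n(G)\in\{0,1,2,\dots,\infty\}$ be the number of equivalence classes of continuous irreducible complex linear representations of $G$ of degree $n$. The group $G$ is rigid if $r_n(G)<\infty$ for all $n\ge 1$; its representation zeta function is then the Dirichlet series $\zeta_G(s)=\zeta(G,s)=\sum_{n\ge 1} r_n(G)\,n^{-s}$. For a finite group $Q$ acting on a finite set $X$, let $H\wr_X Q=H^X\rtimes Q$ be the permutational wreath product, with $(qb)(x)=b(q^{-1}x)$ for $q\in Q$, $b\in H^X$, $x\in X$, and with the topology for which $H^X$ has the product topology and is an open subgroup. For $d\ge 2$, let $C_d$ be the cyclic group of order $d$ acting on $\{1,\dots,d\}$ by cyclic permutations and $S_d$ the symmetric group of $\{1,\dots,d\}$; the corresponding wreath products are written $H\wr_d C_d$ and $H\wr_d S_d$. Let $\mu$ be the Möbius function of elementary number theory. Let $H$ be a rigid topological group. Then the groups $H\wr_d C_d$ ($d\ge 2$), $H\wr_3 S_3$ and $H\wr_4 S_4$ are rigid, and the following identities hold, both as identities of formal Dirichlet series and as identities of complex numbers at every $s\in\mathbf C$ at which the series $\zeta_H(s)$ converges absolutely (the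 series on the left then converges absolutely at $s$ as well). For every integer $d\ge 2$, $$\zeta(H\wr_d C_d,s)=\sum_{e\mid d}\left(\frac de\right)^{-1-s} e\sum_{f:\ e\mid f\mid d}\mu\!\left(\frac fe\right)\zeta_H(fs)^{d/f}.$$ In particular, for $p$ prime, $$\zeta(H\wr_p C_p,s)=p^{-1-s}\bigl(\zeta_H(s)^p-\zeta_H(ps)\bigr)+p\,\zeta_H(ps),$$ and for $d=4$, $$\zeta(H\wr_4 C_4,s)=4^{-1-s}\bigl(\zeta_H(s)^4-\zeta_H(2s)^2\bigr)+2^{-s}\bigl(\zeta_H(2s)^2-\zeta_H(4s)\bigr)+4\,\zeta_H(4s).$$ For the symmetric group on three objects, $$\zeta(H\wr_3 S_3,s)=6^{-1-s}\zeta_H(s)^3+\bigl(-6^{-s}/2+2\cdot 3^{-s}\bigr)\zeta_H(2s)\zeta_H(s)+\bigl(6^{-s}/3-2\cdot 3^{-s}+2^{-s}+2\bigr)\zeta_H(3s).$$ For the symmetric group on four objects, $$\begin{aligned}\zeta(H\wr_4 S_4,s)={}&24^{-1-s}\bigl(\zeta_H(s)^4-6\zeta_H(s)^2\zeta_H(2s)+8\zeta_H(s)\zeta_H(3s)+3\zeta_H(2s)^2-6\zeta_H(4s)\bigr)\\&+6\cdot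 12^{-1-s}\cdot 2\,\bigl(\zeta_H(s)^2\zeta_H(2s)-2\zeta_H(s)\zeta_H(3s)-\zeta_H(2s)^2+2\zeta_H(4s)\bigr)\\&+4\cdot 4^{-1-s}(2+2^{-s})\bigl(\zeta_H(s)\zeta_H(3s)-\zeta_H(4s)\bigr)\\&+3\cdot 6^{-1-s}\cdot 4\,\bigl(\zeta_H(2s)^2-\zeta_H(4s)\bigr)\\&+\bigl(2+2^{-s}+2\cdot 3^{-s}\bigr)\zeta_H(4s).\end{aligned}$$ -/

import Mathlib

namespace RepZeta

noncomputable section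

/-- A continuous irreducible complex linear representation of `G` on the space `ℂⁿ`. For a linear
action on a finite-dimensional space, continuity of all orbit maps is the same as continuity of
`G × ℂⁿ → ℂⁿ`, and as continuity of `G → GL_n(ℂ)`. -/
structure IrrRep (G : Type*) [Group G] [TopologicalSpace G] (n : ℕ) where
  rep : Representation ℂ G (Fin n → ℂ)
  irreducible : rep.IsIrreducible
  continuous : ∀ v : Fin n → ℂ, Continuous fun g : G => rep g v

/-- Equivalence (isomorphism) of representations. -/
instance IrrRep.setoid (G : Type*) [Group G] [TopologicalSpace G] (n : ℕ) :
    Setoid (IrrRep G n) where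
  r π σ := Nonempty (π.rep.Equiv σ.rep)
  iseqv :=
    { refl := fun π => ⟨Representation.Equiv.refl π.rep⟩
      symm := fun ⟨e⟩ => ⟨e.symm⟩
      trans := fun ⟨e⟩ ⟨e'⟩ => ⟨e.trans e'⟩ }

/-- The part of degree `n` of the dual of `G`: the set of equivalence classes of continuous
irreducible complex representations of `G` of dimension `n`. -/
def DualDeg (G : Type*) [Group G] [TopologicalSpace G] (n : ℕ) : Type _ :=
  Quotient (IrrRep.setoid G n)

/-- `r_n(G)`, the number (possibly infinite) of classes of continuous irreducible complex
representations of degree `n`. -/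
def repCount (G : Type*) [Group G] [TopologicalSpace G] (n : ℕ) : ℕ∞ :=
  ENat.card (DualDeg G n)

/-- `G` is rigid if `r_n(G)` is finite for all `n ≥ 1`. -/
def Rigid (G : Type*) [Group G] [TopologicalSpace G] : Prop :=
  ∀ n : ℕ, 1 ≤ n → repCount G n ≠ ⊤

/-- The formal Dirichlet series `∑_{n ≥ 1} r_n(G) n^{-s}` of a rigid group. Formal Dirichlet
series are elements of the ring of arithmetic functions, whose product is Dirichlet convolution,
that is, the product of Dirichlet series. -/
def zetaSeries (G : Type*) [Group G] [TopologicalSpace G] : ArithmeticFunction ℂ :=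
  ⟨fun n => if n = 0 then 0 else ((repCount G n).toNat : ℂ), by simp⟩

/-- The representation zeta function `ζ(G, s) = ∑_{n ≥ 1} r_n(G) n^{-s}`, as a function of the
complex variable `s`, at the points `s` where the series converges. -/
def zeta (G : Type*) [Group G] [TopologicalSpace G] (s : ℂ) : ℂ :=
  LSeries (zetaSeries G) s

/-- `ζ(G, ·)` converges at `s`. -/
def ZetaConverges (G : Type*) [Group G] [TopologicalSpace G] (s : ℂ) : Prop :=
  LSeriesSummable (zetaSeries G) s

/-- The formal Dirichlet series `k^{-s}`, for `k ≥ 1`. -/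
def powNeg (k : ℕ) : ArithmeticFunction ℂ :=
  ⟨fun n => if n = k ∧ n ≠ 0 then 1 else 0, by simp⟩

/-- For `f ≥ 1`, the formal Dirichlet series obtained from `∑ a_n n^{-s}` by substituting `f s`
for `s`, namely `∑ a_n (n^f)^{-s}`. -/
def dilate (f : ℕ) (a : ArithmeticFunction ℂ) : ArithmeticFunction ℂ :=
  ⟨fun m => ∑ n ∈ m.divisors with n ^ f = m, a n, by simp⟩

/-- The formal Dirichlet series `ζ(G, f s)`, for `f ≥ 1`. -/
def zetaSeriesAt (G : Type*) [Group G] [TopologicalSpace G] (f : ℕ) : ArithmeticFunction ℂ :=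
  dilate f (zetaSeries G)

/-- The permutational wreath product `H ≀_X Q = H^X ⋊ Q`, where `Q` acts on `H^X` by
`(q b)(x) = b (q⁻¹ x)`. -/
def Wreath (H X Q : Type*) [Group H] [Group Q] [MulAction Q X] : Type _ :=
  (X → H) ⋊[mulAutArrow (G := Q) (A := X) (M := H)] Q

instance (H X Q : Type*) [Group H] [Group Q] [MulAction Q X] : Group (Wreath H X Q) :=
  inferInstanceAs (Group ((X → H) ⋊[mulAutArrow (G := Q) (A := X) (M := H)] Q))

/-- The topology of `H ≀_X Q`: the product of the product topology of `H^X` and the discrete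
topology of `Q`, so that `H^X` carries the product topology and is an open subgroup. -/
instance (H X Q : Type*) [Group H] [TopologicalSpace H] [Group Q] [MulAction Q X] :
    TopologicalSpace (Wreath H X Q) :=
  TopologicalSpace.induced (fun g => SemidirectProduct.left g)
      (inferInstance : TopologicalSpace (X → H)) ⊓
    TopologicalSpace.induced (fun g => SemidirectProduct.right g) (⊥ : TopologicalSpace Q)

/-- The cyclic group `C_d` of order `d`, acting on `d` points by cyclic permutations. -/
abbrev CycGp (d : ℕ) : Type := Subgroup.zpowers (finRotate d)

/-- The symmetric group `S_d`, acting on `d` points. -/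
abbrev SymGp (d : ℕ) : Type := Equiv.Perm (Fin d)

end

end RepZeta

open RepZeta

/-! The proof is Clifford theory over the base group `H^X`, followed by counting. Restricted to
`H^X`, an irreducible representation `V` of `H ≀_X Q` (with `Q` finite) contains some outer tensor
product `⊗ σ_x` of irreducible representations of `H`, and the families `σ` that occur form a single
`Q`-orbit. Since `⊗ σ_x` extends to `H^X ⋊ Stab(σ)` by permuting tensor factors, no cocycle appears:
the irreducible `V` lying over `σ` correspond to the irreducible representations `τ` of `Stab(σ)`,
with `deg V = |Qσ| · ∏ deg σ_x · deg τ`. Each `V` lies over `|Qσ|` families, so giving every pair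
`(σ, V)` the weight `1/|Qσ|` yields `ζ(H ≀_X Q, s) = ∑_σ |Qσ|^(-1-s) (∏ deg σ_x)^(-s) ζ(Stab σ, s)`.

The multiplicity space `Hom(⊗ σ_x, V)` is realized inside `V` as `multSpace`, by evaluation at the
tensor product of the first basis vectors. Jacobson density (`exists_asAlgebraHom_eq`) provides
elements of `ℂ[H]` acting as a matrix unit on one class and as zero on finitely many others; their
products over the factors, `idem`, project onto these spaces. By `mem_of_mem_repSpan`, the
subrepresentation generated by a stabilizer-stable part `Γ` of `multSpace` meets `multSpace` only in
`Γ`. Hence `V ↦ multSpace` preserves irreducibility (`multRep_irreducible`) and detects isomorphism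
(`equiv_of_multRep_equiv`). Every `τ` is reached from the large representation `tensorRep`, and the
degree formula is a trace computation (`finrank_eq_sum`). `exists_correspondence` collects this, and
`wreath_zetaSeries` performs the weighted sum.

In the cases treated, the order of `Stab(σ)` already determines its zeta series, so families are
sorted by that order. For `C_d`, an order `f ∣ d` divides `|Stab σ|` exactly when `σ` has period
`d/f`; such families contribute `ζ_H(fs)^(d/f)`, and Möbius inversion isolates each exact order. For
`S_3` and `S_4`, the order depends only on which entries of `σ` coincide; averaging over
permutations writes its indicator as an integer combination of indicators of coincidences, a finite
verification. The zeta series of the stabilizers come from the sum of squares of the degrees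
together with bounds on the number of linear characters.

The numerical identities follow because absolutely convergent Dirichlet series add and multiply, and
because `ζ_H(ks)` converges absolutely wherever `ζ_H(s)` does (`ZetaConverges.nat_mul`). -/

namespace RepZeta

noncomputable section

open Module MonoidAlgebra

universe u v w

/-! ### Irreducible representations, continuity and the dual -/

section General

variable {G : Type*} [Group G] {V W : Type*} [AddCommGroup V] [Module ℂ V]
  [AddCommGroup W] [Module ℂ W]

theorem isIrreducible_iff (ρ : Representation ℂ G V) :
    ρ.IsIrreducible ↔ Nontrivial V ∧
      ∀ U : Submodule ℂ V, (∀ g, ∀ v ∈ U, ρ g v ∈ U) → U = ⊥ ∨ U = ⊤ := by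
  constructor
  · intro h
    refine ⟨?_, fun U hU => ?_⟩
    · obtain ⟨a, b, hab⟩ := h.toNontrivial
      by_contra hn
      rw [not_nontrivial_iff_subsingleton] at hn
      exact hab (Subrepresentation.ext (Subsingleton.elim _ _))
    · rcases h.eq_bot_or_eq_top ⟨U, fun g v hv => hU g v hv⟩ with h | h
      · left; exact congrArg Subrepresentation.toSubmodule h
      · right; exact congrArg Subrepresentation.toSubmodule h
  · rintro ⟨hn, h⟩
    refine @IsSimpleOrder.mk _ _ _ ⟨⊥, ⊤, fun e => ?_⟩ fun U => ?_
    · have := congrArg Subrepresentation.toSubmodule e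
      exact bot_ne_top (α := Submodule ℂ V) this
    · rcases h U.toSubmodule (fun g v hv => U.apply_mem_toSubmodule g hv) with h | h
      · left; exact Subrepresentation.ext h
      · right; exact Subrepresentation.ext h

theorem isIrreducible_of_equiv {ρ : Representation ℂ G V} {σ : Representation ℂ G W}
    (e : ρ.Equiv σ) (h : ρ.IsIrreducible) : σ.IsIrreducible := by
  rw [isIrreducible_iff] at h ⊢
  obtain ⟨h1, h2⟩ := h
  refine ⟨e.toLinearEquiv.symm.toEquiv.nontrivial, fun U hU => ?_⟩
  have key : ∀ g v, e (ρ g v) = σ g (e v) := fun g v => e.toIntertwiningMap.isIntertwining _ _ g v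
  rcases h2 (U.comap (e.toLinearEquiv : V →ₗ[ℂ] W)) (fun g v hv => by
    change e (ρ g v) ∈ U
    rw [key]; exact hU g _ hv) with h | h
  · left
    rw [eq_bot_iff]
    intro u hu
    have : e.symm u ∈ U.comap (e.toLinearEquiv : V →ₗ[ℂ] W) := by
      change e (e.symm u) ∈ U
      simpa using hu
    rw [h, Submodule.mem_bot] at this
    have h2 := congrArg e this
    rw [Representation.Equiv.apply_symm_apply] at h2
    rw [h2]
    exact map_zero e.toLinearEquiv
  · right
    rw [eq_top_iff]
    intro u _
    have : e.symm u ∈ U.comap (e.toLinearEquiv : V →ₗ[ℂ] W) := by rw [h]; trivial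
    change e (e.symm u) ∈ U at this
    simpa using this

/-- The action of the group algebra is transported by intertwining maps. -/
theorem intertwining_asAlgebraHom {ρ : Representation ℂ G V} {σ : Representation ℂ G W}
    (f : V →ₗ[ℂ] W) (hf : ∀ g v, f (ρ g v) = σ g (f v)) (a : ℂ[G]) (v : V) :
    f (ρ.asAlgebraHom a v) = σ.asAlgebraHom a (f v) := by
  induction a using MonoidAlgebra.induction_linear with
  | zero => simp
  | add x y hx hy => simp [hx, hy]
  | single g c => simp [Representation.asAlgebraHom_single, hf]

theorem asAlgebraHom_mem {ρ : Representation ℂ G V} (U : Submodule ℂ V)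
    (hU : ∀ g, ∀ v ∈ U, ρ g v ∈ U) (a : ℂ[G]) {v : V} (hv : v ∈ U) :
    ρ.asAlgebraHom a v ∈ U := by
  induction a using MonoidAlgebra.induction_linear with
  | zero => simp
  | add x y hx hy => simpa using U.add_mem hx hy
  | single g c =>
    rw [Representation.asAlgebraHom_single]
    exact U.smul_mem _ (hU g v hv)

variable [TopologicalSpace G]

/-- All matrix coefficients of the representation are continuous. -/
def ContRep (ρ : Representation ℂ G V) : Prop :=
  ∀ (v : V) (l : Module.Dual ℂ V), Continuous fun g => l (ρ g v)

/-- A functional on the source extends to the target through a linear left inverse of the embedding.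
Working with matrix coefficients spares subspaces and quotients any choice of topology. -/
theorem ContRep.of_injective {ρ : Representation ℂ G V} {σ : Representation ℂ G W}
    (h : ContRep σ) (f : V →ₗ[ℂ] W) (hf : ∀ g v, f (ρ g v) = σ g (f v))
    (hi : Function.Injective f) : ContRep ρ := by
  intro v l
  obtain ⟨p, hp⟩ := f.exists_leftInverse_of_injective (LinearMap.ker_eq_bot.2 hi)
  have : (fun g => l (ρ g v)) = fun g => (l ∘ₗ p) (σ g (f v)) := by
    funext g
    rw [← hf]
    have := LinearMap.congr_fun hp (ρ g v)
    simp only [LinearMap.comp_apply, LinearMap.id_apply] at this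
    simp [this]
  rw [this]
  exact h _ _

theorem contRep_pi_iff {n : ℕ} (ρ : Representation ℂ G (Fin n → ℂ)) :
    ContRep ρ ↔ ∀ v, Continuous fun g => ρ g v := by
  constructor
  · intro h v
    exact continuous_pi fun i => h v (LinearMap.proj i)
  · intro h v l
    exact (LinearMap.continuous_of_finiteDimensional l).comp (h v)

variable (G) in
/-- The set of classes of continuous irreducible representations of all degrees. -/
abbrev IrrDual : Type _ := Σ n : ℕ, DualDeg G n

/-- A representation in a given class. -/
def IrrDual.rep (d : IrrDual G) : Representation ℂ G (Fin d.1 → ℂ) := (Quotient.out d.2).rep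

instance (d : IrrDual G) : d.rep.IsIrreducible := (Quotient.out d.2).irreducible

theorem IrrDual.contRep (d : IrrDual G) : ContRep d.rep :=
  (contRep_pi_iff _).2 (Quotient.out d.2).continuous

theorem IrrDual.deg_pos (d : IrrDual G) : 0 < d.1 := by
  have h := ((isIrreducible_iff d.rep).1 inferInstance).1
  by_contra h0
  have h0 : d.1 = 0 := by omega
  have : IsEmpty (Fin d.1) := by rw [h0]; infer_instance
  exact not_subsingleton _ (inferInstance : Subsingleton (Fin d.1 → ℂ))

theorem IrrDual.ext_of_equiv {d d' : IrrDual G} (e : d.rep.Equiv d'.rep) : d = d' := by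
  have hn : d.1 = d'.1 := by
    simpa using e.toLinearEquiv.finrank_eq
  obtain ⟨n, d⟩ := d
  obtain ⟨n', d'⟩ := d'
  dsimp only at hn
  subst hn
  congr 1
  rw [← Quotient.out_eq d, ← Quotient.out_eq d']
  exact Quotient.sound ⟨e⟩

/-- A choice of basis transports the action to `ℂⁿ`. Constructions can thus be made on arbitrary
spaces and be named by a class only at the end. -/
theorem exists_irrDual [FiniteDimensional ℂ V] (ρ : Representation ℂ G V)
    (hi : ρ.IsIrreducible) (hc : ContRep ρ) :
    ∃ d : IrrDual G, Nonempty (ρ.Equiv d.rep) := by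
  let b : V ≃ₗ[ℂ] (Fin (finrank ℂ V) → ℂ) := (finBasis ℂ V).equivFun
  let ρ' : Representation ℂ G (Fin (finrank ℂ V) → ℂ) :=
    { toFun := fun g => b.conj (ρ g)
      map_one' := by ext; simp [LinearEquiv.conj_apply]
      map_mul' := fun g h => by rw [map_mul]; ext; simp [LinearEquiv.conj_apply] }
  let e : ρ.Equiv ρ' := .mk b (fun g => by ext v; simp [ρ', LinearEquiv.conj_apply])
  have hc' : ContRep ρ' := by
    refine hc.of_injective (b.symm : _ →ₗ[ℂ] V) (fun g v => ?_) b.symm.injective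
    simp [ρ', LinearEquiv.conj_apply]
  let π : IrrRep G (finrank ℂ V) :=
    ⟨ρ', isIrreducible_of_equiv e hi, (contRep_pi_iff _).1 hc'⟩
  refine ⟨⟨_, ⟦π⟧⟩, ?_⟩
  obtain ⟨e'⟩ : Quotient.out (⟦π⟧ : DualDeg G _) ≈ π := Quotient.mk_out π
  exact ⟨e.trans e'.symm⟩

/-- Every nonzero finite-dimensional space with a continuous action contains the image of an
irreducible representation. -/
theorem exists_irrDual_intertwining [FiniteDimensional ℂ V] (ρ : Representation ℂ G V)
    (hc : ContRep ρ) (U : Submodule ℂ V) (hU : ∀ g, ∀ v ∈ U, ρ g v ∈ U) (hne : U ≠ ⊥) :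
    ∃ (d : IrrDual G) (f : (Fin d.1 → ℂ) →ₗ[ℂ] V), Function.Injective f ∧
      (∀ g v, f (d.rep g v) = ρ g (f v)) ∧ ∀ v, f v ∈ U := by
  obtain ⟨S, ⟨hS1, hS2, hS3⟩, hmin⟩ := exists_minimal_of_wellFoundedLT
    (fun S : Submodule ℂ V => S ≠ ⊥ ∧ S ≤ U ∧ ∀ g, ∀ v ∈ S, ρ g v ∈ S) ⟨U, hne, le_rfl, hU⟩
  let S' : Subrepresentation ρ := ⟨S, fun g v hv => hS3 g v hv⟩
  have hirr : S'.toRepresentation.IsIrreducible := by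
    rw [isIrreducible_iff]
    refine ⟨Submodule.nontrivial_iff_ne_bot.2 hS1, fun T hT => ?_⟩
    by_cases h0 : T = ⊥
    · exact Or.inl h0
    · right
      have hle : T.map S.subtype ≤ S := Submodule.map_subtype_le S T
      have := hmin (y := T.map S.subtype) ⟨?_, hle.trans hS2, ?_⟩ hle
      · rw [eq_top_iff]
        rintro ⟨x, hx⟩ -
        obtain ⟨y, hy, hyx⟩ := this hx
        have : y = ⟨x, hx⟩ := Subtype.ext hyx
        rwa [← this]
      · intro h
        exact h0 (Submodule.map_injective_of_injective S.injective_subtype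
          (h.trans (Submodule.map_bot _).symm))
      · rintro g _ ⟨y, hy, rfl⟩
        exact ⟨_, hT g y hy, rfl⟩
  obtain ⟨d, ⟨e⟩⟩ := exists_irrDual S'.toRepresentation hirr
    (hc.of_injective S.subtype (fun g v => rfl) S.injective_subtype)
  refine ⟨d, S.subtype ∘ₗ (e.symm.toLinearEquiv : _ →ₗ[ℂ] _),
    S.injective_subtype.comp e.symm.toLinearEquiv.injective, fun g v => ?_, fun v => ?_⟩
  · have := e.symm.toIntertwiningMap.isIntertwining _ _ g v
    exact congrArg S.subtype this
  · exact hS2 (e.symm v).2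

end General

/-! ### Joint surjectivity by the density theorem -/

section Density

variable {G : Type*} [Group G]

/-- Pairwise inequivalent irreducible representations are jointly surjective on endomorphisms. -/
theorem exists_asAlgebraHom_eq {ι : Type*} [Finite ι] {V : ι → Type*} [∀ i, AddCommGroup (V i)]
    [∀ i, Module ℂ (V i)] [∀ i, FiniteDimensional ℂ (V i)]
    (ρ : ∀ i, Representation ℂ G (V i)) (hirr : ∀ i, (ρ i).IsIrreducible)
    (hne : ∀ i j, i ≠ j → IsEmpty ((ρ i).Equiv (ρ j)))
    (T : ∀ i, Module.End ℂ (V i)) :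
    ∃ a : ℂ[G], ∀ i, (ρ i).asAlgebraHom a = T i := by
  classical
  have := Fintype.ofFinite ι
  let M := ∀ i, (ρ i).asModule
  have hs : IsSemisimpleModule ℂ[G] M := inferInstance
  -- Schur's lemma for the entries of an endomorphism of the direct sum: scalars on the diagonal,
  -- zero elsewhere by inequivalence.
  have hcross : ∀ (φ : Module.End ℂ[G] M) (i j : ι), ∃ c : ℂ, ∀ v : (ρ i).asModule,
      φ (Pi.single i v) j = if h : i = j then c • (h ▸ v : (ρ j).asModule) else 0 := by
    intro φ i j
    let ψ : (ρ i).asModule →ₗ[ℂ[G]] (ρ j).asModule :=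
      LinearMap.proj j ∘ₗ φ ∘ₗ LinearMap.single ℂ[G] (fun i => (ρ i).asModule) i
    by_cases hij : i = j
    · subst hij
      obtain ⟨c, hc⟩ := (IsSimpleModule.algebraMap_end_bijective_of_isAlgClosed
        (A := ℂ[G]) (V := (ρ i).asModule) ℂ).2 ψ
      refine ⟨c, fun v => ?_⟩
      have := LinearMap.congr_fun hc v
      simp only [dif_pos]
      exact this.symm
    · refine ⟨0, fun v => ?_⟩
      rw [dif_neg hij]
      let ψ' := (Representation.IntertwiningMap.equivLinearMapAsModule (ρ i) (ρ j)).symm ψ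
      have := hne i j hij
      have h0 : ψ' = 0 := Subsingleton.elim _ _
      have h1 : ψ = 0 := by
        simpa [ψ'] using h0
      exact LinearMap.congr_fun h1 v
  -- By the shape of its entries, every `ℂ[G]`-endomorphism of `M` commutes with the block-diagonal
  -- map `T`. So `T` lies in the bicommutant, and density lets one element of `ℂ[G]` agree with it
  -- on a finite set, here a basis of each summand.
  let f0 : M → M := fun m i => T i (m i)
  have hcomm : ∀ (φ : Module.End ℂ[G] M) (m : M), f0 (φ m) = φ (f0 m) := by
    intro φ m
    have hm : ∀ m : M, m = ∑ i, Pi.single i (m i) := fun m => (Finset.univ_sum_single m).symm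
    funext j
    have h1 : ∀ m : M, φ m j = ∑ i, φ (Pi.single i (m i)) j := by
      intro m
      conv_lhs => rw [hm m, map_sum]
      rw [Finset.sum_apply]
    change T j (φ m j) = φ (f0 m) j
    rw [h1 m, h1 (f0 m)]
    refine (map_sum (T j) _ _).trans ?_
    refine Finset.sum_congr rfl fun i _ => ?_
    obtain ⟨c, hc⟩ := hcross φ i j
    rw [hc, hc]
    by_cases hij : i = j
    · subst hij
      simp only [dif_pos]
      exact map_smul (T i) c _
    · rw [dif_neg hij, dif_neg hij]
      exact map_zero (T j)
  let f : Module.End (Module.End ℂ[G] M) M :=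
    { toFun := f0
      map_add' := fun x y => by
        funext i
        exact map_add (T i) _ _
      map_smul' := fun φ m => hcomm φ m }
  let bv : ∀ i, Fin (finrank ℂ (V i)) → (ρ i).asModule := fun i k => finBasis ℂ (V i) k
  let s : Finset M := Finset.univ.biUnion fun i : ι =>
    Finset.univ.image fun k => (Pi.single i (bv i k) : M)
  obtain ⟨a, ha⟩ := jacobson_density f s
  refine ⟨a, fun i => (finBasis ℂ (V i)).ext fun k => ?_⟩
  have h1 := ha (Pi.single i (bv i k) : M) (Finset.mem_biUnion.2
    ⟨i, Finset.mem_univ _, Finset.mem_image.2 ⟨k, Finset.mem_univ _, rfl⟩⟩)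
  have h2 := congrFun h1 i
  have h3 : T i ((Pi.single i (bv i k) : M) i) = (a • ((Pi.single i (bv i k) : M) i)) := h2
  have h4 : (Pi.single i (bv i k) : M) i = bv i k := Pi.single_eq_same i _
  erw [h4] at h3
  exact h3.symm

variable [TopologicalSpace G]

theorem exists_lift (F : Finset (IrrDual G)) (T : ∀ d : IrrDual G, Module.End ℂ (Fin d.1 → ℂ)) :
    ∃ a : ℂ[G], ∀ d ∈ F, d.rep.asAlgebraHom a = T d := by
  obtain ⟨a, ha⟩ := exists_asAlgebraHom_eq (fun d : F => d.1.rep) (fun d => inferInstance)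
    (fun i j hij => ⟨fun e => hij (Subtype.ext (IrrDual.ext_of_equiv e))⟩) (fun d => T d.1)
  exact ⟨a, fun d hd => ha ⟨d, hd⟩⟩

end Density

/-! ### The group algebras of the factors acting on a representation -/

section Wreath

variable {H X Q : Type*} [Group H] [Group Q] [MulAction Q X]

/-- The inclusion of the base group. -/
def Wreath.base : (X → H) →* Wreath H X Q :=
  (SemidirectProduct.inl : (X → H) →* (X → H) ⋊[mulAutArrow (G := Q) (A := X) (M := H)] Q)

/-- The inclusion of the acting group. -/
def Wreath.top : Q →* Wreath H X Q :=
  (SemidirectProduct.inr : Q →* (X → H) ⋊[mulAutArrow (G := Q) (A := X) (M := H)] Q)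

open Wreath

theorem Wreath.top_mul_base (q : Q) (b : X → H) :
    (top q * base b : Wreath H X Q) = base (fun x => b (q⁻¹ • x)) * top q := by
  have h := SemidirectProduct.inl_aut (φ := mulAutArrow (G := Q) (A := X) (M := H)) q b
  have h2 : (base (fun x => b (q⁻¹ • x)) : Wreath H X Q) = top q * base b * top q⁻¹ := h
  rw [h2, mul_assoc, ← map_mul]
  simp

theorem Wreath.exists_eq (g : Wreath H X Q) : ∃ b q, g = base b * top q :=
  ⟨SemidirectProduct.left g, SemidirectProduct.right g,
    (SemidirectProduct.inl_left_mul_inr_right g).symm⟩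

variable [decX : DecidableEq X]

theorem Wreath.top_mul_base_mulSingle (q : Q) (x : X) (h : H) :
    (top q * base (Pi.mulSingle x h) : Wreath H X Q) = base (Pi.mulSingle (q • x) h) * top q := by
  rw [top_mul_base]
  congr 2
  funext y
  by_cases hy : y = q • x
  · subst hy; simp
  · rw [Pi.mulSingle_eq_of_ne hy, Pi.mulSingle_eq_of_ne]
    rintro rfl
    simp at hy

variable {V W : Type*} [AddCommGroup V] [Module ℂ V] [AddCommGroup W] [Module ℂ W]

/-- The restriction of a representation of the wreath product to a factor of the base group. -/
def factorRep (ρ : Representation ℂ (Wreath H X Q) V) (x : X) : Representation ℂ H V :=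
  ρ.comp (base.comp (MonoidHom.mulSingle (fun _ : X => H) x))

/-- The action of the group algebra of a factor of the base group. -/
def factorAlg (ρ : Representation ℂ (Wreath H X Q) V) (x : X) : ℂ[H] →ₐ[ℂ] Module.End ℂ V :=
  (factorRep ρ x).asAlgebraHom

theorem factorAlg_single (ρ : Representation ℂ (Wreath H X Q) V) (x : X) (h : H) (c : ℂ) :
    factorAlg ρ x (single h c) = c • ρ (base (Pi.mulSingle x h)) :=
  Representation.asAlgebraHom_single _ _ _

theorem factorAlg_commute (ρ : Representation ℂ (Wreath H X Q) V) {x y : X} (hxy : x ≠ y)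
    (a b : ℂ[H]) : Commute (factorAlg ρ x a) (factorAlg ρ y b) := by
  induction a using MonoidAlgebra.induction_linear with
  | zero => simp
  | add a a' ha ha' => rw [map_add]; exact ha.add_left ha'
  | single g c =>
    induction b using MonoidAlgebra.induction_linear with
    | zero => simp
    | add a a' ha ha' => rw [map_add]; exact ha.add_right ha'
    | single g' c' =>
      rw [factorAlg_single, factorAlg_single]
      refine Commute.smul_left (Commute.smul_right ?_ _) _
      exact ((Pi.mulSingle_commute (f := fun _ : X => H) hxy g g').map base).map ρ

theorem top_factorAlg (ρ : Representation ℂ (Wreath H X Q) V) (q : Q) (x : X) (a : ℂ[H]) (v : V) :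
    ρ (top q) (factorAlg ρ x a v) = factorAlg ρ (q • x) a (ρ (top q) v) := by
  induction a using MonoidAlgebra.induction_linear with
  | zero => simp
  | add a a' ha ha' => simp [ha, ha']
  | single g c =>
    rw [factorAlg_single, factorAlg_single]
    simp only [LinearMap.smul_apply, map_smul]
    congr 1
    rw [← Module.End.mul_apply, ← map_mul, top_mul_base_mulSingle, map_mul, Module.End.mul_apply]

theorem factorAlg_map {ρ : Representation ℂ (Wreath H X Q) V}
    {σ : Representation ℂ (Wreath H X Q) W} (f : V →ₗ[ℂ] W)
    (hf : ∀ g v, f (ρ g v) = σ g (f v)) (x : X) (a : ℂ[H]) (v : V) :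
    f (factorAlg ρ x a v) = factorAlg σ x a (f v) :=
  intertwining_asAlgebraHom (ρ := factorRep ρ x) (σ := factorRep σ x) f (fun _ _ => hf _ _) a v

variable [Fintype X]

/-- The multiplicative action of families of elements of the group algebra, one for each factor
of the base group. -/
def baseAlg (ρ : Representation ℂ (Wreath H X Q) V) : (X → ℂ[H]) →* Module.End ℂ V :=
  MonoidHom.noncommPiCoprod (fun x => (factorAlg ρ x : ℂ[H] →* Module.End ℂ V))
    (fun _ _ hxy a b => factorAlg_commute ρ hxy a b)

theorem baseAlg_mulSingle (ρ : Representation ℂ (Wreath H X Q) V) (x : X) (a : ℂ[H]) :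
    baseAlg ρ (Pi.mulSingle x a) = factorAlg ρ x a :=
  MonoidHom.noncommPiCoprod_mulSingle _ _ _

theorem baseAlg_update (ρ : Representation ℂ (Wreath H X Q) V) (m : X → ℂ[H]) (x : X) (a : ℂ[H]) :
    baseAlg ρ (Function.update m x a) = factorAlg ρ x a * baseAlg ρ (Function.update m x 1) := by
  rw [← baseAlg_mulSingle, ← map_mul]
  congr 1
  funext y
  by_cases hy : y = x
  · subst hy; simp
  · simp [hy]

/-- Both sides are homomorphisms in `b`, so it suffices to compare them on single factors. Products
of base elements with projections can then be computed factor by factor. -/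
theorem baseAlg_of (ρ : Representation ℂ (Wreath H X Q) V) (b : X → H) :
    baseAlg ρ (fun x => of ℂ H (b x)) = ρ (base b) := by
  let f1 : (X → H) →* Module.End ℂ V :=
    (baseAlg ρ).comp
      { toFun := fun b x => of ℂ H (b x)
        map_one' := by funext x; exact map_one (of ℂ H)
        map_mul' := fun b c => by funext x; exact map_mul (of ℂ H) _ _ }
  let f2 : (X → H) →* Module.End ℂ V := ρ.comp base
  have : f1 = f2 := by
    refine MonoidHom.pi_ext fun x h => ?_
    change baseAlg ρ (fun y => of ℂ H ((Pi.mulSingle x h : X → H) y)) = ρ (base (Pi.mulSingle x h))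
    have h1 : (fun y => of ℂ H ((Pi.mulSingle x h : X → H) y)) =
        (Pi.mulSingle x (of ℂ H h) : X → ℂ[H]) := by
      funext y
      by_cases hy : y = x
      · subst hy; simp
      · rw [Pi.mulSingle_eq_of_ne hy, Pi.mulSingle_eq_of_ne hy, map_one]
    rw [h1, baseAlg_mulSingle, of_apply, factorAlg_single, one_smul]
  exact DFunLike.congr_fun this b

theorem baseAlg_apply (ρ : Representation ℂ (Wreath H X Q) V) (a : X → ℂ[H]) :
    baseAlg ρ a = Finset.univ.noncommProd (fun x => factorAlg ρ x (a x))
      (fun _ _ _ _ hxy => factorAlg_commute ρ hxy _ _) := rfl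

theorem baseAlg_congr (ρ : Representation ℂ (Wreath H X Q) V) {a a' : X → ℂ[H]}
    (h : ∀ x, factorAlg ρ x (a x) = factorAlg ρ x (a' x)) : baseAlg ρ a = baseAlg ρ a' := by
  rw [baseAlg_apply, baseAlg_apply]
  exact Finset.noncommProd_congr rfl (fun x _ => h x) _

theorem baseAlg_eq_zero (ρ : Representation ℂ (Wreath H X Q) V) {a : X → ℂ[H]} (x : X)
    (h : factorAlg ρ x (a x) = 0) : baseAlg ρ a = 0 := by
  rw [← Function.update_eq_self x a, baseAlg_update, h, zero_mul]

/-- Properties of operators that are closed under composition pass from the factors to the product;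
below they are "fixes `v`" and "scales `v`". -/
theorem baseAlg_apply_induction (ρ : Representation ℂ (Wreath H X Q) V) {a : X → ℂ[H]}
    (S : Submonoid (Module.End ℂ V)) (h : ∀ x, factorAlg ρ x (a x) ∈ S) : baseAlg ρ a ∈ S := by
  rw [baseAlg_apply]
  exact Submonoid.noncommProd_mem _ _ _ _ fun x _ => h x

theorem baseAlg_fix (ρ : Representation ℂ (Wreath H X Q) V) {a : X → ℂ[H]} {v : V}
    (h : ∀ x, factorAlg ρ x (a x) v = v) : baseAlg ρ a v = v :=
  baseAlg_apply_induction ρ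
    { carrier := {T | T v = v}
      one_mem' := rfl
      mul_mem' := fun {S T} hS hT => by
        change S (T v) = v
        rw [show T v = v from hT]; exact hS } h

theorem baseAlg_scalar (ρ : Representation ℂ (Wreath H X Q) V) {a : X → ℂ[H]} {v : V}
    (h : ∀ x, ∃ c : ℂ, factorAlg ρ x (a x) v = c • v) : ∃ c : ℂ, baseAlg ρ a v = c • v :=
  baseAlg_apply_induction ρ
    { carrier := {T | ∃ c : ℂ, T v = c • v}
      one_mem' := ⟨1, by simp⟩
      mul_mem' := by
        rintro S T ⟨c, hc⟩ ⟨d, hd⟩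
        exact ⟨d * c, by rw [Module.End.mul_apply, hd, map_smul, hc, mul_smul]⟩ } h

/-- The action of families of elements of the group algebra is multilinear. -/
def baseAlgMultilinear (ρ : Representation ℂ (Wreath H X Q) V) :
    MultilinearMap ℂ (fun _ : X => ℂ[H]) (Module.End ℂ V) where
  toFun := baseAlg ρ
  map_update_add' := by
    intro inst m x a b
    -- Multilinearity is quantified over all decidability instances, while `baseAlg` was built with
    -- a fixed one.
    obtain rfl : decX = inst := Subsingleton.elim _ _
    rw [baseAlg_update, baseAlg_update ρ m x a, baseAlg_update ρ m x b, map_add, add_mul]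
  map_update_smul' := by
    intro inst m x c a
    obtain rfl : decX = inst := Subsingleton.elim _ _
    rw [baseAlg_update, baseAlg_update ρ m x a, map_smul, smul_mul_assoc]

end Wreath

/-! ### Multiplicity spaces and finite support -/

section Multiplicity

open Wreath

variable {H X Q : Type*} [Group H] [TopologicalSpace H] [Group Q] [MulAction Q X] [DecidableEq X]
  {V W : Type*} [AddCommGroup V] [Module ℂ V] [AddCommGroup W] [Module ℂ W]

/-- The first index of a representation. -/
def IrrDual.zero (d : IrrDual H) : Fin d.1 := ⟨0, d.deg_pos⟩

/-- The first basis vector. -/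
def IrrDual.vec (d : IrrDual H) : Fin d.1 → ℂ := Pi.single d.zero 1

theorem IrrDual.vec_ne_zero (d : IrrDual H) : d.vec ≠ 0 := by
  simp [IrrDual.vec]

/-- The space of vectors that transform under the factor `x` like the first basis vector of
`σ x`, for all `x`. -/
def multSpace (ρ : Representation ℂ (Wreath H X Q) V) (σ : X → IrrDual H) : Submodule ℂ V where
  carrier := {v | ∀ x, ∀ a : ℂ[H], (σ x).rep.asAlgebraHom a (σ x).vec = 0 → factorAlg ρ x a v = 0}
  add_mem' := fun hv hw x a ha => by rw [map_add, hv x a ha, hw x a ha, add_zero]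
  zero_mem' := fun x a _ => map_zero _
  smul_mem' := fun c v hv x a ha => by rw [map_smul, hv x a ha, smul_zero]

attribute [local instance] arrowAction

/-- Conjugation by `q` carries the factor `q⁻¹ • x` to the factor `x`, and `q • σ` takes at `x` the
value `σ (q⁻¹ • x)`. -/
theorem top_mem_multSpace {ρ : Representation ℂ (Wreath H X Q) V} {σ : X → IrrDual H} {v : V}
    (q : Q) (hv : v ∈ multSpace ρ σ) : ρ (top q) v ∈ multSpace ρ (q • σ) := by
  intro x a ha
  have h := top_factorAlg ρ q (q⁻¹ • x) a v
  rw [smul_inv_smul] at h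
  rw [← h, hv (q⁻¹ • x) a ha, map_zero]

theorem map_mem_multSpace {ρ : Representation ℂ (Wreath H X Q) V}
    {π : Representation ℂ (Wreath H X Q) W} (f : V →ₗ[ℂ] W) (hf : ∀ g v, f (ρ g v) = π g (f v))
    {σ : X → IrrDual H} {v : V} (hv : v ∈ multSpace ρ σ) : f v ∈ multSpace π σ := by
  intro x a ha
  rw [← factorAlg_map f hf, hv x a ha, map_zero]

theorem mem_multSpace_of_map {ρ : Representation ℂ (Wreath H X Q) V}
    {π : Representation ℂ (Wreath H X Q) W} (f : V →ₗ[ℂ] W) (hf : ∀ g v, f (ρ g v) = π g (f v))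
    (hi : Function.Injective f)
    {σ : X → IrrDual H} {v : V} (hv : f v ∈ multSpace π σ) : v ∈ multSpace ρ σ := by
  intro x a ha
  apply hi
  rw [factorAlg_map f hf, hv x a ha, map_zero]

/-- Only finitely many classes, namely those in `F`, are involved in the restrictions to the
factors of the base group. -/
def Supported (F : Finset (IrrDual H)) (ρ : Representation ℂ (Wreath H X Q) V) : Prop :=
  ∀ x, ∀ a : ℂ[H], (∀ d ∈ F, d.rep.asAlgebraHom a = 0) → factorAlg ρ x a = 0

theorem Supported.mono {F F' : Finset (IrrDual H)} (hF : F ⊆ F')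
    {ρ : Representation ℂ (Wreath H X Q) V} (h : Supported F ρ) : Supported F' ρ :=
  fun x a ha => h x a fun d hd => ha d (hF hd)

/-- The elements of `ℂ[H]` killing all classes in `F` form a two-sided ideal. Such an element can
therefore be moved past any group element, changing only by conjugation, until it meets a translate
of the cyclic vector `v` and kills it. -/
theorem supported_of_span {ρ : Representation ℂ (Wreath H X Q) V} {σ : X → IrrDual H} {v : V}
    (F : Finset (IrrDual H)) (hF : ∀ x, σ x ∈ F) (hv : v ∈ multSpace ρ σ)
    (hspan : Submodule.span ℂ (Set.range fun g => ρ g v) = ⊤) : Supported F ρ := by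
  intro x a ha
  refine LinearMap.ext_on hspan ?_
  rintro _ ⟨g, rfl⟩
  obtain ⟨b, q, rfl⟩ := Wreath.exists_eq g
  obtain ⟨a', ha', hcomm⟩ : ∃ a' : ℂ[H], (∀ d ∈ F, d.rep.asAlgebraHom a' = 0) ∧
      factorAlg ρ x a * ρ (base b) = ρ (base b) * factorAlg ρ x a' := by
    refine ⟨of ℂ H (b x)⁻¹ * a * of ℂ H (b x), fun d hd => by simp [ha d hd], ?_⟩
    have hb : factorAlg ρ x (of ℂ H (b x)) = ρ (base (Pi.mulSingle x (b x))) := by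
      rw [of_apply, factorAlg_single, one_smul]
    have hb' : factorAlg ρ x (of ℂ H (b x)⁻¹) = ρ (base (Pi.mulSingle x (b x)⁻¹)) := by
      rw [of_apply, factorAlg_single, one_smul]
    -- The part of `b` away from `x` commutes with the factor at `x`, so only the coordinate `b x`
    -- conjugates `a`.
    let c : X → H := Function.update b x 1
    have hbc : b = Pi.mulSingle x (b x) * c := by
      funext y
      by_cases hy : y = x
      · subst hy; simp [c]
      · simp [c, hy]
    have hc : ∀ a : ℂ[H], Commute (factorAlg ρ x a) (ρ (base c)) := by
      intro a
      induction a using MonoidAlgebra.induction_linear with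
      | zero => simp
      | add a a' ha ha' => rw [map_add]; exact ha.add_left ha'
      | single g r =>
        rw [factorAlg_single]
        refine Commute.smul_left ?_ _
        refine Commute.map (Commute.map ?_ base) ρ
        funext y
        by_cases hy : y = x
        · subst hy; simp [c]
        · simp [hy]
    have hb2 : ρ (base b) = factorAlg ρ x (of ℂ H (b x)) * ρ (base c) := by
      conv_lhs => rw [hbc]
      rw [map_mul, map_mul, hb]
    have hu : factorAlg ρ x (of ℂ H (b x)) * factorAlg ρ x (of ℂ H (b x)⁻¹) = 1 := by
      rw [← map_mul, ← map_mul, mul_inv_cancel, map_one, map_one]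
    rw [hb2, mul_assoc, ← (hc _).eq, ← mul_assoc, ← mul_assoc, map_mul, map_mul, ← mul_assoc,
      ← mul_assoc, hu, one_mul]
  have h1 : ρ (top q) v ∈ multSpace ρ (q • σ) := top_mem_multSpace q hv
  have h2 := h1 x a' (by rw [ha' ((q • σ) x) (hF (q⁻¹ • x)), LinearMap.zero_apply])
  change factorAlg ρ x a (ρ (base b * top q) v) = _
  rw [map_mul, Module.End.mul_apply, ← Module.End.mul_apply, hcomm, Module.End.mul_apply, h2,
    map_zero, LinearMap.zero_apply]

end Multiplicity

open Wreath

attribute [local instance] arrowAction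

/-! ### Projections onto multiplicity spaces and the degree formula -/

section Idempotents

variable {H X Q : Type*} [Group H] [TopologicalSpace H] [Group Q] [MulAction Q X] [DecidableEq X]
  {V : Type*} [AddCommGroup V] [Module ℂ V]

omit [DecidableEq X] in
theorem Wreath.continuous_base : Continuous (base : (X → H) → Wreath H X Q) := by
  refine continuous_inf_rng.2 ⟨continuous_induced_rng.2 ?_, continuous_induced_rng.2 ?_⟩
  · exact continuous_id
  · exact @continuous_const _ _ _ ⊥ (1 : Q)

theorem ContRep.factorRep {ρ : Representation ℂ (Wreath H X Q) V} (h : ContRep ρ) (x : X) :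
    ContRep (factorRep ρ x) := fun v l =>
  (h v l).comp (continuous_base.comp (continuous_mulSingle (A := fun _ : X => H) x))

/-- The factors are treated one at a time. Only stability of `U` under the base group is needed. -/
theorem exists_mem_multSpace [Fintype X] [FiniteDimensional ℂ V]
    {ρ : Representation ℂ (Wreath H X Q) V} (hc : ContRep ρ) (U : Submodule ℂ V)
    (hU : ∀ b : X → H, ∀ v ∈ U, ρ (base b) v ∈ U) (hne : U ≠ ⊥) :
    ∃ σ : X → IrrDual H, ∃ v ∈ U, v ≠ 0 ∧ v ∈ multSpace ρ σ := by
  have key : ∀ A : Finset X, ∃ v ∈ U, v ≠ 0 ∧ ∀ x ∈ A, ∃ d : IrrDual H, ∀ a : ℂ[H],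
      d.rep.asAlgebraHom a d.vec = 0 → factorAlg ρ x a v = 0 := by
    intro A
    induction A using Finset.induction_on with
    | empty =>
      obtain ⟨v, hv, hv0⟩ := (Submodule.ne_bot_iff U).1 hne
      exact ⟨v, hv, hv0, by simp⟩
    | insert y A hy ih =>
      obtain ⟨v, hvU, hv0, hv⟩ := ih
      choose σ hσ using hv
      -- Vectors already of the right type for the factors in `A`. Distinct factors commute, so `Y`
      -- is stable under the factor `y` and contains an irreducible representation of it; the image
      -- of the first basis vector is the new vector.
      let Y : Submodule ℂ V :=
        { carrier := {v | v ∈ U ∧ ∀ x hx, ∀ a : ℂ[H],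
            (σ x hx).rep.asAlgebraHom a (σ x hx).vec = 0 → factorAlg ρ x a v = 0}
          add_mem' := fun hv hw => ⟨U.add_mem hv.1 hw.1, fun x hx a ha => by
            rw [map_add, hv.2 x hx a ha, hw.2 x hx a ha, add_zero]⟩
          zero_mem' := ⟨U.zero_mem, fun _ _ _ _ => map_zero _⟩
          smul_mem' := fun c v hv => ⟨U.smul_mem c hv.1, fun x hx a ha => by
            rw [map_smul, hv.2 x hx a ha, smul_zero]⟩ }
      have hY : Y ≠ ⊥ := (Submodule.ne_bot_iff Y).2 ⟨v, ⟨hvU, hσ⟩, hv0⟩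
      obtain ⟨d, f, hf, hf2, hf3⟩ := exists_irrDual_intertwining (RepZeta.factorRep ρ y)
        (hc.factorRep y) Y (by
          rintro h w ⟨hw1, hw2⟩
          refine ⟨hU _ _ hw1, fun x hx a ha => ?_⟩
          have hxy : x ≠ y := by rintro rfl; exact hy hx
          have e : RepZeta.factorRep ρ y h = factorAlg ρ y (single h 1) := by
            rw [factorAlg_single, one_smul]; rfl
          rw [e, ← Module.End.mul_apply, (factorAlg_commute ρ hxy _ _).eq, Module.End.mul_apply,
            hw2 x hx a ha, map_zero]) hY
      refine ⟨f d.vec, (hf3 _).1, ?_, ?_⟩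
      · rw [Ne, map_eq_zero_iff f hf]
        exact d.vec_ne_zero
      · intro x hx
        rcases Finset.mem_insert.1 hx with rfl | hx
        · refine ⟨d, fun a ha => ?_⟩
          have := intertwining_asAlgebraHom (σ := RepZeta.factorRep ρ x) f hf2 a d.vec
          rw [ha, map_zero] at this
          exact this.symm
        · exact ⟨σ x hx, (hf3 _).2 x hx⟩
  obtain ⟨v, hvU, hv0, hv⟩ := key Finset.univ
  choose σ hσ using fun x => hv x (Finset.mem_univ x)
  exact ⟨σ, v, hvU, hv0, hσ⟩

/-- Only finitely many classes are involved in the restrictions to the factors of the base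
group. -/
def FinSupported (ρ : Representation ℂ (Wreath H X Q) V) : Prop :=
  ∃ F : Finset (IrrDual H), Supported F ρ

theorem FinSupported.exists_superset {ρ : Representation ℂ (Wreath H X Q) V}
    (h : FinSupported ρ) {S : Set (IrrDual H)} (hS : S.Finite) :
    ∃ F : Finset (IrrDual H), Supported F ρ ∧ S ⊆ F := by
  classical
  obtain ⟨F, hF⟩ := h
  exact ⟨F ∪ hS.toFinset, hF.mono Finset.subset_union_left, fun d hd => by simp [hd]⟩

/-- The elementary endomorphisms. -/
def elemEnd {n : ℕ} (i j : Fin n) : Module.End ℂ (Fin n → ℂ) :=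
  (LinearMap.single ℂ (fun _ => ℂ) i) ∘ₗ (LinearMap.proj j)

theorem elemEnd_apply {n : ℕ} (i j : Fin n) (v : Fin n → ℂ) :
    elemEnd i j v = Pi.single i (v j) := rfl

theorem elemEnd_mul {n : ℕ} (i j k : Fin n) : elemEnd i j * elemEnd j k = elemEnd i k := by
  ext v
  simp [elemEnd_apply]

theorem sum_elemEnd (n : ℕ) : ∑ i : Fin n, elemEnd i i = 1 := by
  refine LinearMap.ext fun v => ?_
  rw [LinearMap.sum_apply]
  simp only [elemEnd_apply]
  exact Finset.univ_sum_single v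

open Classical in
/-- An element of the group algebra that acts by `T` on `d` and by zero on the other classes in
`F`. -/
def isolate (F : Finset (IrrDual H)) (d : IrrDual H) (T : Module.End ℂ (Fin d.1 → ℂ)) : ℂ[H] :=
  (exists_lift F (Pi.single d T)).choose

theorem isolate_same {F : Finset (IrrDual H)} {d : IrrDual H} (hd : d ∈ F)
    (T : Module.End ℂ (Fin d.1 → ℂ)) : d.rep.asAlgebraHom (isolate F d T) = T := by
  classical
  rw [isolate, (exists_lift F (Pi.single d T)).choose_spec d hd, Pi.single_eq_same]

theorem isolate_of_ne {F : Finset (IrrDual H)} {d d' : IrrDual H} (hd' : d' ∈ F) (h : d' ≠ d)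
    (T : Module.End ℂ (Fin d.1 → ℂ)) : d'.rep.asAlgebraHom (isolate F d T) = 0 := by
  classical
  rw [isolate, (exists_lift F (Pi.single d T)).choose_spec d' hd', Pi.single_eq_of_ne h]

theorem Supported.factorAlg_eq {F : Finset (IrrDual H)} {ρ : Representation ℂ (Wreath H X Q) V}
    (h : Supported F ρ) (x : X) {a b : ℂ[H]}
    (hab : ∀ d ∈ F, d.rep.asAlgebraHom a = d.rep.asAlgebraHom b) :
    factorAlg ρ x a = factorAlg ρ x b := by
  rw [← sub_eq_zero, ← map_sub]
  exact h x _ fun d hd => by rw [map_sub, hab d hd, sub_self]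

theorem Supported.factorAlg_eq_isolate {F : Finset (IrrDual H)}
    {ρ : Representation ℂ (Wreath H X Q) V}
    (h : Supported F ρ) (x : X) {a : ℂ[H]} {d : IrrDual H} {T : Module.End ℂ (Fin d.1 → ℂ)}
    (h1 : d.rep.asAlgebraHom a = T) (h2 : ∀ d' ∈ F, d' ≠ d → d'.rep.asAlgebraHom a = 0) :
    factorAlg ρ x a = factorAlg ρ x (isolate F d T) := by
  refine h.factorAlg_eq x fun d' hd' => ?_
  by_cases hdd : d' = d
  · subst hdd; rw [isolate_same hd', h1]
  · rw [isolate_of_ne hd' hdd, h2 d' hd' hdd]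

variable [Fintype X]

/-- The projection onto `multSpace ρ σ`. -/
def idem (ρ : Representation ℂ (Wreath H X Q) V) (F : Finset (IrrDual H)) (σ : X → IrrDual H) :
    Module.End ℂ V :=
  baseAlg ρ fun x => isolate F (σ x) (elemEnd (σ x).zero (σ x).zero)

-- The annihilator condition defining `multSpace`, applied to `a - c • 1`, transfers eigenvector
-- relations from the first basis vector to `v`.
omit [Fintype X] in
theorem factorAlg_eq_smul {ρ : Representation ℂ (Wreath H X Q) V} {σ : X → IrrDual H}
    {v : V} (hv : v ∈ multSpace ρ σ) {x : X} {a : ℂ[H]} {c : ℂ}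
    (h : (σ x).rep.asAlgebraHom a (σ x).vec = c • (σ x).vec) : factorAlg ρ x a v = c • v := by
  have := hv x (a - c • 1) (by simp [h])
  simpa [sub_eq_zero] using this

/-- With `E` the first diagonal matrix unit and `e` the first basis vector, `E T e = T₀₀ e` in each
factor. Thus the base group moves vectors of `multSpace` only by scalars, once projected back. -/
theorem idem_base_apply {ρ : Representation ℂ (Wreath H X Q) V} {F : Finset (IrrDual H)}
    {σ : X → IrrDual H} (hσ : ∀ x, σ x ∈ F) {v : V} (hv : v ∈ multSpace ρ σ) (b : X → H) :
    ∃ c : ℂ, idem ρ F σ (ρ (base b) v) = c • v := by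
  rw [← baseAlg_of, idem, ← Module.End.mul_apply, ← map_mul]
  refine baseAlg_scalar ρ fun x => ⟨(σ x).rep (b x) (σ x).vec (σ x).zero, ?_⟩
  refine factorAlg_eq_smul hv ?_
  rw [Pi.mul_apply, map_mul, isolate_same (hσ x), Representation.asAlgebraHom_of,
    Module.End.mul_apply, elemEnd_apply, IrrDual.vec, ← Pi.single_smul]
  simp

theorem idem_apply_of_mem {ρ : Representation ℂ (Wreath H X Q) V} {F : Finset (IrrDual H)}
    {σ : X → IrrDual H} (hσ : ∀ x, σ x ∈ F) {v : V} (hv : v ∈ multSpace ρ σ) :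
    idem ρ F σ v = v := by
  refine baseAlg_fix ρ fun x => ?_
  rw [factorAlg_eq_smul (c := 1) hv, one_smul]
  rw [isolate_same (hσ x), elemEnd_apply, IrrDual.vec]
  simp

/-- An `a` killing the first basis vector of `σ x`, times the isolated matrix unit, is zero on every
class in `F`: on `σ x` because the matrix unit has image in the line of that vector, on the others
because the isolated element vanishes there. -/
theorem idem_apply_mem {ρ : Representation ℂ (Wreath H X Q) V} {F : Finset (IrrDual H)}
    (hF : Supported F ρ) (σ : X → IrrDual H) (v : V) :
    idem ρ F σ v ∈ multSpace ρ σ := by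
  intro x a ha
  rw [idem, ← baseAlg_mulSingle, ← Module.End.mul_apply, ← map_mul, baseAlg_eq_zero ρ x,
    LinearMap.zero_apply]
  refine hF x _ fun d hd => ?_
  rw [Pi.mul_apply, Pi.mulSingle_eq_same, map_mul]
  by_cases hdx : d = σ x
  · subst hdx
    rw [isolate_same hd]
    refine LinearMap.ext fun w => ?_
    rw [Module.End.mul_apply, elemEnd_apply]
    have : (Pi.single (σ x).zero (w (σ x).zero) : Fin (σ x).1 → ℂ) =
        w (σ x).zero • (σ x).vec := by
      rw [IrrDual.vec, ← Pi.single_smul]; simp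
    rw [this, map_smul, ha, smul_zero, LinearMap.zero_apply]
  · rw [isolate_of_ne hd hdx, mul_zero]

/-- At a factor where `σ` and `σ'` differ, the product of the two isolated elements around `b x`
vanishes on every class in `F`, whatever `b` is. -/
theorem idem_base_apply_of_ne {ρ : Representation ℂ (Wreath H X Q) V} {F : Finset (IrrDual H)}
    (hF : Supported F ρ) {σ σ' : X → IrrDual H} (hσ' : ∀ x, σ' x ∈ F)
    (hne : σ ≠ σ') {v : V} (hv : v ∈ multSpace ρ σ') (b : X → H) :
    idem ρ F σ (ρ (base b) v) = 0 := by
  obtain ⟨x, hx⟩ := Function.ne_iff.1 hne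
  rw [← idem_apply_of_mem hσ' hv, ← baseAlg_of, idem, idem, ← Module.End.mul_apply,
    ← Module.End.mul_apply, ← map_mul, ← map_mul, baseAlg_eq_zero ρ x, LinearMap.zero_apply]
  refine hF x _ fun d hd => ?_
  rw [Pi.mul_apply, Pi.mul_apply, map_mul, map_mul]
  by_cases hdx : d = σ x
  · rw [isolate_of_ne (d := σ' x) hd (hdx ▸ hx), mul_zero]
  · rw [isolate_of_ne (d := σ x) hd hdx, zero_mul, zero_mul]

/-- The subrepresentation generated by a subspace. -/
def repSpan {G : Type*} [Group G] (ρ : Representation ℂ G V) (Γ : Submodule ℂ V) :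
    Submodule ℂ V :=
  ⨆ g, Γ.map (ρ g)

theorem repSpan_mem {G : Type*} [Group G] {ρ : Representation ℂ G V} {Γ : Submodule ℂ V} (g : G)
    {v : V} (hv : v ∈ Γ) : ρ g v ∈ repSpan ρ Γ :=
  Submodule.mem_iSup_of_mem g ⟨v, hv, rfl⟩

theorem le_repSpan {G : Type*} [Group G] (ρ : Representation ℂ G V) (Γ : Submodule ℂ V) :
    Γ ≤ repSpan ρ Γ := by
  intro v hv
  simpa using repSpan_mem (ρ := ρ) (1 : G) hv

theorem repSpan_le {G : Type*} [Group G] {ρ : Representation ℂ G V} {Γ U : Submodule ℂ V}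
    (h : ∀ g, ∀ v ∈ Γ, ρ g v ∈ U) : repSpan ρ Γ ≤ U :=
  iSup_le fun g => Submodule.map_le_iff_le_comap.2 fun v hv => h g v hv

theorem repSpan_stable {G : Type*} [Group G] (ρ : Representation ℂ G V) (Γ : Submodule ℂ V) (g : G)
    (v : V) (hv : v ∈ repSpan ρ Γ) : ρ g v ∈ repSpan ρ Γ := by
  have : repSpan ρ Γ ≤ (repSpan ρ Γ).comap (ρ g) := repSpan_le fun g' w hw => by
    change ρ g (ρ g' w) ∈ repSpan ρ Γ
    rw [← Module.End.mul_apply, ← map_mul]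
    exact repSpan_mem _ hw
  exact this hv

/-- The main tool. A translate of `v ∈ Γ` by `base b * top q` projects to a multiple of `top q • v ∈
Γ` if `q` fixes `σ`, and to zero otherwise. So `idem` maps the generated subrepresentation into `Γ`,
while it fixes `w`. -/
theorem mem_of_mem_repSpan {ρ : Representation ℂ (Wreath H X Q) V} (hρ : FinSupported ρ)
    {σ : X → IrrDual H} {Γ : Submodule ℂ V} (hΓ : Γ ≤ multSpace ρ σ)
    (hst : ∀ q : Q, q • σ = σ → ∀ v ∈ Γ, ρ (top q) v ∈ Γ) {w : V}
    (hw : w ∈ repSpan ρ Γ) (hwσ : w ∈ multSpace ρ σ) : w ∈ Γ := by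
  obtain ⟨F, hF, hσF⟩ := hρ.exists_superset (Set.finite_range σ)
  have hσ : ∀ x, σ x ∈ F := fun x => hσF ⟨x, rfl⟩
  have : repSpan ρ Γ ≤ Γ.comap (idem ρ F σ) := repSpan_le fun g v hv => by
    change idem ρ F σ (ρ g v) ∈ Γ
    obtain ⟨b, q, rfl⟩ := Wreath.exists_eq g
    have h1 := top_mem_multSpace q (hΓ hv)
    rw [map_mul, Module.End.mul_apply]
    by_cases hq : q • σ = σ
    · rw [hq] at h1
      obtain ⟨c, hc⟩ := idem_base_apply hσ h1 b
      rw [hc]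
      exact Γ.smul_mem _ (hst q hq v hv)
    · rw [idem_base_apply_of_ne hF (fun x => hσ _) (Ne.symm hq) h1]
      exact Γ.zero_mem
  have h2 := this hw
  change idem ρ F σ w ∈ Γ at h2
  rwa [idem_apply_of_mem hσ hwσ] at h2

/-- If `σ'` were outside the orbit, its projection would kill every translate of `multSpace ρ σ`,
yet it fixes `w ≠ 0`. -/
theorem mem_orbit_of_mem_repSpan {ρ : Representation ℂ (Wreath H X Q) V} (hρ : FinSupported ρ)
    {σ σ' : X → IrrDual H} {w : V}
    (hw : w ∈ repSpan ρ (multSpace ρ σ)) (hwσ : w ∈ multSpace ρ σ') (hw0 : w ≠ 0) :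
    σ' ∈ MulAction.orbit Q σ := by
  obtain ⟨F, hF, hσF⟩ := hρ.exists_superset ((Set.finite_range σ).union (Set.finite_range σ'))
  have hσ : ∀ x, σ x ∈ F := fun x => hσF (Or.inl ⟨x, rfl⟩)
  have hσ' : ∀ x, σ' x ∈ F := fun x => hσF (Or.inr ⟨x, rfl⟩)
  by_contra hno
  have : repSpan ρ (multSpace ρ σ) ≤ LinearMap.ker (idem ρ F σ') := repSpan_le fun g v hv => by
    obtain ⟨b, q, rfl⟩ := Wreath.exists_eq g
    rw [map_mul, Module.End.mul_apply, LinearMap.mem_ker]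
    refine idem_base_apply_of_ne hF (fun x => hσ _) ?_ (top_mem_multSpace q hv) b
    rintro rfl
    exact hno ⟨q, rfl⟩
  have h2 := this hw
  rw [LinearMap.mem_ker, idem_apply_of_mem hσ' hwσ] at h2
  exact hw0 h2

theorem repSpan_eq_top {G : Type*} [Group G] {ρ : Representation ℂ G V} (hi : ρ.IsIrreducible)
    {Γ : Submodule ℂ V} (hΓ : Γ ≠ ⊥) : repSpan ρ Γ = ⊤ := by
  refine (((isIrreducible_iff ρ).1 hi).2 _ (repSpan_stable ρ Γ)).resolve_left fun h => hΓ ?_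
  exact le_bot_iff.1 (h ▸ le_repSpan ρ Γ)

theorem mem_orbit_of_irreducible {ρ : Representation ℂ (Wreath H X Q) V} (hρ : FinSupported ρ)
    (hi : ρ.IsIrreducible) {σ σ' : X → IrrDual H} (h : multSpace ρ σ ≠ ⊥)
    (h' : multSpace ρ σ' ≠ ⊥) : σ' ∈ MulAction.orbit Q σ := by
  obtain ⟨w, hw, hw0⟩ := (Submodule.ne_bot_iff _).1 h'
  refine mem_orbit_of_mem_repSpan hρ (w := w) ?_ hw hw0
  rw [repSpan_eq_top hi h]
  trivial

theorem exists_multSpace_ne_bot [FiniteDimensional ℂ V] {ρ : Representation ℂ (Wreath H X Q) V}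
    (hc : ContRep ρ) (hi : ρ.IsIrreducible) : ∃ σ : X → IrrDual H, multSpace ρ σ ≠ ⊥ := by
  have := ((isIrreducible_iff ρ).1 hi).1
  obtain ⟨σ, v, -, hv0, hv⟩ := exists_mem_multSpace hc ⊤ (fun _ _ _ => trivial) top_ne_bot
  exact ⟨σ, (Submodule.ne_bot_iff _).2 ⟨v, hv, hv0⟩⟩

theorem finSupported_of_irreducible [FiniteDimensional ℂ V]
    {ρ : Representation ℂ (Wreath H X Q) V}
    (hc : ContRep ρ) (hi : ρ.IsIrreducible) : FinSupported ρ := by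
  classical
  obtain ⟨σ, hσ⟩ := exists_multSpace_ne_bot hc hi
  obtain ⟨v, hv, hv0⟩ := (Submodule.ne_bot_iff _).1 hσ
  refine ⟨Finset.univ.image σ, supported_of_span _ (fun x => by simp) hv ?_⟩
  have h1 : repSpan ρ (Submodule.span ℂ {v}) = ⊤ := repSpan_eq_top hi (by simpa using hv0)
  rw [eq_top_iff, ← h1]
  refine repSpan_le fun g w hw => ?_
  obtain ⟨c, rfl⟩ := Submodule.mem_span_singleton.1 hw
  rw [map_smul]
  exact Submodule.smul_mem _ _ (Submodule.subset_span ⟨g, rfl⟩)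

theorem trace_idem [FiniteDimensional ℂ V] {ρ : Representation ℂ (Wreath H X Q) V}
    {F : Finset (IrrDual H)} (hF : Supported F ρ) {σ : X → IrrDual H} (hσ : ∀ x, σ x ∈ F) :
    LinearMap.trace ℂ V (idem ρ F σ) = finrank ℂ (multSpace ρ σ) :=
  LinearMap.IsProj.trace ⟨fun v => idem_apply_mem hF σ v, fun _ hv => idem_apply_of_mem hσ hv⟩

/-- In each factor the identity is the sum of the diagonal matrix units of all classes in `F`.
Multilinear expansion of the product and traces give the count. -/
theorem finrank_eq_sum [FiniteDimensional ℂ V] {ρ : Representation ℂ (Wreath H X Q) V}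
    {F : Finset (IrrDual H)} (hF : Supported F ρ) :
    finrank ℂ V = ∑ j : X → (Σ d : F, Fin d.1.1), finrank ℂ (multSpace ρ fun x => (j x).1.1) := by
  let e : (Σ d : F, Fin d.1.1) → ℂ[H] := fun k => isolate F k.1.1 (elemEnd k.2 k.2)
  have h1 : (1 : Module.End ℂ V) = ∑ j : X → (Σ d : F, Fin d.1.1), baseAlg ρ fun x => e (j x) := by
    rw [← map_one (baseAlg ρ)]
    have h2 : baseAlg ρ 1 = baseAlg ρ (fun _ => ∑ k, e k) := by
      refine baseAlg_congr ρ fun x => hF.factorAlg_eq x fun d hd => ?_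
      rw [Pi.one_apply, map_one, Fintype.sum_sigma, map_sum, Finset.sum_eq_single ⟨d, hd⟩,
        map_sum]
      · rw [← sum_elemEnd]
        exact Finset.sum_congr rfl fun i _ => (isolate_same hd _).symm
      · intro d' _ hdd
        rw [map_sum]
        refine Finset.sum_eq_zero fun i _ => isolate_of_ne hd ?_ _
        rintro rfl
        exact hdd rfl
      · simp
    rw [h2]
    exact (baseAlgMultilinear ρ).map_sum fun _ k => e k
  have h2 : (finrank ℂ V : ℂ) = ∑ j : X → (Σ d : F, Fin d.1.1),
      (finrank ℂ (multSpace ρ fun x => (j x).1.1) : ℂ) := by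
    rw [← LinearMap.trace_one ℂ V, h1, map_sum]
    refine Finset.sum_congr rfl fun j _ => ?_
    rw [← trace_idem hF fun x => (j x).1.2]
    -- Factoring `E_jj = E_j0 E_0j` and exchanging the factors under the trace replaces the index
    -- `j` by the first one, so each term has the trace of `idem`.
    let u : X → ℂ[H] := fun x => isolate F (j x).1.1 (elemEnd (j x).2 (j x).1.1.zero)
    let w : X → ℂ[H] := fun x => isolate F (j x).1.1 (elemEnd (j x).1.1.zero (j x).2)
    have hu : baseAlg ρ (fun x => e (j x)) = baseAlg ρ u * baseAlg ρ w := by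
      rw [← map_mul]
      refine baseAlg_congr ρ fun x => (hF.factorAlg_eq_isolate x ?_ ?_).symm
      · rw [Pi.mul_apply, map_mul, isolate_same (j x).1.2, isolate_same (j x).1.2, elemEnd_mul]
      · intro d hd hdx
        rw [Pi.mul_apply, map_mul, isolate_of_ne hd hdx, zero_mul]
    have hw : idem ρ F (fun x => (j x).1.1) = baseAlg ρ w * baseAlg ρ u := by
      rw [← map_mul]
      refine baseAlg_congr ρ fun x => (hF.factorAlg_eq_isolate x ?_ ?_).symm
      · rw [Pi.mul_apply, map_mul, isolate_same (j x).1.2, isolate_same (j x).1.2, elemEnd_mul]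
      · intro d hd hdx
        rw [Pi.mul_apply, map_mul, isolate_of_ne hd hdx, zero_mul]
    rw [hu, hw, LinearMap.trace_mul_comm]
  exact_mod_cast h2

omit [Fintype X] in
theorem finrank_multSpace_smul [FiniteDimensional ℂ V] (ρ : Representation ℂ (Wreath H X Q) V)
    (q : Q) (σ : X → IrrDual H) :
    finrank ℂ (multSpace ρ (q • σ)) = finrank ℂ (multSpace ρ σ) := by
  have key : ∀ (q : Q) (σ : X → IrrDual H),
      finrank ℂ (multSpace ρ σ) ≤ finrank ℂ (multSpace ρ (q • σ)) := by
    intro q σ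
    refine LinearMap.finrank_le_finrank_of_injective
      (f := (ρ (top q)).restrict fun v hv => top_mem_multSpace q hv) ?_
    intro v w hvw
    have h := congrArg Subtype.val hvw
    apply Subtype.ext
    have h2 := congrArg (ρ (top q)⁻¹) h
    simpa [LinearMap.coe_restrict_apply, ← Module.End.mul_apply, ← map_mul] using h2
  refine le_antisymm ?_ (key q σ)
  have := key q⁻¹ (q • σ)
  rwa [inv_smul_smul] at this

/-- The degree of the representation of the base group associated with a family of classes. -/
def famDeg (σ : X → IrrDual H) : ℕ := ∏ x, (σ x).1

omit [DecidableEq X] in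
theorem famDeg_smul (q : Q) (σ : X → IrrDual H) : famDeg (q • σ) = famDeg σ :=
  Fintype.prod_equiv (MulAction.toPerm q⁻¹) _ _ fun _ => rfl

theorem finrank_eq_of_irreducible [Finite Q] [FiniteDimensional ℂ V]
    {ρ : Representation ℂ (Wreath H X Q) V} (hc : ContRep ρ) (hi : ρ.IsIrreducible)
    {σ : X → IrrDual H} (hσ : multSpace ρ σ ≠ ⊥) :
    finrank ℂ V = Nat.card (MulAction.orbit Q σ) * famDeg σ * finrank ℂ (multSpace ρ σ) := by
  classical
  have hs := finSupported_of_irreducible hc hi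
  obtain ⟨F, hF, hσF⟩ := hs.exists_superset (Set.finite_range σ)
  have hO : ∀ σ' ∈ MulAction.orbit Q σ, ∀ x, σ' x ∈ F := by
    rintro _ ⟨q, rfl⟩ x
    exact hσF ⟨_, rfl⟩
  rw [finrank_eq_sum hF]
  let s : (X → (Σ d : F, Fin d.1.1)) → (X → IrrDual H) := fun j x => (j x).1.1
  have h1 : ∀ j : X → (Σ d : F, Fin d.1.1), finrank ℂ (multSpace ρ (s j)) =
      if s j ∈ MulAction.orbit Q σ then finrank ℂ (multSpace ρ σ) else 0 := by
    intro j
    split_ifs with h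
    · obtain ⟨q, hq⟩ := h
      rw [← hq]
      exact finrank_multSpace_smul ρ q σ
    · have : multSpace ρ (s j) = ⊥ := by
        by_contra hne
        exact h (mem_orbit_of_irreducible hs hi hσ hne)
      rw [this, finrank_bot]
  rw [Finset.sum_congr rfl fun j _ => h1 j, ← Finset.sum_filter, Finset.sum_const, smul_eq_mul]
  congr 1
  rw [← Fintype.card_subtype, ← Nat.card_eq_fintype_card]
  -- A contributing index is a family in the orbit together with a basis index at each `x`, whence
  -- `|Qσ| · famDeg σ` of them.
  let eqv : {j // s j ∈ MulAction.orbit Q σ} ≃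
      Σ σ' : MulAction.orbit Q σ, ∀ x, Fin (σ'.1 x).1 :=
    { toFun := fun j => ⟨⟨s j.1, j.2⟩, fun x => (j.1 x).2⟩
      invFun := fun p => ⟨fun x => ⟨⟨p.1.1 x, hO _ p.1.2 x⟩, p.2 x⟩, p.1.2⟩
      left_inv := fun j => rfl
      right_inv := fun p => rfl }
  have : Finite (MulAction.orbit Q σ) := Set.finite_range _
  have : Fintype (MulAction.orbit Q σ) := Fintype.ofFinite _
  rw [Nat.card_congr eqv, Nat.card_sigma]
  have h2 : ∀ σ' : MulAction.orbit Q σ, Nat.card (∀ x, Fin (σ'.1 x).1) = famDeg σ := by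
    rintro ⟨_, q, rfl⟩
    change Nat.card (∀ x, Fin ((q • σ) x).1) = famDeg σ
    rw [Nat.card_pi, ← famDeg_smul q σ]
    simp [famDeg]
  rw [Finset.sum_congr rfl fun σ' _ => h2 σ', Finset.sum_const, smul_eq_mul, Finset.card_univ,
    Nat.card_eq_fintype_card]

end Idempotents

/-! ### Clifford correspondence with representations of the stabilizer -/

section Correspondence

variable {H X Q : Type*} [Group H] [TopologicalSpace H] [Group Q] [MulAction Q X] [DecidableEq X]
  {V W : Type*} [AddCommGroup V] [Module ℂ V] [AddCommGroup W] [Module ℂ W]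

/-- The representation of the stabilizer of `σ` on the multiplicity space. -/
def multRep (ρ : Representation ℂ (Wreath H X Q) V) (σ : X → IrrDual H) :
    Representation ℂ (MulAction.stabilizer Q σ) (multSpace ρ σ) where
  toFun q := (ρ (top q.1)).restrict fun v hv => by
    have := top_mem_multSpace q.1 hv
    rwa [q.2] at this
  map_one' := by ext; simp
  map_mul' := fun q q' => by ext; simp

variable [Fintype X]

/-- A nonzero stable `U` generates all of `V` by irreducibility, and what it generates meets
`multSpace` only in `U`. -/
theorem multRep_irreducible {ρ : Representation ℂ (Wreath H X Q) V} (hs : FinSupported ρ)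
    (hi : ρ.IsIrreducible) {σ : X → IrrDual H} (hσ : multSpace ρ σ ≠ ⊥) :
    (multRep ρ σ).IsIrreducible := by
  rw [isIrreducible_iff]
  refine ⟨Submodule.nontrivial_iff_ne_bot.2 hσ, fun U hU => ?_⟩
  by_cases h0 : U = ⊥
  · exact Or.inl h0
  right
  rw [eq_top_iff]
  rintro ⟨w, hw⟩ -
  have hΓ : U.map (multSpace ρ σ).subtype ≠ ⊥ := fun h =>
    h0 (Submodule.map_injective_of_injective (multSpace ρ σ).injective_subtype
      (h.trans (Submodule.map_bot _).symm))
  have := mem_of_mem_repSpan hs (Γ := U.map (multSpace ρ σ).subtype)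
    (Submodule.map_subtype_le _ _) (by
      rintro q hq _ ⟨u, hu, rfl⟩
      exact ⟨_, hU ⟨q, hq⟩ u hu, rfl⟩) (w := w) (by rw [repSpan_eq_top hi hΓ]; trivial) hw
  obtain ⟨u, hu, huw⟩ := this
  have : u = ⟨w, hw⟩ := Subtype.ext huw
  rwa [← this]

omit [Fintype X] in
theorem FinSupported.prod {ρ : Representation ℂ (Wreath H X Q) V}
    {π : Representation ℂ (Wreath H X Q) W} (hρ : FinSupported ρ) (hπ : FinSupported π) :
    FinSupported (ρ.prod π) := by
  obtain ⟨F, hF⟩ := hρ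
  obtain ⟨F', hF', hFF⟩ := hπ.exists_superset F.finite_toSet
  have hF := hF.mono hFF
  refine ⟨F', fun x a ha => LinearMap.ext fun v => Prod.ext ?_ ?_⟩
  · have := factorAlg_map (ρ := ρ.prod π) (σ := ρ) (LinearMap.fst ℂ V W) (fun _ _ => rfl) x a v
    rw [hF x a ha] at this
    exact this
  · have := factorAlg_map (ρ := ρ.prod π) (σ := π) (LinearMap.snd ℂ V W) (fun _ _ => rfl) x a v
    rw [hF' x a ha] at this
    exact this

/-- A Goursat argument: the graph of `e` generates a subrepresentation of `V × W` which turns out to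
be the graph of an isomorphism. -/
theorem equiv_of_multRep_equiv {ρ : Representation ℂ (Wreath H X Q) V}
    {π : Representation ℂ (Wreath H X Q) W} (hρ : FinSupported ρ) (hπ : FinSupported π)
    (hρi : ρ.IsIrreducible) (hπi : π.IsIrreducible) {σ : X → IrrDual H} (hσ : multSpace ρ σ ≠ ⊥)
    (e : (multRep ρ σ).Equiv (multRep π σ)) : Nonempty (ρ.Equiv π) := by
  have hei : ∀ q v, e (multRep ρ σ q v) = multRep π σ q (e v) :=
    fun q v => e.toIntertwiningMap.isIntertwining _ _ q v
  let j : multSpace ρ σ →ₗ[ℂ] V × W :=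
    (multSpace ρ σ).subtype.prod ((multSpace π σ).subtype ∘ₗ (e.toLinearEquiv : _ →ₗ[ℂ] _))
  have hj : ∀ v, j v = (v.1, (e v).1) := fun v => rfl
  let Γ : Submodule ℂ (V × W) := LinearMap.range j
  let ω := ρ.prod π
  have hω : FinSupported ω := hρ.prod hπ
  have hprodσ : ∀ v w, v ∈ multSpace ρ σ → w ∈ multSpace π σ → (v, w) ∈ multSpace ω σ := by
    intro v w hv hw
    have h1 := map_mem_multSpace (ρ := ρ) (π := ω) (LinearMap.inl ℂ V W)
      (fun g v => by simp [ω]) hv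
    have h2 := map_mem_multSpace (ρ := π) (π := ω) (LinearMap.inr ℂ V W)
      (fun g v => by simp [ω]) hw
    have := (multSpace ω σ).add_mem h1 h2
    simpa using this
  have hΓσ : Γ ≤ multSpace ω σ := by
    rintro _ ⟨v, rfl⟩
    exact hprodσ _ _ v.2 (e v).2
  have hst : ∀ q : Q, q • σ = σ → ∀ v ∈ Γ, ω (top q) v ∈ Γ := by
    rintro q hq _ ⟨v, rfl⟩
    refine ⟨multRep ρ σ ⟨q, hq⟩ v, ?_⟩
    rw [hj, hei]
    rfl
  have key := fun w => mem_of_mem_repSpan hω hΓσ hst (w := w)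
  let U := repSpan ω Γ
  have hU : ∀ g, ∀ u ∈ U, ω g u ∈ U := repSpan_stable ω Γ
  obtain ⟨v0, hv0, hv0n⟩ := (Submodule.ne_bot_iff _).1 hσ
  have he0 : (e ⟨v0, hv0⟩ : W) ≠ 0 := by
    intro h
    have : e ⟨v0, hv0⟩ = 0 := Subtype.ext h
    have h2 : e.toLinearEquiv ⟨v0, hv0⟩ = 0 := this
    rw [LinearEquiv.map_eq_zero_iff] at h2
    exact hv0n (congrArg Subtype.val h2)
  -- If `U` contained `V × 0`, then `(v0, 0)` would lie in `U` and in its multiplicity space, hence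
  -- on the graph of `e`, forcing `e v0 = 0`.
  have hl : U.comap (LinearMap.inl ℂ V W) = ⊥ := by
    refine (((isIrreducible_iff ρ).1 hρi).2 _ fun g v hv => ?_).resolve_right fun h => ?_
    · have := hU g _ hv
      simpa [ω] using this
    · have h1 : (v0, (0 : W)) ∈ U := by
        have : v0 ∈ U.comap (LinearMap.inl ℂ V W) := by rw [h]; trivial
        exact this
      obtain ⟨v, hv⟩ := key _ h1 (hprodσ _ _ hv0 (zero_mem _))
      rw [hj, Prod.mk.injEq] at hv
      have h3 : v = ⟨v0, hv0⟩ := Subtype.ext hv.1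
      exact he0 (h3 ▸ hv.2)
  have hr : U.comap (LinearMap.inr ℂ V W) = ⊥ := by
    refine (((isIrreducible_iff π).1 hπi).2 _ fun g v hv => ?_).resolve_right fun h => ?_
    · have := hU g _ hv
      simpa [ω] using this
    · have h1 : ((0 : V), (e ⟨v0, hv0⟩ : W)) ∈ U := by
        have : (e ⟨v0, hv0⟩ : W) ∈ U.comap (LinearMap.inr ℂ V W) := by rw [h]; trivial
        exact this
      obtain ⟨v, hv⟩ := key _ h1 (hprodσ _ _ (zero_mem _) (e ⟨v0, hv0⟩).2)
      rw [hj, Prod.mk.injEq] at hv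
      have h3 : v = 0 := Subtype.ext hv.1
      rw [h3] at hv
      have h4 : (e 0 : W) = 0 := congrArg Subtype.val (map_zero e.toLinearEquiv)
      exact he0 (hv.2.symm.trans h4)
  have hmem : (v0, (e ⟨v0, hv0⟩ : W)) ∈ U := le_repSpan ω Γ ⟨⟨v0, hv0⟩, rfl⟩
  let pl : U →ₗ[ℂ] V := LinearMap.fst ℂ V W ∘ₗ U.subtype
  let pr : U →ₗ[ℂ] W := LinearMap.snd ℂ V W ∘ₗ U.subtype
  have hpl : Function.Bijective pl := by
    constructor
    · rw [← LinearMap.ker_eq_bot, eq_bot_iff]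
      rintro ⟨⟨v, w⟩, hu⟩ h
      have hv : v = 0 := h
      subst hv
      have : w ∈ U.comap (LinearMap.inr ℂ V W) := hu
      rw [hr, Submodule.mem_bot] at this
      subst this
      exact Subtype.ext rfl
    · rw [← LinearMap.range_eq_top]
      refine (((isIrreducible_iff ρ).1 hρi).2 _ ?_).resolve_left fun h => ?_
      · rintro g _ ⟨u, rfl⟩
        exact ⟨⟨_, hU g u.1 u.2⟩, rfl⟩
      · have : v0 ∈ LinearMap.range pl := ⟨⟨_, hmem⟩, rfl⟩
        rw [h] at this
        exact hv0n this
  have hpr : Function.Bijective pr := by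
    constructor
    · rw [← LinearMap.ker_eq_bot, eq_bot_iff]
      rintro ⟨⟨v, w⟩, hu⟩ h
      have hv : w = 0 := h
      subst hv
      have : v ∈ U.comap (LinearMap.inl ℂ V W) := hu
      rw [hl, Submodule.mem_bot] at this
      subst this
      exact Subtype.ext rfl
    · rw [← LinearMap.range_eq_top]
      refine (((isIrreducible_iff π).1 hπi).2 _ ?_).resolve_left fun h => ?_
      · rintro g _ ⟨u, rfl⟩
        exact ⟨⟨_, hU g u.1 u.2⟩, rfl⟩
      · have : (e ⟨v0, hv0⟩ : W) ∈ LinearMap.range pr := ⟨⟨_, hmem⟩, rfl⟩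
        rw [h] at this
        exact he0 this
  let el := LinearEquiv.ofBijective pl hpl
  let er := LinearEquiv.ofBijective pr hpr
  refine ⟨.mk (el.symm.trans er) fun g => LinearMap.ext fun v => ?_⟩
  obtain ⟨u, rfl⟩ := el.surjective v
  have h1 : ρ g (el u) = el ⟨ω g u.1, hU g _ u.2⟩ := rfl
  have h2 : π g (er u) = er ⟨ω g u.1, hU g _ u.2⟩ := rfl
  simp only [LinearMap.comp_apply, LinearEquiv.coe_coe, LinearEquiv.trans_apply,
    LinearEquiv.symm_apply_apply]
  rw [h1, LinearEquiv.symm_apply_apply, h2]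

omit [Fintype X] in
theorem multSpace_ne_bot_of_equiv {ρ : Representation ℂ (Wreath H X Q) V}
    {π : Representation ℂ (Wreath H X Q) W} (e : ρ.Equiv π) {σ : X → IrrDual H}
    (h : multSpace ρ σ ≠ ⊥) : multSpace π σ ≠ ⊥ := by
  obtain ⟨v, hv, hv0⟩ := (Submodule.ne_bot_iff _).1 h
  refine (Submodule.ne_bot_iff _).2 ⟨e v, map_mem_multSpace (e.toLinearEquiv : V →ₗ[ℂ] W)
    (fun g v => e.toIntertwiningMap.isIntertwining _ _ g v) hv, ?_⟩
  intro h0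
  have h2 : e.toLinearEquiv v = 0 := h0
  rw [LinearEquiv.map_eq_zero_iff] at h2
  exact hv0 h2

omit [Fintype X] in
theorem multRep_equiv_of_equiv {ρ : Representation ℂ (Wreath H X Q) V}
    {π : Representation ℂ (Wreath H X Q) W} (e : ρ.Equiv π) (σ : X → IrrDual H) :
    Nonempty ((multRep ρ σ).Equiv (multRep π σ)) := by
  have he : ∀ g v, e (ρ g v) = π g (e v) :=
    fun g v => e.toIntertwiningMap.isIntertwining _ _ g v
  have he' : ∀ g v, e.symm (π g v) = ρ g (e.symm v) :=
    fun g v => e.symm.toIntertwiningMap.isIntertwining _ _ g v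
  let f : multSpace ρ σ ≃ₗ[ℂ] multSpace π σ :=
    { toFun := fun v => ⟨e v.1, map_mem_multSpace (e.toLinearEquiv : V →ₗ[ℂ] W) he v.2⟩
      invFun := fun v => ⟨e.symm v.1,
        map_mem_multSpace (e.symm.toLinearEquiv : W →ₗ[ℂ] V) he' v.2⟩
      map_add' := fun v w => Subtype.ext (map_add e.toLinearEquiv v.1 w.1)
      map_smul' := fun c v => Subtype.ext (map_smul e.toLinearEquiv c v.1)
      left_inv := fun v => Subtype.ext (e.symm_apply_apply v.1)
      right_inv := fun v => Subtype.ext (e.apply_symm_apply v.1) }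
  exact ⟨.mk f fun g => LinearMap.ext fun v => Subtype.ext (he _ _)⟩

/-- An irreducible representation of the stabilizer inside a multiplicity space of a
representation generates an irreducible representation of the wreath product. -/
theorem repSpan_irreducible [FiniteDimensional ℂ V] {ρ : Representation ℂ (Wreath H X Q) V}
    (hc : ContRep ρ) (hs : FinSupported ρ) {σ : X → IrrDual H} {E : Type*} [AddCommGroup E]
    [Module ℂ E] {τ : Representation ℂ (MulAction.stabilizer Q σ) E} (hτ : τ.IsIrreducible)
    (f : E →ₗ[ℂ] V) (hinj : Function.Injective f) (hmem : ∀ v, f v ∈ multSpace ρ σ)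
    (hf : ∀ q v, f (τ q v) = ρ (top q.1) (f v)) :
    ∃ S : Subrepresentation ρ, S.toRepresentation.IsIrreducible ∧
      Nonempty (τ.Equiv (multRep S.toRepresentation σ)) := by
  let Γ := LinearMap.range f
  have hΓσ : Γ ≤ multSpace ρ σ := by rintro _ ⟨v, rfl⟩; exact hmem v
  have hst : ∀ q : Q, q • σ = σ → ∀ v ∈ Γ, ρ (top q) v ∈ Γ := by
    rintro q hq _ ⟨v, rfl⟩
    exact ⟨τ ⟨q, hq⟩ v, hf _ _⟩
  obtain ⟨hnt, hτ2⟩ := (isIrreducible_iff τ).1 hτ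
  let S : Subrepresentation ρ := ⟨repSpan ρ Γ, fun g v hv => repSpan_stable ρ Γ g v hv⟩
  have hΓS : ∀ v, f v ∈ S.toSubmodule := fun v => le_repSpan ρ Γ ⟨v, rfl⟩
  refine ⟨S, ?_, ?_⟩
  · rw [isIrreducible_iff]
    refine ⟨?_, fun U hU => ?_⟩
    · obtain ⟨v, hv⟩ := exists_ne (0 : E)
      refine ⟨⟨f v, hΓS v⟩, 0, fun h => hv (hinj ?_)⟩
      rw [map_zero]
      exact congrArg Subtype.val h
    by_cases h0 : U = ⊥
    · exact Or.inl h0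
    right
    let U' : Submodule ℂ V := U.map S.toSubmodule.subtype
    have hU'S : U' ≤ repSpan ρ Γ := Submodule.map_subtype_le S.toSubmodule U
    have hU' : ∀ g, ∀ v ∈ U', ρ g v ∈ U' := by
      rintro g _ ⟨u, hu, rfl⟩
      exact ⟨_, hU g u hu, rfl⟩
    have hU'0 : U' ≠ ⊥ := fun h =>
      h0 (Submodule.map_injective_of_injective S.toSubmodule.injective_subtype
        (h.trans (Submodule.map_bot _).symm))
    -- A nonzero subrepresentation must meet some multiplicity space; its family lies in the orbit
    -- of `σ`, and translating back by `q⁻¹` gives a nonzero vector of `Γ` in `U'`.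
    obtain ⟨σ', v, hv, hv0, hvσ⟩ := exists_mem_multSpace hc U' (fun b v hv => hU' _ v hv) hU'0
    obtain ⟨q, rfl⟩ := mem_orbit_of_mem_repSpan hs (σ := σ)
      ((iSup_mono fun g => Submodule.map_mono hΓσ) (hU'S hv)) hvσ hv0
    have hvσ : v ∈ multSpace ρ (q • σ) := hvσ
    have h1 : ρ (top q⁻¹) v ∈ multSpace ρ σ := by
      have := top_mem_multSpace q⁻¹ hvσ
      rwa [inv_smul_smul] at this
    have h2 : ρ (top q⁻¹) v ∈ U' := hU' _ _ hv
    obtain ⟨u, hu⟩ := mem_of_mem_repSpan hs hΓσ hst (hU'S h2) h1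
    -- Irreducibility of `τ` upgrades one nonzero vector of `Γ` in `U'` to all of `Γ`, which
    -- generates.
    have hcomap : U'.comap f = ⊤ := by
      refine (hτ2 _ fun q w hw => ?_).resolve_left fun h => ?_
      · rw [Submodule.mem_comap, hf]
        exact hU' _ _ hw
      · have hu' : u ∈ U'.comap f := by rw [Submodule.mem_comap, hu]; exact h2
        rw [h, Submodule.mem_bot] at hu'
        rw [hu', map_zero] at hu
        have := congrArg (ρ (top q)) hu
        rw [map_zero, ← Module.End.mul_apply, ← map_mul, ← map_mul, mul_inv_cancel, map_one,
          map_one] at this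
        exact hv0 this.symm
    have hle : repSpan ρ Γ ≤ U' := by
      refine repSpan_le ?_
      rintro g _ ⟨w, rfl⟩
      refine hU' g _ ?_
      have : w ∈ U'.comap f := by rw [hcomap]; trivial
      exact this
    rw [eq_top_iff]
    rintro ⟨x, hx⟩ -
    obtain ⟨y, hy, hyx⟩ := hle hx
    have : y = ⟨x, hx⟩ := Subtype.ext hyx
    rwa [← this]
  · have hsub : ∀ g v, S.toSubmodule.subtype (S.toRepresentation g v) =
        ρ g (S.toSubmodule.subtype v) := fun g v => rfl
    let j : E →ₗ[ℂ] multSpace S.toRepresentation σ :=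
      { toFun := fun v => ⟨⟨f v, hΓS v⟩, mem_multSpace_of_map S.toSubmodule.subtype hsub
          S.toSubmodule.injective_subtype (hmem v)⟩
        map_add' := fun v w => by ext; exact map_add f v w
        map_smul' := fun c v => by ext; exact map_smul f c v }
    have hj : Function.Bijective j := by
      constructor
      · intro v w h
        exact hinj (congrArg (fun x => x.1.1) h)
      · rintro ⟨⟨w, hw⟩, hwσ⟩
        have h1 := map_mem_multSpace S.toSubmodule.subtype hsub hwσ
        obtain ⟨v, hv⟩ := mem_of_mem_repSpan hs hΓσ hst hw h1
        exact ⟨v, Subtype.ext (Subtype.ext hv)⟩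
    refine ⟨.mk (LinearEquiv.ofBijective j hj) fun q => LinearMap.ext fun v => ?_⟩
    exact Subtype.ext (Subtype.ext (hf q v))

end Correspondence

/-! ### Kronecker products of matrices -/

section Kronecker

variable {X K J R E : Type*} [Fintype X] [DecidableEq X] [Fintype K] [DecidableEq K]
  [Fintype J] [DecidableEq J] [AddCommGroup E] [Module ℂ E]

/-- The Kronecker product of a family of square matrices. -/
def piKronecker : (X → Matrix K K ℂ) →* Matrix (X → K) (X → K) ℂ where
  toFun m := Matrix.of fun j j' => ∏ x, m x (j x) (j' x)
  map_one' := by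
    ext j j'
    simp only [Matrix.of_apply, Pi.one_apply, Matrix.one_apply, Finset.prod_ite_zero]
    simp [funext_iff]
  map_mul' m n := by
    ext j j'
    simp only [Matrix.of_apply, Pi.mul_apply, Matrix.mul_apply, Finset.prod_univ_sum,
      Fintype.piFinset_univ, Finset.prod_mul_distrib]

theorem piKronecker_apply (m : X → Matrix K K ℂ) (j j' : X → K) :
    piKronecker m j j' = ∏ x, m x (j x) (j' x) := rfl

/-- This form exhibits linearity in `m`, which the multiplicative definition hides. -/
theorem piKronecker_mulSingle_apply (x : X) (m : Matrix K K ℂ) (j j' : X → K) :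
    piKronecker (Pi.mulSingle x m) j j' = m (j x) (j' x) *
      ∏ y ∈ Finset.univ.erase x, (1 : Matrix K K ℂ) (j y) (j' y) := by
  rw [piKronecker_apply, ← Finset.mul_prod_erase _ _ (Finset.mem_univ x), Pi.mulSingle_eq_same]
  congr 1
  refine Finset.prod_congr rfl fun y hy => ?_
  rw [Pi.mulSingle_eq_of_ne (Finset.ne_of_mem_erase hy)]

/-- Matrices act on vector-valued functions. -/
def matrixAct (J R E : Type*) [Fintype J] [DecidableEq J] [AddCommGroup E] [Module ℂ E] :
    Matrix J J ℂ →ₐ[ℂ] Module.End ℂ (J × R → E) :=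
  AlgHom.ofLinearMap
    { toFun := fun A =>
        { toFun := fun f p => ∑ j, A p.1 j • f (j, p.2)
          map_add' := fun f g => by
            funext p; simp [smul_add, Finset.sum_add_distrib]
          map_smul' := fun c f => by
            funext p; simp [Finset.smul_sum, smul_comm c] }
      map_add' := fun A B => by
        ext f p
        simp [add_smul, Finset.sum_add_distrib]
      map_smul' := fun c A => by
        ext f p
        simp [Finset.smul_sum, mul_smul] }
    (by
      ext f p
      simp [Matrix.one_apply])
    (fun A B => by
      refine LinearMap.ext fun f => funext fun p => ?_
      simp only [LinearMap.coe_mk, AddHom.coe_mk, Module.End.mul_apply, Matrix.mul_apply,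
        Finset.sum_smul, Finset.smul_sum, mul_smul]
      exact Finset.sum_comm)

theorem matrixAct_apply (A : Matrix J J ℂ) (f : J × R → E) (p : J × R) :
    matrixAct J R E A f p = ∑ j, A p.1 j • f (j, p.2) := rfl

end Kronecker

/-! ### A large representation of the wreath product -/

section TensorRep

variable {H X Q K E : Type*} [Group H] [Group Q] [MulAction Q X] [Fintype X]
  [DecidableEq X] [Fintype K] [DecidableEq K] [AddCommGroup E] [Module ℂ E]

/-- The tensor power of a representation of `H`, tensored with functions on `Q`, as a
representation of the wreath product. -/
def tensorRep (C : ℂ[H] →ₐ[ℂ] Matrix K K ℂ) (X Q E : Type*) [Group Q] [MulAction Q X] [Fintype X]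
    [DecidableEq X] [AddCommGroup E] [Module ℂ E] :
    Representation ℂ (Wreath H X Q) ((X → K) × Q → E) where
  toFun g := matrixAct (X → K) Q E (piKronecker fun x => C (of ℂ H (SemidirectProduct.left g x))) *
    LinearMap.funLeft ℂ E fun p => (SemidirectProduct.right g)⁻¹ • p
  map_one' := by
    have h1 : (fun x : X => C (of ℂ H (SemidirectProduct.left (1 : Wreath H X Q) x))) = 1 := by
      funext x
      change C (of ℂ H 1) = 1
      rw [map_one, map_one]
    rw [h1, map_one, map_one, one_mul]
    refine LinearMap.ext fun f => funext fun p => ?_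
    change f ((1 : Q)⁻¹ • p) = f p
    rw [inv_one, one_smul]
  map_mul' g g' := by
    have h1 : (fun x : X => C (of ℂ H (SemidirectProduct.left (g * g') x))) =
        (fun x => C (of ℂ H (SemidirectProduct.left g x))) *
        fun x => C (of ℂ H (SemidirectProduct.left g' ((SemidirectProduct.right g)⁻¹ • x))) := by
      funext x
      rw [Pi.mul_apply, ← map_mul, ← map_mul]
      rfl
    rw [h1, map_mul, map_mul, mul_assoc, mul_assoc]
    congr 1
    refine LinearMap.ext fun f => funext fun p => ?_
    simp only [Module.End.mul_apply, matrixAct_apply, LinearMap.funLeft_apply]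
    -- Permuting the factors of a Kronecker product amounts to permuting its multi-indices, so the
    -- two sums match after reindexing `j` by the action.
    refine Fintype.sum_equiv (MulAction.toPerm (SemidirectProduct.right g)⁻¹) _ _ fun j => ?_
    congr 1
    · rw [piKronecker_apply, piKronecker_apply]
      exact Fintype.prod_equiv (MulAction.toPerm (SemidirectProduct.right g)⁻¹) _ _ fun x => by
        simp only [MulAction.toPerm_apply]
        change _ = C (of ℂ H _) (p.1 ((SemidirectProduct.right g)⁻¹⁻¹ • _))
          (j ((SemidirectProduct.right g)⁻¹⁻¹ • _))
        simp only [inv_inv, smul_inv_smul]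
    · change f ((SemidirectProduct.right g * SemidirectProduct.right g')⁻¹ • (j, p.2)) = _
      rw [mul_inv_rev, mul_smul]
      rfl

theorem tensorRep_base (C : ℂ[H] →ₐ[ℂ] Matrix K K ℂ) (b : X → H) :
    tensorRep C X Q E (base b) =
      matrixAct (X → K) Q E (piKronecker fun x => C (of ℂ H (b x))) := by
  refine LinearMap.ext fun f => ?_
  change matrixAct (X → K) Q E (piKronecker fun x => C (of ℂ H (b x)))
    (LinearMap.funLeft ℂ E (fun p => (1 : Q)⁻¹ • p) f) = _
  congr 1
  funext p
  rw [LinearMap.funLeft_apply, inv_one, one_smul]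

theorem tensorRep_top (C : ℂ[H] →ₐ[ℂ] Matrix K K ℂ) (q : Q) (f : (X → K) × Q → E)
    (p : (X → K) × Q) : tensorRep C X Q E (top q) f p = f (q⁻¹ • p) := by
  change matrixAct (X → K) Q E (piKronecker fun x => C (of ℂ H 1))
    (LinearMap.funLeft ℂ E (fun p => q⁻¹ • p) f) p = _
  have h1 : (fun _ : X => C (of ℂ H 1)) = 1 := by
    funext x
    rw [map_one, map_one, Pi.one_apply]
  rw [h1, map_one, map_one]
  rfl

theorem tensorRep_factorAlg (C : ℂ[H] →ₐ[ℂ] Matrix K K ℂ) (x : X) (a : ℂ[H]) :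
    factorAlg (tensorRep C X Q E) x a =
      matrixAct (X → K) Q E (piKronecker (Pi.mulSingle x (C a))) := by
  induction a using MonoidAlgebra.induction_linear with
  | zero =>
    have : piKronecker (Pi.mulSingle x (C 0) : X → Matrix K K ℂ) = 0 := by
      ext j j'
      rw [piKronecker_mulSingle_apply, map_zero]
      simp
    rw [this, map_zero, map_zero]
  | add a a' ha ha' =>
    rw [map_add, ha, ha', ← map_add]
    congr 1
    ext j j'
    rw [Matrix.add_apply, piKronecker_mulSingle_apply, piKronecker_mulSingle_apply,
      piKronecker_mulSingle_apply, map_add, Matrix.add_apply, add_mul]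
  | single h c =>
    rw [factorAlg_single, tensorRep_base, ← map_smul]
    congr 1
    have h1 : (fun y => C (of ℂ H ((Pi.mulSingle x h : X → H) y))) =
        Pi.mulSingle x (C (of ℂ H h)) := by
      funext y
      by_cases hy : y = x
      · subst hy; rw [Pi.mulSingle_eq_same, Pi.mulSingle_eq_same]
      · rw [Pi.mulSingle_eq_of_ne hy, Pi.mulSingle_eq_of_ne hy, map_one, map_one]
    have h2 : (single h c : ℂ[H]) = c • of ℂ H h := by simp
    rw [h1, h2]
    ext j j'
    rw [Matrix.smul_apply, piKronecker_mulSingle_apply, piKronecker_mulSingle_apply, map_smul,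
      Matrix.smul_apply, smul_mul_assoc]

variable {V : Type*} [AddCommGroup V] [Module ℂ V]

-- Writing `g = base b * top q` makes a coefficient a function of `(b, q)`. As `Q` is discrete,
-- continuity in `b` for each fixed `q` is enough.
omit [Fintype X] [DecidableEq X] in
theorem contRep_of_base [TopologicalSpace H] {ρ : Representation ℂ (Wreath H X Q) V}
    (h : ∀ (v : V) (l : Module.Dual ℂ V), Continuous fun b : X → H => l (ρ (base b) v)) :
    ContRep ρ := by
  intro v l
  let _ : TopologicalSpace Q := ⊥
  have : DiscreteTopology Q := ⟨rfl⟩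
  have h1 : Continuous fun p : (X → H) × Q => l (ρ (base p.1) (ρ (top p.2) v)) :=
    continuous_prod_of_discrete_right.2 fun q => h (ρ (top q) v) l
  have h2 : Continuous fun g : Wreath H X Q =>
      ((SemidirectProduct.left g, SemidirectProduct.right g) : (X → H) × Q) :=
    Continuous.prodMk (by
      have h4 := @continuous_inf_dom_left (Wreath H X Q) (X → H)
        (fun g => SemidirectProduct.left g)
        (TopologicalSpace.induced (fun g => SemidirectProduct.left g)
          (inferInstance : TopologicalSpace (X → H)))
        (TopologicalSpace.induced (fun g => SemidirectProduct.right g) ⊥) inferInstance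
        continuous_induced_dom
      exact h4) (by
      have h4 := @continuous_inf_dom_right (Wreath H X Q) Q (fun g => SemidirectProduct.right g)
        (TopologicalSpace.induced (fun g => SemidirectProduct.left g)
          (inferInstance : TopologicalSpace (X → H)))
        (TopologicalSpace.induced (fun g => SemidirectProduct.right g) ⊥) ⊥ continuous_induced_dom
      exact h4)
  have h3 := h1.comp h2
  refine h3.congr fun g => ?_
  rw [Function.comp_apply, ← Module.End.mul_apply, ← map_mul]
  congr 3
  exact SemidirectProduct.inl_left_mul_inr_right g

theorem tensorRep_contRep [TopologicalSpace H] [Finite Q] [FiniteDimensional ℂ E]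
    (C : ℂ[H] →ₐ[ℂ] Matrix K K ℂ)
    (hC : ∀ k k', Continuous fun h => C (of ℂ H h) k k') : ContRep (tensorRep C X Q E) := by
  refine contRep_of_base fun v l => ?_
  let T : Matrix (X → K) (X → K) ℂ →ₗ[ℂ] ℂ :=
    l ∘ₗ (LinearMap.applyₗ v) ∘ₗ (matrixAct (X → K) Q E).toLinearMap
  have hT : Continuous T := LinearMap.continuous_of_finiteDimensional T
  have h2 : Continuous fun b : X → H =>
      (piKronecker fun x => C (of ℂ H (b x)) : Matrix (X → K) (X → K) ℂ) := by
    refine continuous_matrix fun j j' => ?_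
    simp only [piKronecker_apply]
    exact continuous_finsetProd _ fun x _ => (hC _ _).comp (continuous_apply x)
  refine (hT.comp h2).congr fun b => ?_
  rw [tensorRep_base]
  rfl

end TensorRep

/-! ### Every representation of a stabilizer occurs -/

section Existence

variable {H X Q E : Type*} [Group H] [TopologicalSpace H] [Group Q] [MulAction Q X] [Fintype X]
  [DecidableEq X] [AddCommGroup E] [Module ℂ E]

open Classical in
/-- The direct sum of the classes in `F`, in matrix form. -/
def blockAlg (F : Finset (IrrDual H)) :
    ℂ[H] →ₐ[ℂ] Matrix (Σ d : F, Fin d.1.1) (Σ d : F, Fin d.1.1) ℂ :=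
  AlgHom.ofLinearMap
    { toFun := fun a => Matrix.blockDiagonal' fun d : F =>
        LinearMap.toMatrix' (d.1.rep.asAlgebraHom a)
      map_add' := fun a b => by
        rw [← Matrix.blockDiagonal'_add]; congr 1; funext d; simp
      map_smul' := fun c a => by
        rw [RingHom.id_apply, ← Matrix.blockDiagonal'_smul]; congr 1; funext d; simp }
    (by
      simp only [LinearMap.coe_mk, AddHom.coe_mk, map_one]
      rw [← Matrix.blockDiagonal'_one]
      congr 1; funext d; exact LinearMap.toMatrix'_one)
    (fun a b => by
      simp only [LinearMap.coe_mk, AddHom.coe_mk, map_mul]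
      rw [← Matrix.blockDiagonal'_mul]
      congr 1; funext d; exact LinearMap.toMatrix'_mul _ _)

theorem blockAlg_apply_eq {F : Finset (IrrDual H)} (a : ℂ[H]) (d : F) (i j : Fin d.1.1) :
    blockAlg F a ⟨d, i⟩ ⟨d, j⟩ = d.1.rep.asAlgebraHom a (Pi.single j 1) i := by
  classical
  refine (Matrix.blockDiagonal'_apply_eq
    (fun d : F => LinearMap.toMatrix' (d.1.rep.asAlgebraHom a)) _ _ _).trans ?_
  rw [LinearMap.toMatrix'_apply]

theorem blockAlg_apply_ne {F : Finset (IrrDual H)} (a : ℂ[H]) {d d' : F} (h : d ≠ d')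
    (i : Fin d.1.1) (j : Fin d'.1.1) : blockAlg F a ⟨d, i⟩ ⟨d', j⟩ = 0 := by
  classical
  exact Matrix.blockDiagonal'_apply_ne
    (fun d : F => LinearMap.toMatrix' (d.1.rep.asAlgebraHom a)) _ _ h

theorem continuous_blockAlg (F : Finset (IrrDual H)) (k k' : Σ d : F, Fin d.1.1) :
    Continuous fun h => blockAlg F (of ℂ H h) k k' := by
  obtain ⟨d, i⟩ := k
  obtain ⟨d', i'⟩ := k'
  by_cases hd : d = d'
  · subst hd
    simp only [blockAlg_apply_eq, Representation.asAlgebraHom_of]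
    exact d.1.contRep _ (LinearMap.proj i)
  · simp only [blockAlg_apply_ne _ hd]
    exact continuous_const

theorem blockAlg_eq_zero {F : Finset (IrrDual H)} {a : ℂ[H]}
    (ha : ∀ d ∈ F, d.rep.asAlgebraHom a = 0) : blockAlg F a = 0 := by
  ext ⟨d, i⟩ ⟨d', i'⟩
  by_cases hd : d = d'
  · subst hd
    rw [blockAlg_apply_eq, ha _ d.2]
    rfl
  · rw [blockAlg_apply_ne _ hd, Matrix.zero_apply]

open Classical in
theorem tensorRep_finSupported (F : Finset (IrrDual H)) :
    FinSupported (tensorRep (blockAlg F) X Q E) := by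
  refine ⟨F, fun x a ha => ?_⟩
  rw [tensorRep_factorAlg, blockAlg_eq_zero ha]
  have : piKronecker (Pi.mulSingle x 0 :
      X → Matrix (Σ d : F, Fin d.1.1) (Σ d : F, Fin d.1.1) ℂ) = 0 := by
    ext j j'
    rw [piKronecker_mulSingle_apply, Matrix.zero_apply, zero_mul, Matrix.zero_apply]
  rw [this, map_zero]

-- The map `f` sends `v` to the function supported on `j₀` and the stabilizer, with value `τ (q⁻¹)
-- v` at `q`: the orbit-map embedding of `τ` into `E`-valued functions, tensored with the first
-- basis vectors. All components of `j₀` are first indices, and the stabilizer fixes `j₀`, so `f`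
-- lands in the multiplicity space and is equivariant.
open Classical in
theorem exists_map_multSpace (σ : X → IrrDual H) (F : Finset (IrrDual H)) (hF : ∀ x, σ x ∈ F)
    (τ : Representation ℂ (MulAction.stabilizer Q σ) E) :
    ∃ f : E →ₗ[ℂ] ((X → Σ d : F, Fin d.1.1) × Q → E), Function.Injective f ∧
      (∀ v, f v ∈ multSpace (tensorRep (blockAlg F) X Q E) σ) ∧
      ∀ q v, f (τ q v) = tensorRep (blockAlg F) X Q E (top q.1) (f v) := by
  let g : F → Σ d : F, Fin d.1.1 := fun d => ⟨d, d.1.zero⟩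
  let j₀ : X → Σ d : F, Fin d.1.1 := fun x => g ⟨σ x, hF x⟩
  have hj₀ : ∀ q ∈ MulAction.stabilizer Q σ, q • j₀ = j₀ := fun q hq => funext fun x =>
    congrArg g (Subtype.ext (congrFun hq x))
  let f : E →ₗ[ℂ] ((X → Σ d : F, Fin d.1.1) × Q → E) :=
    { toFun := fun v p => if h : p.1 = j₀ ∧ p.2⁻¹ ∈ MulAction.stabilizer Q σ then
        τ ⟨p.2⁻¹, h.2⟩ v else 0
      map_add' := fun v w => by
        funext p
        simp only [Pi.add_apply]
        split_ifs <;> simp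
      map_smul' := fun c v => by
        funext p
        simp only [Pi.smul_apply, RingHom.id_apply]
        split_ifs <;> simp }
  have hfz : ∀ v j q, j ≠ j₀ → f v (j, q) = 0 := fun v j q h => dif_neg fun h' => h h'.1
  refine ⟨f, fun v w h => ?_, fun v x a ha => ?_, fun q v => ?_⟩
  · have h1 : ∀ v, f v (j₀, 1) = v := by
      intro v
      have h2 : (1 : Q)⁻¹ ∈ MulAction.stabilizer Q σ := by rw [inv_one]; exact one_mem _
      refine (dif_pos ⟨rfl, h2⟩).trans ?_
      have h3 : (⟨(1 : Q)⁻¹, h2⟩ : MulAction.stabilizer Q σ) = 1 := Subtype.ext inv_one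
      change τ ⟨(1 : Q)⁻¹, h2⟩ v = v
      rw [h3, map_one]
      rfl
    rw [← h1 v, h, h1]
  · rw [tensorRep_factorAlg]
    funext p
    rw [matrixAct_apply, Pi.zero_apply]
    refine Finset.sum_eq_zero fun j _ => ?_
    by_cases hj : j = j₀
    · subst hj
      have : blockAlg F a (p.1 x) (j₀ x) = 0 := by
        obtain ⟨d, i⟩ := p.1 x
        by_cases hd : d = ⟨σ x, hF x⟩
        · subst hd
          refine (blockAlg_apply_eq a _ _ _).trans ?_
          exact congrFun ha i
        · exact blockAlg_apply_ne a hd _ _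
      rw [piKronecker_mulSingle_apply, this, zero_mul, zero_smul]
    · rw [hfz _ _ _ hj, smul_zero]
  · funext p
    rw [tensorRep_top]
    change (if h : p.1 = j₀ ∧ p.2⁻¹ ∈ MulAction.stabilizer Q σ then
        τ ⟨p.2⁻¹, h.2⟩ (τ q v) else 0) =
      if h : q.1⁻¹ • p.1 = j₀ ∧ (q.1⁻¹ * p.2)⁻¹ ∈ MulAction.stabilizer Q σ then
        τ ⟨(q.1⁻¹ * p.2)⁻¹, h.2⟩ v else 0
    have hiff : (p.1 = j₀ ∧ p.2⁻¹ ∈ MulAction.stabilizer Q σ) ↔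
        (q.1⁻¹ • p.1 = j₀ ∧ (q.1⁻¹ * p.2)⁻¹ ∈ MulAction.stabilizer Q σ) := by
      refine and_congr ?_ ?_
      · rw [inv_smul_eq_iff, hj₀ _ q.2]
      · rw [mul_inv_rev, inv_inv, Subgroup.mul_mem_cancel_right _ q.2]
    by_cases h : p.1 = j₀ ∧ p.2⁻¹ ∈ MulAction.stabilizer Q σ
    · rw [dif_pos h, dif_pos (hiff.1 h), ← Module.End.mul_apply, ← map_mul]
      congr 2
      apply Subtype.ext
      simp
    · rw [dif_neg h, dif_neg (mt hiff.2 h)]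

/-- The set of classes of irreducible representations of a group without topology. -/
abbrev FinDual (P : Type*) [Group P] : Type _ := @IrrDual P _ ⊥

theorem contRep_of_discrete {P V : Type*} [Group P] [AddCommGroup V] [Module ℂ V]
    (ρ : Representation ℂ P V) : @ContRep P _ V _ _ ⊥ ρ := fun _ _ =>
  @continuous_bot _ _ _ _

/-- The representations of the wreath product lying over `σ` correspond to the representations
of the stabilizer of `σ`. -/
theorem exists_correspondence [Finite Q] (σ : X → IrrDual H) :
    ∃ e : {D : IrrDual (Wreath H X Q) // multSpace D.rep σ ≠ ⊥} ≃
        FinDual (MulAction.stabilizer Q σ),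
      ∀ D, D.1.1 = Nat.card (MulAction.orbit Q σ) * famDeg σ * (e D).1 := by
  classical
  let _ : TopologicalSpace (MulAction.stabilizer Q σ) := ⊥
  have hs : ∀ D : IrrDual (Wreath H X Q), FinSupported D.rep := fun D =>
    finSupported_of_irreducible D.contRep inferInstance
  have h1 : ∀ D : {D : IrrDual (Wreath H X Q) // multSpace D.rep σ ≠ ⊥},
      ∃ t : IrrDual (MulAction.stabilizer Q σ), Nonempty ((multRep D.1.rep σ).Equiv t.rep) :=
    fun D => exists_irrDual _ (multRep_irreducible (hs D.1) inferInstance D.2)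
      (contRep_of_discrete _)
  choose e he using h1
  have hbij : Function.Bijective e := by
    constructor
    · intro D D' h
      obtain ⟨e1⟩ := he D
      obtain ⟨e2⟩ := he D'
      rw [h] at e1
      obtain ⟨e3⟩ := equiv_of_multRep_equiv (hs D.1) (hs D'.1) inferInstance inferInstance D.2
        (e1.trans e2.symm)
      exact Subtype.ext (IrrDual.ext_of_equiv e3)
    · intro t
      let F := Finset.univ.image σ
      have hF : ∀ x, σ x ∈ F := fun x => by simp [F]
      -- Surjectivity: `t` is placed in the multiplicity space of `tensorRep`, and the
      -- subrepresentation it generates is irreducible with multiplicity representation `t`.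
      obtain ⟨f, hf1, hf2, hf3⟩ := exists_map_multSpace σ F hF t.rep
      have hc : ContRep (tensorRep (blockAlg F) X Q (Fin t.1 → ℂ)) :=
        tensorRep_contRep _ (continuous_blockAlg F)
      have : Fintype Q := Fintype.ofFinite Q
      obtain ⟨S, hS, ⟨e1⟩⟩ := repSpan_irreducible hc (tensorRep_finSupported F)
        (inferInstance : t.rep.IsIrreducible) f hf1 hf2 hf3
      obtain ⟨D, ⟨e2⟩⟩ := exists_irrDual S.toRepresentation hS
        (hc.of_injective S.toSubmodule.subtype (fun _ _ => rfl) S.toSubmodule.injective_subtype)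
      have hne : multSpace S.toRepresentation σ ≠ ⊥ := by
        rw [← Submodule.nontrivial_iff_ne_bot]
        have := ((isIrreducible_iff t.rep).1 inferInstance).1
        exact e1.symm.toLinearEquiv.toEquiv.nontrivial
      refine ⟨⟨D, multSpace_ne_bot_of_equiv e2 hne⟩, ?_⟩
      obtain ⟨e3⟩ := multRep_equiv_of_equiv e2 σ
      obtain ⟨e4⟩ := he ⟨D, multSpace_ne_bot_of_equiv e2 hne⟩
      exact (IrrDual.ext_of_equiv ((e1.trans e3).trans e4)).symm
  refine ⟨Equiv.ofBijective e hbij, fun D => ?_⟩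
  have h2 := finrank_eq_of_irreducible D.1.contRep inferInstance D.2
  obtain ⟨e1⟩ := he D
  rw [e1.toLinearEquiv.finrank_eq] at h2
  simpa using h2

end Existence

/-! ### Formal Dirichlet series of graded sets -/

section DirichletSeries

variable {S T : Type*}

/-- Degrees are positive and each degree is attained finitely often. -/
def IsGraded (deg : S → ℕ) : Prop :=
  (∀ s, deg s ≠ 0) ∧ ∀ n, {s | deg s = n}.Finite

/-- The formal Dirichlet series `∑ w(s) deg(s)^{-s}`. -/
def dser (deg : S → ℕ) (w : S → ℂ) : ArithmeticFunction ℂ :=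
  ⟨fun n => if n = 0 then 0 else ∑ᶠ s ∈ {s | deg s = n}, w s, by simp⟩

theorem dser_apply {deg : S → ℕ} {w : S → ℂ} {n : ℕ} (hn : n ≠ 0) :
    dser deg w n = ∑ᶠ s ∈ {s | deg s = n}, w s := if_neg hn

/-- Any finite superset of the elements of degree `n` may serve as summation range, so that several
coefficients can be summed over one common set. -/
theorem dser_apply_of_subset {deg : S → ℕ} {w : S → ℂ} {n : ℕ} (hn : n ≠ 0)
    (A : Finset S) (hA : ∀ s, deg s = n → s ∈ A) :
    dser deg w n = ∑ s ∈ A, if deg s = n then w s else 0 := by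
  rw [dser_apply hn, ← Finset.sum_filter, ← finsum_mem_coe_finset]
  refine finsum_mem_congr ?_ fun _ _ => rfl
  ext s
  simp only [Set.mem_ofPred_eq, Finset.coe_filter]
  exact ⟨fun h => ⟨hA s h, h⟩, fun h => h.2⟩

theorem IsGraded.finite {deg : S → ℕ} (h : IsGraded deg) (n : ℕ) : {s | deg s = n}.Finite := h.2 n

theorem IsGraded.apply {deg : S → ℕ} (h : IsGraded deg) {w : S → ℂ} {n : ℕ} (hn : n ≠ 0) :
    dser deg w n = ∑ s ∈ (h.finite n).toFinset, if deg s = n then w s else 0 :=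
  dser_apply_of_subset hn _ fun s hs => by simpa using hs

theorem dser_sum {ι : Type*} {deg : S → ℕ} (h : IsGraded deg) (A : Finset ι) (c : ι → ℂ)
    (w : ι → S → ℂ) :
    dser deg (fun s => ∑ i ∈ A, c i * w i s) = ∑ i ∈ A, c i • dser deg (w i) := by
  ext n
  have key : ∀ f : ι → ArithmeticFunction ℂ, (∑ i ∈ A, f i) n = ∑ i ∈ A, f i n := by
    intro f
    classical
    induction A using Finset.induction_on with
    | empty => simp
    | insert a A ha ih => rw [Finset.sum_insert ha, Finset.sum_insert ha,
        ArithmeticFunction.add_apply, ih]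
  by_cases hn : n = 0
  · subst hn; simp
  rw [key, h.apply hn]
  have h1 : ∀ i ∈ A, (c i • dser deg (w i)) n =
      ∑ s ∈ (h.finite n).toFinset, c i * if deg s = n then w i s else 0 := by
    intro i _
    rw [← Finset.mul_sum, ← h.apply hn]
    rfl
  rw [Finset.sum_congr rfl h1, Finset.sum_comm]
  refine Finset.sum_congr rfl fun s _ => ?_
  split_ifs <;> simp

theorem dser_add {deg : S → ℕ} (h : IsGraded deg) (w w' : S → ℂ) :
    dser deg (fun s => w s + w' s) = dser deg w + dser deg w' := by
  ext n
  by_cases hn : n = 0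
  · subst hn; simp
  rw [ArithmeticFunction.add_apply, h.apply hn, h.apply hn, h.apply hn, ← Finset.sum_add_distrib]
  refine Finset.sum_congr rfl fun s _ => ?_
  split_ifs <;> simp

theorem dser_smul {deg : S → ℕ} (h : IsGraded deg) (c : ℂ) (w : S → ℂ) :
    dser deg (fun s => c * w s) = c • dser deg w := by
  simpa using dser_sum h {()} (fun _ => c) (fun _ => w)

/-- Push-forward: weights are summed along fibres of a degree-preserving map. Reindexing by
injections and by equivalences are special cases. -/
theorem dser_fiberwise {deg : S → ℕ} (hS : IsGraded deg) (π : T → S)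
    (hT : IsGraded fun t => deg (π t)) (w : T → ℂ) (u : S → ℂ)
    (hu : ∀ s, ∑ᶠ t ∈ π ⁻¹' {s}, w t = u s) :
    dser (fun t => deg (π t)) w = dser deg u := by
  classical
  ext n
  by_cases hn : n = 0
  · subst hn; simp
  rw [hS.apply hn, hT.apply hn, ← Finset.sum_fiberwise_of_maps_to (g := π)
    (t := (hS.finite n).toFinset) (fun t ht => by simpa using ht)]
  refine Finset.sum_congr rfl fun s hs => ?_
  have hs : deg s = n := by simpa using hs
  rw [if_pos hs, ← hu s, ← finsum_mem_coe_finset]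
  refine finsum_mem_congr ?_ ?_
  · ext t
    simp only [Finset.coe_filter, Set.Finite.mem_toFinset, Set.mem_ofPred_eq, Set.mem_preimage,
      Set.mem_singleton_iff]
    exact ⟨fun h => h.2, fun h => ⟨by rw [h, hs], h⟩⟩
  · intro t ht
    have ht : π t = s := ht
    rw [if_pos (by rw [ht, hs])]

theorem IsGraded.comp_injective {deg : S → ℕ} (h : IsGraded deg) {f : T → S}
    (hf : Function.Injective f) : IsGraded fun t => deg (f t) :=
  ⟨fun _ => h.1 _, fun n => (h.finite n).preimage hf.injOn⟩

theorem dser_injective {deg : S → ℕ} (h : IsGraded deg) {f : T → S} (hf : Function.Injective f)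
    (p : S → Prop) [DecidablePred p] (hp : ∀ s, p s ↔ ∃ t, f t = s) :
    dser deg (fun s => if p s then 1 else 0) = dser (fun t => deg (f t)) 1 := by
  symm
  refine dser_fiberwise h f (h.comp_injective hf) _ _ fun s => ?_
  split_ifs with hs
  · obtain ⟨t, rfl⟩ := (hp s).1 hs
    have : f ⁻¹' {f t} = {t} := by ext t'; simp [hf.eq_iff]
    rw [this, finsum_mem_singleton]
    rfl
  · have : f ⁻¹' {s} = ∅ := by
      ext t
      simp only [Set.mem_preimage, Set.mem_singleton_iff, Set.mem_empty_iff_false, iff_false]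
      exact fun h => hs ((hp s).2 ⟨t, h⟩)
    rw [this, finsum_mem_empty]

theorem dser_equiv {deg : S → ℕ} {deg' : T → ℕ} (e : T ≃ S) (h : IsGraded deg)
    (hd : ∀ t, deg' t = deg (e t)) (w : S → ℂ) : dser deg' (fun t => w (e t)) = dser deg w := by
  have : deg' = fun t => deg (e t) := funext hd
  subst this
  refine dser_fiberwise h e (h.comp_injective e.injective) _ _ fun s => ?_
  have : e ⁻¹' {s} = {e.symm s} := by ext t; simp [Equiv.eq_symm_apply]
  rw [this, finsum_mem_singleton, e.apply_symm_apply]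

theorem IsGraded.dvd_finite {deg : S → ℕ} (h : IsGraded deg) {n : ℕ} (hn : n ≠ 0) :
    {s | deg s ∣ n}.Finite := by
  refine Set.Finite.subset (Set.Finite.biUnion n.divisors.finite_toSet fun k _ => h.finite k) ?_
  intro s hs
  simp only [Set.mem_iUnion]
  exact ⟨deg s, by simpa [hn] using hs, rfl⟩

theorem IsGraded.sigma {U : S → Type*} {deg : S → ℕ} (h : IsGraded deg) {degU : ∀ s, U s → ℕ}
    (hU : ∀ s, IsGraded (degU s)) : IsGraded fun p : Σ s, U s => deg p.1 * degU p.1 p.2 := by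
  refine ⟨fun p => mul_ne_zero (h.1 _) ((hU _).1 _), fun n => ?_⟩
  by_cases hn : n = 0
  · subst hn
    convert Set.finite_empty
    ext p
    simpa using ⟨h.1 p.1, (hU p.1).1 p.2⟩
  refine Set.Finite.subset (Set.Finite.biUnion (h.dvd_finite hn)
    fun s _ => ((hU s).dvd_finite hn).image (Sigma.mk s)) ?_
  rintro ⟨s, u⟩ hp
  have hp : deg s * degU s u = n := hp
  simp only [Set.mem_iUnion]
  exact ⟨s, ⟨_, hp.symm⟩, u, ⟨_, by rw [mul_comm, hp]⟩, rfl⟩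

/-- If the series of the fibre over `s` depends only on the type `κ s`, grouping by type turns the
series of the total space into finitely many Dirichlet products. -/
theorem dser_sigma {ι : Type*} [DecidableEq ι] {U : S → Type*} {deg : S → ℕ} (h : IsGraded deg)
    {degU : ∀ s, U s → ℕ} (hU : ∀ s, IsGraded (degU s)) (A : Finset ι) (κ : S → ι)
    (hκ : ∀ s, κ s ∈ A) (W : ι → ArithmeticFunction ℂ) (w : ∀ s, U s → ℂ) (v : S → ℂ)
    (hW : ∀ s, dser (degU s) (w s) = W (κ s)) :
    dser (fun p : Σ s, U s => deg p.1 * degU p.1 p.2) (fun p => v p.1 * w p.1 p.2) =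
      ∑ k ∈ A, W k * dser deg (fun s => if κ s = k then v s else 0) := by
  classical
  ext n
  have key : ∀ f : ι → ArithmeticFunction ℂ, (∑ i ∈ A, f i) n = ∑ i ∈ A, f i n := by
    intro f
    clear hκ
    induction A using Finset.induction_on with
    | empty => simp
    | insert a A ha ih => rw [Finset.sum_insert ha, Finset.sum_insert ha,
        ArithmeticFunction.add_apply, ih]
  by_cases hn : n = 0
  · subst hn; simp
  let B := (h.dvd_finite hn).toFinset
  have hB : ∀ s, s ∈ B ↔ deg s ∣ n := fun s => by simp [B]
  have hdiv : ∀ s ∈ B, n / deg s ≠ 0 := fun s hs =>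
    (Nat.div_pos (Nat.le_of_dvd (Nat.pos_of_ne_zero hn) ((hB s).1 hs))
      (Nat.pos_of_ne_zero (h.1 s))).ne'
  have hL : dser (fun p : Σ s, U s => deg p.1 * degU p.1 p.2) (fun p => v p.1 * w p.1 p.2) n =
      ∑ s ∈ B, v s * W (κ s) (n / deg s) := by
    rw [dser_apply_of_subset hn (B.sigma fun s => ((hU s).finite (n / deg s)).toFinset)]
    · rw [Finset.sum_sigma]
      refine Finset.sum_congr rfl fun s hs => ?_
      rw [← hW s, (hU s).apply (hdiv s hs), Finset.mul_sum]
      refine Finset.sum_congr rfl fun u _ => ?_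
      have hiff : deg s * degU s u = n ↔ degU s u = n / deg s := by
        rw [mul_comm, Nat.eq_div_iff_mul_eq_left (h.1 s) ((hB s).1 hs), eq_comm]
      simp only [hiff]
      split_ifs <;> simp
    · rintro ⟨s, u⟩ hp
      have hp : deg s * degU s u = n := hp
      have hs : deg s ∣ n := ⟨_, hp.symm⟩
      simp only [Finset.mem_sigma, hB, Set.Finite.mem_toFinset, Set.mem_ofPred_eq]
      exact ⟨hs, by rw [Nat.eq_div_iff_mul_eq_left (h.1 s) hs, mul_comm, hp]⟩
  rw [hL, key]
  have hR : ∀ k ∈ A, (W k * dser deg (fun s => if κ s = k then v s else 0)) n =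
      ∑ s ∈ B, if κ s = k then v s * W k (n / deg s) else 0 := by
    intro k _
    rw [ArithmeticFunction.mul_apply]
    have h1 : ∀ x ∈ n.divisorsAntidiagonal,
        W k x.1 * dser deg (fun s => if κ s = k then v s else 0) x.2 =
        ∑ s ∈ B, if deg s = x.2 then (if κ s = k then v s * W k (n / deg s) else 0) else 0 := by
      intro x hx
      have hx := Nat.mem_divisorsAntidiagonal.1 hx
      have hx2 : x.2 ≠ 0 := by rintro h0; rw [h0, mul_zero] at hx; exact hx.2 hx.1.symm
      rw [dser_apply_of_subset hx2 B, Finset.mul_sum]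
      · refine Finset.sum_congr rfl fun s _ => ?_
        split_ifs with h2 h3
        · have : n / deg s = x.1 := by
            rw [h2, ← hx.1, Nat.mul_div_cancel _ (Nat.pos_of_ne_zero hx2)]
          rw [this, mul_comm]
        · simp
        · simp
      · intro s hs
        rw [hB, hs]
        exact ⟨x.1, by rw [mul_comm, hx.1]⟩
    rw [Finset.sum_congr rfl h1, Finset.sum_comm]
    refine Finset.sum_congr rfl fun s hs => ?_
    -- For given `s`, only this factorization of `n` has second factor `deg s`.
    rw [Finset.sum_eq_single (n / deg s, deg s)]
    · simp
    · intro x hx hne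
      rw [if_neg]
      intro h2
      apply hne
      have hx := Nat.mem_divisorsAntidiagonal.1 hx
      have hx2 : x.2 ≠ 0 := by rintro h0; rw [h0, mul_zero] at hx; exact hx.2 hx.1.symm
      ext
      · simp only
        rw [h2, ← hx.1, Nat.mul_div_cancel _ (Nat.pos_of_ne_zero hx2)]
      · exact h2.symm
    · intro h2
      exact absurd (Nat.mem_divisorsAntidiagonal.2
        ⟨Nat.div_mul_cancel ((hB s).1 hs), hn⟩) h2
  rw [Finset.sum_congr rfl hR, Finset.sum_comm]
  refine Finset.sum_congr rfl fun s _ => ?_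
  rw [Finset.sum_ite_eq, if_pos (hκ s)]

theorem IsGraded.prod {deg : S → ℕ} {deg' : T → ℕ} (h : IsGraded deg) (h' : IsGraded deg') :
    IsGraded fun p : S × T => deg p.1 * deg' p.2 :=
  (h.sigma (U := fun _ => T) fun _ => h').comp_injective (Equiv.sigmaEquivProd S T).symm.injective

theorem dser_prod {deg : S → ℕ} {deg' : T → ℕ} (h : IsGraded deg) (h' : IsGraded deg') :
    dser (fun p : S × T => deg p.1 * deg' p.2) 1 = dser deg 1 * dser deg' 1 := by
  have h1 := dser_sigma (U := fun _ => T) h (fun _ => h') {()} (fun _ => ()) (by simp)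
    (fun _ => dser deg' 1) (fun _ _ => 1) (fun _ => 1) (fun _ => rfl)
  rw [Finset.sum_singleton] at h1
  simp only [if_true] at h1
  change _ = dser deg (fun _ => 1) * dser deg' 1
  rw [mul_comm (dser deg _), ← h1]
  have := dser_equiv (Equiv.sigmaEquivProd S T).symm (h.sigma (U := fun _ => T) fun _ => h')
    (deg' := fun p : S × T => deg p.1 * deg' p.2) (fun _ => rfl) (fun _ => 1 * 1)
  rw [← this]
  congr 1
  funext p
  simp

theorem isGraded_pi {n : ℕ} {deg : Fin n → S → ℕ} (h : ∀ i, IsGraded (deg i)) :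
    IsGraded fun τ : Fin n → S => ∏ i, deg i (τ i) := by
  refine ⟨fun τ => Finset.prod_ne_zero_iff.2 fun i _ => (h i).1 _, fun k => ?_⟩
  by_cases hk : k = 0
  · subst hk
    convert Set.finite_empty
    ext τ
    simpa [Finset.prod_eq_zero_iff] using fun i => (h i).1 _
  refine Set.Finite.subset (Set.Finite.pi' fun i => (h i).dvd_finite hk) ?_
  intro τ hτ i
  rw [Set.mem_ofPred_eq] at hτ
  rw [Set.mem_ofPred_eq, ← hτ]
  exact Finset.dvd_prod_of_mem _ (Finset.mem_univ i)

theorem dser_pi {n : ℕ} {deg : Fin n → S → ℕ} (h : ∀ i, IsGraded (deg i)) :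
    dser (fun τ : Fin n → S => ∏ i, deg i (τ i)) 1 = ∏ i, dser (deg i) 1 := by
  induction n with
  | zero =>
    ext k
    by_cases hk : k = 0
    · subst hk; simp
    rw [dser_apply_of_subset hk Finset.univ fun _ _ => Finset.mem_univ _, Fintype.sum_unique]
    simp only [Finset.univ_eq_empty, Finset.prod_empty, Pi.one_apply,
      ArithmeticFunction.one_apply, eq_comm (a := 1) (b := k)]
  | succ n ih =>
    rw [Fin.prod_univ_succ, ← ih fun i => h i.succ,
      ← dser_prod (h 0) (isGraded_pi fun i => h i.succ)]
    exact dser_equiv (Fin.consEquiv fun _ => S).symm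
      ((h 0).prod (isGraded_pi fun i => h i.succ))
      (fun τ => by rw [Fin.prod_univ_succ]; rfl) 1

theorem IsGraded.pow {deg : S → ℕ} (h : IsGraded deg) {f : ℕ} (hf : f ≠ 0) :
    IsGraded fun s => deg s ^ f := by
  refine ⟨fun s => pow_ne_zero _ (h.1 s), fun n => ?_⟩
  by_cases hn : n = 0
  · subst hn
    convert Set.finite_empty
    ext s
    simpa [hf] using h.1 s
  refine (h.dvd_finite hn).subset fun s hs => ?_
  rw [Set.mem_ofPred_eq] at hs ⊢
  rw [← hs]
  exact dvd_pow_self _ hf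

theorem dilate_dser {deg : S → ℕ} (h : IsGraded deg) {f : ℕ} (hf : f ≠ 0) (w : S → ℂ) :
    dilate f (dser deg w) = dser (fun s => deg s ^ f) w := by
  ext n
  by_cases hn : n = 0
  · subst hn; simp
  change ∑ k ∈ n.divisors with k ^ f = n, dser deg w k = _
  rw [dser_apply_of_subset hn (h.dvd_finite hn).toFinset, Finset.sum_filter]
  · have h1 : ∀ k ∈ n.divisors, (if k ^ f = n then dser deg w k else 0) =
        ∑ s ∈ (h.dvd_finite hn).toFinset,
          if deg s = k then (if deg s ^ f = n then w s else 0) else 0 := by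
      intro k hk
      rw [dser_apply_of_subset (Nat.pos_of_mem_divisors hk).ne' (h.dvd_finite hn).toFinset]
      · split_ifs with h2
        · refine Finset.sum_congr rfl fun s _ => ?_
          split_ifs with h3 h4
          · rfl
          · rw [h3] at h4; exact absurd h2 h4
          · rfl
        · symm
          refine Finset.sum_eq_zero fun s _ => ?_
          split_ifs with h3 h4
          · rw [h3] at h4; exact absurd h4 h2
          · rfl
          · rfl
      · intro s hs
        simpa [hs] using Nat.dvd_of_mem_divisors hk
    rw [Finset.sum_congr rfl h1, Finset.sum_comm]
    refine Finset.sum_congr rfl fun s hs => ?_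
    have hs : deg s ∣ n := by simpa using hs
    rw [Finset.sum_ite_eq, if_pos (Nat.mem_divisors.2 ⟨hs, hn⟩)]
  · intro s hs
    simp only [Set.Finite.mem_toFinset, Set.mem_ofPred_eq]
    rw [← hs]
    exact dvd_pow_self _ hf

/-- A one-point graded set, so that scaling degrees by `c` becomes an instance of `dser_prod`. -/
theorem powNeg_eq_dser (c : ℕ) : powNeg c = dser (fun _ : Unit => c) 1 := by
  ext n
  by_cases hn : n = 0
  · subst hn; simp
  rw [dser_apply_of_subset hn Finset.univ (by simp)]
  change (if n = c ∧ n ≠ 0 then (1 : ℂ) else 0) = _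
  simp [hn, eq_comm]

theorem dser_const_mul {deg : S → ℕ} (h : IsGraded deg) {c : ℕ} (hc : c ≠ 0) :
    dser (fun s => c * deg s) 1 = powNeg c * dser deg 1 := by
  have hu : IsGraded (fun _ : Unit => c) := ⟨fun _ => hc, fun _ => Set.toFinite _⟩
  rw [powNeg_eq_dser, ← dser_prod hu h]
  exact dser_equiv (Equiv.punitProd S).symm (hu.prod h) (fun _ => rfl) 1

end DirichletSeries

/-! ### The zeta series as the series of the dual -/

section ZetaSeries

variable (G : Type*) [Group G] [TopologicalSpace G]

theorem rigid_iff_isGraded : Rigid G ↔ IsGraded (Sigma.fst : IrrDual G → ℕ) := by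
  have h1 : ∀ n, {d : IrrDual G | d.1 = n} = Set.range (Sigma.mk n) := by
    intro n
    ext ⟨m, d⟩
    constructor
    · rintro rfl
      exact ⟨d, rfl⟩
    · rintro ⟨d', h⟩
      exact (congrArg Sigma.fst h).symm
  have h2 : ∀ n, {d : IrrDual G | d.1 = n}.Finite ↔ repCount G n ≠ ⊤ := by
    intro n
    rw [h1, repCount, Ne, ENat.card_eq_top, not_infinite_iff_finite]
    constructor
    · intro h
      exact Set.finite_range_iff sigma_mk_injective |>.1 h
    · intro h
      exact Set.finite_range _
  constructor
  · intro h
    refine ⟨fun d => (IrrDual.deg_pos d).ne', fun n => ?_⟩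
    by_cases hn : n = 0
    · subst hn
      convert Set.finite_empty
      ext d
      simpa using IrrDual.deg_pos d |>.ne'
    · exact (h2 n).2 (h n (by omega))
  · intro h n _
    exact (h2 n).1 (h.2 n)

theorem zetaSeries_eq_dser : zetaSeries G = dser (Sigma.fst : IrrDual G → ℕ) 1 := by
  ext n
  change (if n = 0 then (0 : ℂ) else ((repCount G n).toNat : ℂ)) = if n = 0 then 0 else _
  split_ifs with hn
  · rfl
  have h1 : {d : IrrDual G | d.1 = n} = Set.range (Sigma.mk n) := by
    ext ⟨m, d⟩
    constructor
    · rintro rfl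
      exact ⟨d, rfl⟩
    · rintro ⟨d', h⟩
      exact (congrArg Sigma.fst h).symm
  have hinj : Function.Injective (Sigma.mk n : DualDeg G n → IrrDual G) := sigma_mk_injective
  rw [h1, finsum_mem_range hinj]
  by_cases hf : Finite (DualDeg G n)
  · have := Fintype.ofFinite (DualDeg G n)
    rw [finsum_eq_sum_of_fintype, repCount, ENat.card_eq_coe_fintype_card]
    simp
  -- For infinitely many classes both conventions give zero, so rigidity is not needed.
  · rw [repCount, ENat.card_eq_top.2 (not_finite_iff_infinite.1 hf), finsum_of_infinite_support]
    · simp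
    · simpa [Function.support] using Set.infinite_univ_iff.2 (not_finite_iff_infinite.1 hf)

end ZetaSeries

/-! ### Finite groups: the sum of the squares of the degrees -/

section FiniteGroups

variable (P : Type*) [Group P] [Finite P]

omit [Group P] in
theorem finrank_groupAlgebra : finrank ℂ ℂ[P] = Nat.card P := by
  have := Fintype.ofFinite P
  rw [(MonoidAlgebra.coeffLinearEquiv (S := ℂ) (M := P) ℂ).finrank_eq,
    Module.finrank_finsupp_self, Nat.card_eq_fintype_card]

instance : FiniteDimensional ℂ ℂ[P] :=
  Module.Finite.equiv (MonoidAlgebra.coeffLinearEquiv (S := ℂ) (M := P) ℂ).symm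

variable {P} in
omit [Finite P] in
theorem ofModule'_asAlgebraHom (M : Type*) [AddCommGroup M] [Module ℂ M] [Module ℂ[P] M]
    [IsScalarTower ℂ ℂ[P] M] (a : ℂ[P]) (m : M) :
    (Representation.ofModule' (k := ℂ) (G := P) M).asAlgebraHom a m = a • m := by
  simp [Representation.asAlgebraHom, Representation.ofModule']

omit [Finite P] in
theorem isIrreducible_ofModule' (M : Type*) [AddCommGroup M] [Module ℂ M] [Module ℂ[P] M]
    [IsScalarTower ℂ ℂ[P] M] [IsSimpleModule ℂ[P] M] :
    (Representation.ofModule' (k := ℂ) (G := P) M).IsIrreducible := by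
  rw [isIrreducible_iff]
  refine ⟨IsSimpleModule.nontrivial ℂ[P] M, fun U hU => ?_⟩
  let N : Submodule ℂ[P] M :=
    { U with
      smul_mem' := fun a m hm => by
        rw [← ofModule'_asAlgebraHom]
        exact asAlgebraHom_mem U hU a hm }
  rcases eq_bot_or_eq_top N with h | h
  · left
    refine (Submodule.eq_bot_iff _).2 fun x hx => ?_
    exact (Submodule.eq_bot_iff N).1 h x hx
  · right
    refine eq_top_iff.2 fun x _ => ?_
    have : x ∈ N := h ▸ Submodule.mem_top
    exact this

/-- By Maschke, `1` is a sum of elements of simple left ideals, and `a` annihilates each of these;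
hence `a = a * 1 = 0`. -/
theorem eq_zero_of_asAlgebraHom_eq_zero (a : ℂ[P])
    (ha : ∀ d : FinDual P, (@IrrDual.rep _ _ ⊥ d).asAlgebraHom a = 0) : a = 0 := by
  let _ : TopologicalSpace P := ⊥
  have hss : IsSemisimpleModule ℂ[P] ℂ[P] := by
    have : Fintype P := Fintype.ofFinite P
    infer_instance
  have key : ∀ S : Submodule ℂ[P] ℂ[P], IsSimpleModule ℂ[P] S → ∀ m ∈ S, a * m = 0 := by
    intro S hS m hm
    have : FiniteDimensional ℂ S :=
      Module.Finite.of_injective (S.subtype.restrictScalars ℂ) Subtype.val_injective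
    obtain ⟨d, ⟨e⟩⟩ := exists_irrDual _ (isIrreducible_ofModule' P S) (contRep_of_discrete _)
    have h1 := intertwining_asAlgebraHom (σ := d.rep) (e.toLinearEquiv : _ →ₗ[ℂ] _)
      (fun g v => e.toIntertwiningMap.isIntertwining _ _ g v) a ⟨m, hm⟩
    rw [ha d, LinearMap.zero_apply] at h1
    have h2 := (LinearEquiv.map_eq_zero_iff e.toLinearEquiv).1 h1
    rw [ofModule'_asAlgebraHom] at h2
    exact congrArg Subtype.val h2
  have h1 : (1 : ℂ[P]) ∈ sSup {S : Submodule ℂ[P] ℂ[P] | IsSimpleModule ℂ[P] S} := by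
    rw [IsSemisimpleModule.sSup_simples_eq_top]
    trivial
  rw [sSup_eq_iSup'] at h1
  have h2 : a * 1 = 0 := by
    refine Submodule.iSup_induction _ (motive := fun m => a * m = 0) h1
      (fun S m hm => key S.1 S.2 m hm) (mul_zero a) fun x y hx hy => ?_
    rw [mul_add, hx, hy, add_zero]
  rwa [mul_one] at h2

/-- The joint action of the group algebra on a finite set of classes. -/
def jointAct [TopologicalSpace P] (F : Finset (IrrDual P)) :
    ℂ[P] →ₗ[ℂ] ∀ d : F, Module.End ℂ (Fin d.1.1 → ℂ) :=
  LinearMap.pi fun d => d.1.rep.asAlgebraHom.toLinearMap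

omit [Finite P] in
theorem jointAct_surjective [TopologicalSpace P] (F : Finset (IrrDual P)) :
    Function.Surjective (jointAct P F) := by
  intro T
  classical
  obtain ⟨a, ha⟩ := exists_lift F fun d => if h : d ∈ F then T ⟨d, h⟩ else 0
  refine ⟨a, funext fun d => ?_⟩
  have := ha d d.2
  rw [dif_pos d.2] at this
  exact this

omit [Finite P] in
theorem finrank_pi_end [TopologicalSpace P] (F : Finset (IrrDual P)) :
    finrank ℂ (∀ d : F, Module.End ℂ (Fin d.1.1 → ℂ)) = ∑ d ∈ F, d.1 ^ 2 := by
  rw [Module.finrank_pi_fintype, ← Finset.sum_coe_sort F fun d => d.1 ^ 2]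
  refine Finset.sum_congr rfl fun d _ => ?_
  rw [Module.finrank_linearMap, Module.finrank_fin_fun, sq]

/-- With `|P| + 1` classes, `ℂ[P]` would surject onto a space of dimension larger than its own. -/
instance finite_finDual : Finite (FinDual P) := by
  let _ : TopologicalSpace P := ⊥
  by_contra hinf
  rw [not_finite_iff_infinite] at hinf
  obtain ⟨F, hF⟩ := Infinite.exists_subset_card_eq (FinDual P) (Nat.card P + 1)
  have h1 := LinearMap.finrank_le_finrank_of_surjective (jointAct_surjective P F)
  rw [finrank_pi_end, finrank_groupAlgebra] at h1
  have h2 : ∑ d ∈ F, 1 ≤ ∑ d ∈ F, d.1 ^ 2 :=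
    Finset.sum_le_sum fun d _ => Nat.one_le_pow _ _ d.deg_pos
  rw [Finset.sum_const, smul_eq_mul, mul_one, hF] at h2
  exact absurd (h2.trans h1) (by omega)

theorem sum_sq_finDual [Fintype (FinDual P)] : ∑ d : FinDual P, d.1 ^ 2 = Nat.card P := by
  let _ : TopologicalSpace P := ⊥
  have hinj : Function.Injective (jointAct P (Finset.univ : Finset (FinDual P))) := by
    rw [← LinearMap.ker_eq_bot, eq_bot_iff]
    intro a ha
    refine eq_zero_of_asAlgebraHom_eq_zero P a fun d => ?_
    exact congrFun ha ⟨d, Finset.mem_univ d⟩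
  have := (LinearEquiv.ofBijective _ ⟨hinj, jointAct_surjective P Finset.univ⟩).finrank_eq
  rw [finrank_pi_end, finrank_groupAlgebra] at this
  exact this.symm

end FiniteGroups

/-! ### Summation over families of classes -/

section Counting

variable {H Q : Type*} [Group H] [TopologicalSpace H] [Group Q] [Finite Q]

/-- The zeta series of a group without topology. -/
def finZeta (P : Type*) [Group P] : ArithmeticFunction ℂ := @zetaSeries P _ ⊥

theorem isGraded_finDual (P : Type*) [Group P] [Finite P] :
    IsGraded (Sigma.fst : FinDual P → ℕ) :=
  ⟨fun d => (@IrrDual.deg_pos P _ ⊥ d).ne', fun _ => Set.toFinite _⟩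

theorem finZeta_eq (P : Type*) [Group P] : finZeta P = dser (Sigma.fst : FinDual P → ℕ) 1 :=
  @zetaSeries_eq_dser P _ ⊥

theorem isGraded_famDeg (hH : Rigid H) (m : ℕ) :
    IsGraded (famDeg : (Fin m → IrrDual H) → ℕ) :=
  isGraded_pi fun _ => (rigid_iff_isGraded H).1 hH

/-- Weighted pairs `(σ, D)` with `D` lying over `σ` are summed in two ways. Over a fixed `D` the
weights add up to one; over a fixed `σ` the correspondence gives the zeta series of the stabilizer.
The label `κ` is any finite-valued invariant that determines the contribution of `σ`. -/
theorem wreath_zetaSeries (hH : Rigid H) {m : ℕ} [MulAction Q (Fin m)] (A : Finset ℕ)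
    (κ : (Fin m → IrrDual H) → ℕ) (hκ : ∀ σ, κ σ ∈ A) (W : ℕ → ArithmeticFunction ℂ)
    (hW : ∀ σ : Fin m → IrrDual H, ((Nat.card (MulAction.orbit Q σ) : ℂ)⁻¹ •
      powNeg (Nat.card (MulAction.orbit Q σ))) * finZeta (MulAction.stabilizer Q σ) = W (κ σ)) :
    Rigid (Wreath H (Fin m) Q) ∧ zetaSeries (Wreath H (Fin m) Q) =
      ∑ k ∈ A, W k * dser famDeg fun σ : Fin m → IrrDual H => if κ σ = k then 1 else 0 := by
  have hgr := isGraded_famDeg hH m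
  have hfin : ∀ σ : Fin m → IrrDual H, Finite (MulAction.orbit Q σ) := fun σ => Set.finite_range _
  have horb : ∀ σ : Fin m → IrrDual H, Nat.card (MulAction.orbit Q σ) ≠ 0 := fun σ =>
    Nat.card_ne_zero.2 ⟨⟨⟨σ, MulAction.mem_orbit_self σ⟩⟩, hfin σ⟩
  choose e he using fun σ : Fin m → IrrDual H => exists_correspondence (Q := Q) σ
  let U : (Fin m → IrrDual H) → Type _ := fun σ =>
    {D : IrrDual (Wreath H (Fin m) Q) // multSpace D.rep σ ≠ ⊥}
  let degU : ∀ σ, U σ → ℕ := fun σ D => Nat.card (MulAction.orbit Q σ) * (e σ D).1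
  have hbase : ∀ σ : Fin m → IrrDual H, IsGraded fun t : FinDual (MulAction.stabilizer Q σ) =>
      Nat.card (MulAction.orbit Q σ) * t.1 := fun σ =>
    ⟨fun t => mul_ne_zero (horb σ) ((isGraded_finDual _).1 t), fun _ => Set.toFinite _⟩
  have hU : ∀ σ, IsGraded (degU σ) := fun σ => (hbase σ).comp_injective (e σ).injective
  -- This weight produces the `-1` in the exponent `-1 - s` of the orbit size.
  let w : ∀ σ, U σ → ℂ := fun σ _ => (Nat.card (MulAction.orbit Q σ) : ℂ)⁻¹
  have hw : ∀ σ, dser (degU σ) (w σ) = W (κ σ) := by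
    intro σ
    rw [← hW σ, smul_mul_assoc, finZeta_eq, ← dser_const_mul (isGraded_finDual _) (horb σ),
      ← dser_equiv (e σ) (hbase σ) (deg' := degU σ) (fun _ => rfl), ← dser_smul (hU σ)]
    congr 1
    funext D
    simp [w]
  have hsig := dser_sigma hgr hU A κ hκ W w 1 hw
  have hsigG := hgr.sigma hU
  have hdeg : ∀ p : Σ σ, U σ, famDeg p.1 * degU p.1 p.2 = p.2.1.1 := by
    intro p
    rw [he p.1 p.2]
    simp only [degU]
    ring
  simp only [hdeg] at hsig hsigG
  have hrel : ∀ (D : IrrDual (Wreath H (Fin m) Q)) (σ σ' : Fin m → IrrDual H),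
      multSpace D.rep σ ≠ ⊥ → (multSpace D.rep σ' ≠ ⊥ ↔ σ' ∈ MulAction.orbit Q σ) := by
    intro D σ σ' hσ
    constructor
    · exact mem_orbit_of_irreducible (finSupported_of_irreducible D.contRep inferInstance)
        inferInstance hσ
    · rintro ⟨q, rfl⟩
      have := finrank_multSpace_smul D.rep q σ
      intro h
      change multSpace D.rep (q • σ) = ⊥ at h
      rw [h, finrank_bot] at this
      exact hσ (Submodule.finrank_eq_zero.1 this.symm)
  have hex : ∀ D : IrrDual (Wreath H (Fin m) Q), ∃ σ : Fin m → IrrDual H,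
      multSpace D.rep σ ≠ ⊥ := fun D => exists_multSpace_ne_bot D.contRep inferInstance
  let π : (Σ σ, U σ) → IrrDual (Wreath H (Fin m) Q) := fun p => p.2.1
  have hπ : Function.Surjective π := fun D => by
    obtain ⟨σ, hσ⟩ := hex D
    exact ⟨⟨σ, D, hσ⟩, rfl⟩
  have hG : IsGraded (Sigma.fst : IrrDual (Wreath H (Fin m) Q) → ℕ) := by
    refine ⟨fun D => (IrrDual.deg_pos D).ne', fun n => ?_⟩
    refine ((hsigG.finite n).image π).subset ?_
    intro D hD
    obtain ⟨p, rfl⟩ := hπ D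
    exact ⟨p, hD, rfl⟩
  refine ⟨(rigid_iff_isGraded _).2 hG, ?_⟩
  -- The families below a given `D` form exactly one orbit, so the fibre of `π` over `D` has total
  -- weight one.
  have h1 : dser (fun p : (Σ σ, U σ) => (π p).1) (fun p => (1 : (Fin m → IrrDual H) → ℂ) p.1 *
      w p.1 p.2) = dser (Sigma.fst : IrrDual (Wreath H (Fin m) Q) → ℕ) 1 := by
    refine dser_fiberwise hG π hsigG _ _ fun D => ?_
    obtain ⟨σ, hσ⟩ := hex D
    let f : MulAction.orbit Q σ → Σ σ, U σ := fun σ' => ⟨σ'.1, D, (hrel D σ σ'.1 hσ).2 σ'.2⟩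
    have hf : Function.Injective f := fun σ' σ'' h => Subtype.ext (congrArg Sigma.fst h)
    have hr : π ⁻¹' {D} = Set.range f := by
      ext ⟨σ', D', h⟩
      constructor
      · rintro rfl
        exact ⟨⟨σ', (hrel _ σ σ' hσ).1 h⟩, rfl⟩
      · rintro ⟨σ'', h2⟩
        rw [← h2]
        rfl
    rw [hr, finsum_mem_range hf]
    have hc : ∀ σ' : MulAction.orbit Q σ, (1 : (Fin m → IrrDual H) → ℂ) (f σ').1 *
        w (f σ').1 (f σ').2 = (Nat.card (MulAction.orbit Q σ) : ℂ)⁻¹ := by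
      intro σ'
      have : MulAction.orbit Q σ'.1 = MulAction.orbit Q σ := MulAction.orbit_eq_iff.2 σ'.2
      simp only [Pi.one_apply, one_mul, w, f]
      rw [this]
    have := Fintype.ofFinite (MulAction.orbit Q σ)
    rw [finsum_congr hc, finsum_eq_sum_of_fintype, Finset.sum_const, nsmul_eq_mul,
      Finset.card_univ, ← Nat.card_eq_fintype_card, mul_inv_cancel₀ (by exact_mod_cast horb σ)]
    rfl
  rw [zetaSeries_eq_dser, ← h1]
  exact hsig

end Counting

/-! ### Linear characters -/

section DegreeOne

variable {G : Type*} [Group G] [TopologicalSpace G]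

theorem IrrDual.finrank_space (d : IrrDual G) : finrank ℂ (Fin d.1 → ℂ) = d.1 :=
  Module.finrank_fin_fun ℂ

theorem IrrDual.exists_smul_id {d : IrrDual G} (hd : d.1 = 1) (g : G) :
    ∃ c : ℂ, d.rep g = c • 1 :=
  (LinearMap.existsUnique_eq_smul_id_of_finrank_eq_one (d.finrank_space.trans hd) _).exists

theorem IrrDual.smul_id_injective (d : IrrDual G) {c c' : ℂ}
    (h : (c • 1 : Module.End ℂ (Fin d.1 → ℂ)) = c' • 1) : c = c' := by
  have := congrFun (LinearMap.congr_fun h fun _ => 1) ⟨0, d.deg_pos⟩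
  simpa using this

theorem IrrDual.eq_of_smul_id {d d' : IrrDual G} (hd : d.1 = 1) (hd' : d'.1 = 1)
    (h : ∀ g, ∃ c : ℂ, d.rep g = c • 1 ∧ d'.rep g = c • 1) : d = d' := by
  have e : (Fin d.1 → ℂ) ≃ₗ[ℂ] (Fin d'.1 → ℂ) :=
    LinearEquiv.ofFinrankEq _ _ (by rw [d.finrank_space, d'.finrank_space, hd, hd'])
  refine IrrDual.ext_of_equiv (Representation.Equiv.mk e fun g => ?_)
  obtain ⟨c, h1, h2⟩ := h g
  refine LinearMap.ext fun v => ?_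
  simp [h1, h2]

theorem IrrDual.fst_eq_one_of_comm (h : ∀ a b : G, a * b = b * a) (d : IrrDual G) : d.1 = 1 := by
  have : IsMulCommutative G := ⟨⟨h⟩⟩
  rw [← d.finrank_space]
  exact Representation.IsIrreducible.finrank_eq_one_of_isMulCommutative d.rep

theorem exists_fst_eq_one [DiscreteTopology G] : ∃ d : IrrDual G, d.1 = 1 := by
  have hi : (Representation.trivial ℂ G ℂ).IsIrreducible := by
    rw [isIrreducible_iff]
    exact ⟨inferInstance, fun U _ => eq_bot_or_eq_top U⟩
  obtain ⟨d, ⟨e⟩⟩ := exists_irrDual (Representation.trivial ℂ G ℂ) hi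
    fun _ _ => continuous_of_discreteTopology
  refine ⟨d, ?_⟩
  rw [← d.finrank_space, ← e.toLinearEquiv.finrank_eq, finrank_self]

/-- A symmetric group has at most two linear characters. -/
theorem card_fst_eq_one_le_two {n : ℕ} (e : Equiv.Perm (Fin n) ≃* G) [Fintype (IrrDual G)] :
    (Finset.univ.filter fun d : IrrDual G => d.1 = 1).card ≤ 2 := by
  classical
  -- Transpositions generate, so without any the group is trivial and has at most one linear
  -- character.
  by_cases hs : ∃ s : Equiv.Perm (Fin n), s.IsSwap
  swap
  · refine (Finset.card_le_one.2 ?_).trans (by norm_num)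
    intro d hd d' hd'
    simp only [Finset.mem_filter, Finset.mem_univ, true_and] at hd hd'
    refine IrrDual.eq_of_smul_id hd hd' fun g => ⟨1, ?_⟩
    obtain ⟨q, rfl⟩ := e.surjective g
    have : q = 1 := by
      have := Equiv.Perm.closure_isSwap (α := Fin n) ▸ Subgroup.mem_top q
      have h0 : {σ : Equiv.Perm (Fin n) | σ.IsSwap} = ∅ :=
        Set.eq_empty_of_forall_notMem fun s h => hs ⟨s, h⟩
      rw [h0, Subgroup.closure_empty] at this
      simpa using this
    rw [this, map_one, map_one, map_one, one_smul, one_smul]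
    exact ⟨rfl, rfl⟩
  obtain ⟨s, hs⟩ := hs
  -- All transpositions are conjugate, so a linear character is determined by its value at `s`,
  -- which is `1` or `-1`.
  have hconj : ∀ (d : IrrDual G) (c : ℂ) (t : Equiv.Perm (Fin n)), d.rep (e s) = c • 1 →
      t.IsSwap → d.rep (e t) = c • 1 := by
    rintro d c t hc ⟨x, y, hxy, rfl⟩
    obtain ⟨x', y', hxy', rfl⟩ := hs
    obtain ⟨q, hq⟩ := isConj_iff.1 (Equiv.Perm.isConj_swap hxy' hxy)
    rw [← hq, map_mul, map_mul, map_mul, map_mul, hc, mul_smul_comm, smul_mul_assoc]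
    congr 1
    rw [mul_one, ← map_mul, ← map_mul, mul_inv_cancel, map_one, map_one]
  choose! c hc using fun (d : IrrDual G) (hd : d.1 = 1) => IrrDual.exists_smul_id hd (e s)
  refine (Finset.card_le_card_of_injOn c (t := {1, -1}) ?_ ?_).trans Finset.card_le_two
  · intro d hd
    simp only [Finset.coe_filter, Finset.mem_univ, true_and, Set.mem_ofPred_eq] at hd
    have h1 : (c d * c d) = 1 := by
      refine d.smul_id_injective ?_
      have h2 : d.rep (e s) * d.rep (e s) = 1 := by
        obtain ⟨x, y, hxy, rfl⟩ := hs
        rw [← map_mul, ← map_mul, Equiv.swap_mul_self, map_one, map_one]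
      rw [hc d hd, smul_mul_smul_comm, mul_one] at h2
      rw [h2, one_smul]
    have := mul_self_eq_one_iff.1 h1
    simpa using this
  · intro d hd d' hd' hcc
    simp only [Finset.coe_filter, Finset.mem_univ, true_and, Set.mem_ofPred_eq] at hd hd'
    refine IrrDual.eq_of_smul_id hd hd' fun g => ?_
    obtain ⟨q, rfl⟩ := e.surjective g
    have hq := Equiv.Perm.mclosure_isSwap (α := Fin n) ▸ Submonoid.mem_top q
    induction hq using Submonoid.closure_induction with
    | mem t ht => exact ⟨c d, hconj d _ t (hc d hd) ht, hconj d' _ t (hcc ▸ hc d' hd') ht⟩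
    | one => exact ⟨1, by rw [map_one, map_one, one_smul], by rw [map_one, map_one, one_smul]⟩
    | mul x y _ _ hx hy =>
      obtain ⟨a, ha, ha'⟩ := hx
      obtain ⟨b, hb, hb'⟩ := hy
      refine ⟨a * b, ?_, ?_⟩
      · rw [map_mul, map_mul, ha, hb, smul_mul_smul_comm, mul_one]
      · rw [map_mul, map_mul, ha', hb', smul_mul_smul_comm, mul_one]

end DegreeOne

/-! ### Zeta series of the stabilizers -/

section FiniteZeta

variable (P : Type*) [Group P] [Finite P]

/-- The number of irreducible representations of degree `k` of a finite group. -/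
def degCount (k : ℕ) : ℕ := Nat.card {d : FinDual P // d.1 = k}

omit [Finite P] in
theorem degCount_eq [Fintype (FinDual P)] (k : ℕ) :
    degCount P k = (Finset.univ.filter fun d : FinDual P => d.1 = k).card := by
  rw [degCount, Nat.card_eq_fintype_card, Fintype.card_subtype]

theorem fst_lt {K : ℕ} (hK : Nat.card P < K ^ 2) (d : FinDual P) : d.1 < K := by
  have := Fintype.ofFinite (FinDual P)
  refine lt_of_pow_lt_pow_left₀ 2 (Nat.zero_le _) (lt_of_le_of_lt ?_ hK)
  rw [← sum_sq_finDual P]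
  exact Finset.single_le_sum (f := fun d : FinDual P => d.1 ^ 2) (fun _ _ => Nat.zero_le _)
    (Finset.mem_univ d)

theorem degCount_zero : degCount P 0 = 0 := by
  have : IsEmpty {d : FinDual P // d.1 = 0} := ⟨fun d => (isGraded_finDual P).1 d.1 d.2⟩
  exact Nat.card_of_isEmpty

theorem degCount_one_pos : 0 < degCount P 1 := by
  let _ : TopologicalSpace P := ⊥
  have : DiscreteTopology P := ⟨rfl⟩
  obtain ⟨d, hd⟩ := exists_fst_eq_one (G := P)
  have : Nonempty {d : FinDual P // d.1 = 1} := ⟨⟨d, hd⟩⟩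
  exact Nat.card_pos

/-- The square of a degree is at most the group order, so degrees below `K` exhaust all classes. -/
theorem sum_degCount {K : ℕ} (hK : Nat.card P < K ^ 2) :
    ∑ k ∈ Finset.range K, degCount P k * k ^ 2 = Nat.card P := by
  have := Fintype.ofFinite (FinDual P)
  rw [← sum_sq_finDual P, ← Finset.sum_fiberwise_of_maps_to (s := Finset.univ)
    (t := Finset.range K) (g := fun d : FinDual P => d.1)
    (fun d _ => Finset.mem_range.2 (fst_lt P hK d))]
  refine Finset.sum_congr rfl fun k _ => ?_
  rw [degCount_eq, ← smul_eq_mul, ← Finset.sum_const]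
  exact Finset.sum_congr rfl fun d hd => by rw [(Finset.mem_filter.1 hd).2]

theorem finZeta_apply {n : ℕ} (hn : n ≠ 0) : finZeta P n = degCount P n := by
  have := Fintype.ofFinite (FinDual P)
  rw [finZeta_eq, dser_apply_of_subset hn Finset.univ fun _ _ => Finset.mem_univ _, degCount_eq,
    ← Finset.sum_filter]
  simp

theorem finZeta_eq_sum {K : ℕ} (hK : Nat.card P < K ^ 2) :
    finZeta P = ∑ k ∈ Finset.range K, (degCount P k : ArithmeticFunction ℂ) * powNeg k := by
  ext n
  have key : ∀ f : ℕ → ArithmeticFunction ℂ,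
      (∑ i ∈ Finset.range K, f i) n = ∑ i ∈ Finset.range K, f i n := by
    intro f
    induction Finset.range K using Finset.induction_on with
    | empty => simp
    | insert a A ha ih => rw [Finset.sum_insert ha, Finset.sum_insert ha,
        ArithmeticFunction.add_apply, ih]
  have hc : ∀ k : ℕ, ((degCount P k : ArithmeticFunction ℂ) * powNeg k) n =
      if n = k ∧ n ≠ 0 then (degCount P k : ℂ) else 0 := by
    intro k
    rw [← nsmul_eq_mul, ← Nat.cast_smul_eq_nsmul ℂ, ArithmeticFunction.smul_map]
    change (degCount P k : ℂ) • (if n = k ∧ n ≠ 0 then (1 : ℂ) else 0) = _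
    simp
  rw [key]
  simp only [hc]
  by_cases hn : n = 0
  · subst hn; simp
  rw [finZeta_apply P hn]
  simp only [hn, ne_eq, not_false_eq_true, and_true]
  rw [Finset.sum_ite_eq]
  split_ifs with h
  · rfl
  · have : IsEmpty {d : FinDual P // d.1 = n} :=
      ⟨fun d => h (Finset.mem_range.2 (d.2 ▸ fst_lt P hK d.1))⟩
    rw [degCount, Nat.card_of_isEmpty, Nat.cast_zero]

theorem powNeg_one : powNeg 1 = 1 := by
  ext n
  change (if n = 1 ∧ n ≠ 0 then (1 : ℂ) else 0) = _
  rw [ArithmeticFunction.one_apply]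
  by_cases h : n = 1 <;> simp [h]

theorem finZeta_of_comm (h : ∀ a b : P, a * b = b * a) :
    finZeta P = (Nat.card P : ArithmeticFunction ℂ) := by
  have h1 : ∀ d : FinDual P, d.1 = 1 := @IrrDual.fst_eq_one_of_comm P _ ⊥ h
  have h2 : ∀ k, k ≠ 1 → degCount P k = 0 := by
    intro k hk
    have : IsEmpty {d : FinDual P // d.1 = k} := ⟨fun d => hk (d.2 ▸ h1 d.1)⟩
    exact Nat.card_of_isEmpty
  have hK : Nat.card P < (Nat.card P + 1) ^ 2 := by nlinarith
  have hm : 1 ∈ Finset.range (Nat.card P + 1) := by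
    have : 0 < Nat.card P := Nat.card_pos
    rw [Finset.mem_range]
    omega
  have h3 := sum_degCount P hK
  rw [Finset.sum_eq_single_of_mem 1 hm fun k _ hk => by rw [h2 k hk, zero_mul]] at h3
  rw [finZeta_eq_sum P hK, Finset.sum_eq_single_of_mem 1 hm fun k _ hk => by
    rw [h2 k hk, Nat.cast_zero, zero_mul], powNeg_one, mul_one, ← h3]
  simp

/-- The element `ab - ba` of the group algebra acts by zero in every class, hence is zero. -/
theorem comm_of_forall_fst_eq_one (h : ∀ d : FinDual P, d.1 = 1) (a b : P) : a * b = b * a := by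
  have : single (a * b) (1 : ℂ) - single (b * a) 1 = 0 := by
    refine eq_zero_of_asAlgebraHom_eq_zero P _ fun d => ?_
    let _ : TopologicalSpace P := ⊥
    obtain ⟨x, hx⟩ := IrrDual.exists_smul_id (h d) a
    rw [map_sub, Representation.asAlgebraHom_single_one, Representation.asAlgebraHom_single_one,
      map_mul, map_mul, hx, sub_eq_zero,
      smul_one_mul, mul_smul_one]
  rw [sub_eq_zero] at this
  exact MonoidAlgebra.single_left_injective one_ne_zero this

/-- The equation `r₁ + 4 r₂ = 6` with `r₂ ≠ 0` has the single solution `(2, 1)`. -/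
theorem finZeta_of_card_six (h6 : Nat.card P = 6) (h : ¬∀ a b : P, a * b = b * a) :
    finZeta P = 2 + powNeg 2 := by
  have hK : Nat.card P < 3 ^ 2 := by omega
  have h1 := sum_degCount P hK
  have h0 := degCount_zero P
  have h2 : degCount P 2 ≠ 0 := by
    intro h2
    refine h (comm_of_forall_fst_eq_one P fun d => ?_)
    have h3 := fst_lt P hK d
    have h4 := (isGraded_finDual P).1 d
    have h5 : d.1 ≠ 2 := fun h5 => by
      have : IsEmpty {d : FinDual P // d.1 = 2} := (Finite.card_eq_zero_iff).1 h2
      exact this.false ⟨d, h5⟩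
    omega
  rw [finZeta_eq_sum P hK]
  simp only [Finset.sum_range_succ, Finset.sum_range_zero, h0] at h1 ⊢
  have h3 : degCount P 1 = 2 := by omega
  have h4 : degCount P 2 = 1 := by omega
  rw [h3, h4, powNeg_one]
  push_cast
  ring

/-- With `1 ≤ r₁ ≤ 2`, the equation `r₁ + 4 r₂ + 9 r₃ + 16 r₄ = 24` has the single solution `(2, 1,
2, 0)`; no character table is needed. -/
theorem finZeta_of_perm_four (e : Equiv.Perm (Fin 4) ≃* P) :
    finZeta P = 2 + powNeg 2 + 2 * powNeg 3 := by
  have h24 : Nat.card P = 24 := by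
    rw [← Nat.card_congr e.toEquiv, Nat.card_eq_fintype_card, Fintype.card_perm,
      Fintype.card_fin]
    rfl
  have hK : Nat.card P < 5 ^ 2 := by omega
  have h1 := sum_degCount P hK
  have h0 := degCount_zero P
  have hp := degCount_one_pos P
  have hl : degCount P 1 ≤ 2 := by
    let _ : TopologicalSpace P := ⊥
    have := Fintype.ofFinite (FinDual P)
    rw [degCount_eq]
    exact card_fst_eq_one_le_two e
  rw [finZeta_eq_sum P hK]
  simp only [Finset.sum_range_succ, Finset.sum_range_zero, h0] at h1 ⊢
  have h2 : degCount P 1 = 2 := by omega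
  have h3 : degCount P 2 = 1 := by omega
  have h4 : degCount P 3 = 2 := by omega
  have h5 : degCount P 4 = 0 := by omega
  rw [h2, h3, h4, h5, powNeg_one]
  push_cast
  ring

end FiniteZeta

/-! ### Orbit sizes -/

section Orbits

variable {Q X : Type*} [Group Q] [Finite Q] [MulAction Q X]

theorem card_orbit_eq_div (x : X) :
    Nat.card (MulAction.orbit Q x) = Nat.card Q / Nat.card (MulAction.stabilizer Q x) := by
  have := Fintype.ofFinite Q
  have : Finite (MulAction.orbit Q x) := Set.finite_range _
  have := Fintype.ofFinite (MulAction.orbit Q x)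
  have := Fintype.ofFinite (MulAction.stabilizer Q x)
  have h := MulAction.card_orbit_mul_card_stabilizer_eq_card_group Q x
  rw [Nat.card_eq_fintype_card, Nat.card_eq_fintype_card, Nat.card_eq_fintype_card, ← h,
    Nat.mul_div_cancel _ Fintype.card_pos]

end Orbits

/-! ### Coincidence patterns and the symmetric groups -/

section Patterns

variable {H : Type*} [Group H] [TopologicalSpace H]

theorem zetaSeriesAt_eq (hH : Rigid H) {f : ℕ} (hf : f ≠ 0) :
    zetaSeriesAt H f = dser (fun d : IrrDual H => d.1 ^ f) 1 := by
  rw [zetaSeriesAt, zetaSeries_eq_dser, dilate_dser ((rigid_iff_isGraded H).1 hH) hf]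

/-- The contribution of the families that are constant on the fibres of a map. -/
theorem dser_constant_on_fibers (hH : Rigid H) {n t : ℕ} (π : Fin n → Fin t)
    (hπ : Function.Surjective π) (p : (Fin n → IrrDual H) → Prop)
    [DecidablePred p] (hp : ∀ σ, p σ ↔ ∀ i j, π i = π j → σ i = σ j) :
    dser famDeg (fun σ : Fin n → IrrDual H => if p σ then 1 else 0) =
      ∏ y, zetaSeriesAt H (Finset.univ.filter fun i => π i = y).card := by
  have hm : ∀ y, (Finset.univ.filter fun i => π i = y).card ≠ 0 := by
    intro y
    obtain ⟨i, hi⟩ := hπ y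
    exact Finset.card_ne_zero_of_mem (Finset.mem_filter.2 ⟨Finset.mem_univ i, hi⟩)
  rw [Finset.prod_congr rfl fun y _ => zetaSeriesAt_eq hH (hm y),
    ← dser_pi fun y => ((rigid_iff_isGraded H).1 hH).pow (hm y),
    dser_injective (isGraded_famDeg hH n) (f := fun τ : Fin t → IrrDual H => τ ∘ π)
      hπ.injective_comp_right p]
  · congr 1
    funext τ
    change ∏ i, (τ (π i)).1 = _
    rw [← Finset.prod_fiberwise' Finset.univ π fun y => (τ y).1]
    simp
  · intro σ
    rw [hp]
    constructor
    · intro h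
      refine ⟨fun y => σ (Function.surjInv hπ y), funext fun i => h _ _ ?_⟩
      exact Function.surjInv_eq hπ _
    · rintro ⟨τ, rfl⟩ i j hij
      exact congrArg τ hij

theorem dser_comp_perm (hH : Rigid H) {n : ℕ} (q : Equiv.Perm (Fin n))
    (w : (Fin n → IrrDual H) → ℂ) :
    dser famDeg (fun σ : Fin n → IrrDual H => w (σ ∘ q)) = dser famDeg w := by
  refine dser_equiv (Equiv.arrowCongr q.symm (Equiv.refl _)) (isGraded_famDeg hH n) (fun σ => ?_) w
  exact (Equiv.prod_comp q fun i => (σ i).1).symm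

/-- Permuting the coordinates preserves `famDeg`, so a weight may be replaced by its average over
the symmetric group. -/
theorem dser_eq_of_sum_perm (hH : Rigid H) {n : ℕ} (w w' : (Fin n → IrrDual H) → ℂ)
    (h : ∀ σ, (n.factorial : ℂ) * w σ = ∑ q : Equiv.Perm (Fin n), w' (σ ∘ q)) :
    dser famDeg w = dser famDeg w' := by
  have hg := isGraded_famDeg hH n
  have h1 := dser_sum hg (Finset.univ : Finset (Equiv.Perm (Fin n))) (fun _ => 1)
    fun q σ => w' (σ ∘ q)
  simp only [one_mul, ← h, dser_comp_perm hH, one_smul, Finset.sum_const, Finset.card_univ,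
    Fintype.card_perm, Fintype.card_fin] at h1
  rw [dser_smul hg, ← Nat.cast_smul_eq_nsmul ℂ] at h1
  exact smul_right_injective _ (Nat.cast_ne_zero.2 n.factorial_ne_zero) h1

/-- The permutations that preserve a family. -/
def invPerms {n : ℕ} {S : Type*} [DecidableEq S] (σ : Fin n → S) : Finset (Equiv.Perm (Fin n)) :=
  Finset.univ.filter fun q => ∀ i, σ (q i) = σ i

/-- The stabilizer sees only which values coincide. The inverse accounts for `q • σ = σ ∘ q⁻¹`. -/
theorem card_stabilizer_perm {n : ℕ} {S T : Type*} [DecidableEq T] (σ : Fin n → S) (τ : Fin n → T)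
    (h : ∀ i j, τ i = τ j ↔ σ i = σ j) :
    Nat.card (MulAction.stabilizer (SymGp n) σ) = (invPerms τ).card := by
  have h1 : ∀ q : SymGp n, q ∈ MulAction.stabilizer (SymGp n) σ ↔ q ∈ invPerms τ := by
    intro q
    rw [← inv_mem_iff, MulAction.mem_stabilizer_iff, funext_iff, invPerms, Finset.mem_filter]
    simp only [Finset.mem_univ, true_and, h]
    refine forall_congr' fun i => ?_
    change σ (q⁻¹⁻¹ i) = σ i ↔ _
    rw [inv_inv]
  rw [Nat.card_congr (Equiv.subtypeEquivRight h1), Nat.card_eq_fintype_card, Fintype.card_coe]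

/-- Each index goes to the least index with the same value. This replaces families with values in an
arbitrary type by finitely many maps, over which statements are decidable. -/
theorem exists_normal_form {n : ℕ} {S : Type*} (σ : Fin n → S) :
    ∃ τ : Fin n → Fin n, (∀ i, τ i ≤ i) ∧ (∀ i, τ (τ i) = τ i) ∧
      ∀ i j, τ i = τ j ↔ σ i = σ j := by
  classical
  have h1 : ∀ i, ∃ k, σ k = σ i ∧ ∀ j, σ j = σ i → k ≤ j := by
    intro i
    obtain ⟨k, hk, hk'⟩ := Finset.exists_min_image (Finset.univ.filter fun j => σ j = σ i) id
      ⟨i, by simp⟩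
    simp only [Finset.mem_filter, Finset.mem_univ, true_and, id] at hk hk'
    exact ⟨k, hk, hk'⟩
  choose τ h2 h3 using h1
  have h4 : ∀ i j, τ i = τ j ↔ σ i = σ j := by
    intro i j
    constructor
    · intro h
      rw [← h2 i, ← h2 j, h]
    · intro h
      exact le_antisymm (h3 i _ ((h2 j).trans h.symm)) (h3 j _ ((h2 i).trans h))
  exact ⟨τ, fun i => h3 i i rfl, fun i => (h4 _ _).2 (h2 i), h4⟩

theorem dser_pattern (hH : Rigid H) {n t : ℕ} (π : Fin n → Fin t) (m : Fin t → ℕ)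
    (hm : ∀ y, (Finset.univ.filter fun i => π i = y).card = m y)
    (hπ : Function.Surjective π) (p : (Fin n → IrrDual H) → Prop)
    [DecidablePred p] (hp : ∀ σ, p σ ↔ ∀ i j, π i = π j → σ i = σ j) :
    dser famDeg (fun σ : Fin n → IrrDual H => if p σ then 1 else 0) = ∏ y, zetaSeriesAt H (m y) := by
  rw [dser_constant_on_fibers hH π hπ p hp]
  exact Finset.prod_congr rfl fun y _ => by rw [hm]

-- The coefficients express the indicator of a stabilizer order, after symmetrization, through
-- coincidences of entries. The hypothesis `h` is the finite verification on normal forms; each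
-- coincidence condition then contributes a product of dilated zeta series, one for each block of
-- equal entries.
open Classical in
theorem dser_card_stabilizer_three (hH : Rigid H) (k : ℕ) (c₁ c₂ c₃ : ℤ)
    (h : ∀ τ : Fin 3 → Fin 3, (∀ i, τ i ≤ i) → (∀ i, τ (τ i) = τ i) →
      6 * (if (invPerms τ).card = k then 1 else 0) = ∑ q : Equiv.Perm (Fin 3),
        (c₁ + c₂ * (if τ (q 0) = τ (q 1) then 1 else 0) +
          c₃ * if τ (q 0) = τ (q 1) ∧ τ (q 1) = τ (q 2) then 1 else 0)) :
    dser famDeg (fun σ : Fin 3 → IrrDual H =>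
        if Nat.card (MulAction.stabilizer (SymGp 3) σ) = k then 1 else 0) =
      (c₁ : ArithmeticFunction ℂ) * zetaSeriesAt H 1 ^ 3 +
        c₂ * (zetaSeriesAt H 2 * zetaSeriesAt H 1) + c₃ * zetaSeriesAt H 3 := by
  have hg := isGraded_famDeg hH 3
  rw [dser_eq_of_sum_perm hH _ fun σ => ((c₁ : ℂ) * (if True then 1 else 0) +
    c₂ * (if σ 0 = σ 1 then 1 else 0)) + c₃ * if σ 0 = σ 1 ∧ σ 1 = σ 2 then 1 else 0]
  · rw [dser_add hg, dser_add hg, dser_smul hg, dser_smul hg, dser_smul hg,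
      dser_pattern hH (id : Fin 3 → Fin 3) ![1, 1, 1] (by decide) Function.surjective_id
        (fun _ => True) (by simp),
      dser_pattern hH (![0, 0, 1] : Fin 3 → Fin 2) ![2, 1] (by decide) (by decide)
        (fun σ => σ 0 = σ 1) (fun σ => by simp [Fin.forall_fin_succ]; grind),
      dser_pattern hH (![0, 0, 0] : Fin 3 → Fin 1) ![3] (by decide) (by decide)
        (fun σ => σ 0 = σ 1 ∧ σ 1 = σ 2) (fun σ => by simp [Fin.forall_fin_succ]; grind)]
    simp only [Int.cast_smul_eq_zsmul, zsmul_eq_mul, Fin.prod_univ_succ, Fin.prod_univ_zero,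
      Matrix.cons_val_zero, Matrix.cons_val_succ]
    ring
  · intro σ
    obtain ⟨τ, h1, h2, h3⟩ := exists_normal_form σ
    have := congrArg (Int.cast : ℤ → ℂ) (h τ h1 h2)
    rw [card_stabilizer_perm σ τ h3]
    simp only [h3] at this
    push_cast at this
    simpa [Nat.factorial] using this

open Classical in
theorem dser_card_stabilizer_four (hH : Rigid H) (k : ℕ) (c₁ c₂ c₃ c₄ c₅ : ℤ)
    (h : ∀ τ : Fin 4 → Fin 4, (∀ i, τ i ≤ i) → (∀ i, τ (τ i) = τ i) →
      24 * (if (invPerms τ).card = k then 1 else 0) = ∑ q : Equiv.Perm (Fin 4),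
        (c₁ + c₂ * (if τ (q 0) = τ (q 1) then 1 else 0) +
          c₃ * (if τ (q 0) = τ (q 1) ∧ τ (q 1) = τ (q 2) then 1 else 0) +
          c₄ * (if τ (q 0) = τ (q 1) ∧ τ (q 2) = τ (q 3) then 1 else 0) +
          c₅ * if τ (q 0) = τ (q 1) ∧ τ (q 1) = τ (q 2) ∧ τ (q 2) = τ (q 3) then 1 else 0)) :
    dser famDeg (fun σ : Fin 4 → IrrDual H =>
        if Nat.card (MulAction.stabilizer (SymGp 4) σ) = k then 1 else 0) =
      (c₁ : ArithmeticFunction ℂ) * zetaSeriesAt H 1 ^ 4 +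
        c₂ * (zetaSeriesAt H 1 ^ 2 * zetaSeriesAt H 2) +
        c₃ * (zetaSeriesAt H 1 * zetaSeriesAt H 3) + c₄ * zetaSeriesAt H 2 ^ 2 +
        c₅ * zetaSeriesAt H 4 := by
  have hg := isGraded_famDeg hH 4
  rw [dser_eq_of_sum_perm hH _ fun σ => ((((c₁ : ℂ) * (if True then 1 else 0) +
    c₂ * (if σ 0 = σ 1 then 1 else 0)) + c₃ * (if σ 0 = σ 1 ∧ σ 1 = σ 2 then 1 else 0)) +
    c₄ * (if σ 0 = σ 1 ∧ σ 2 = σ 3 then 1 else 0)) +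
    c₅ * if σ 0 = σ 1 ∧ σ 1 = σ 2 ∧ σ 2 = σ 3 then 1 else 0]
  · rw [dser_add hg, dser_add hg, dser_add hg, dser_add hg, dser_smul hg, dser_smul hg,
      dser_smul hg, dser_smul hg, dser_smul hg,
      dser_pattern hH (id : Fin 4 → Fin 4) ![1, 1, 1, 1] (by decide) Function.surjective_id
        (fun _ => True) (by simp),
      dser_pattern hH (![0, 0, 1, 2] : Fin 4 → Fin 3) ![2, 1, 1] (by decide) (by decide)
        (fun σ => σ 0 = σ 1) (fun σ => by simp [Fin.forall_fin_succ]; grind),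
      dser_pattern hH (![0, 0, 0, 1] : Fin 4 → Fin 2) ![3, 1] (by decide) (by decide)
        (fun σ => σ 0 = σ 1 ∧ σ 1 = σ 2) (fun σ => by simp [Fin.forall_fin_succ]; grind),
      dser_pattern hH (![0, 0, 1, 1] : Fin 4 → Fin 2) ![2, 2] (by decide) (by decide)
        (fun σ => σ 0 = σ 1 ∧ σ 2 = σ 3) (fun σ => by simp [Fin.forall_fin_succ]; grind),
      dser_pattern hH (![0, 0, 0, 0] : Fin 4 → Fin 1) ![4] (by decide) (by decide)
        (fun σ => σ 0 = σ 1 ∧ σ 1 = σ 2 ∧ σ 2 = σ 3)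
        (fun σ => by simp [Fin.forall_fin_succ]; grind)]
    simp only [Int.cast_smul_eq_zsmul, zsmul_eq_mul, Fin.prod_univ_succ, Fin.prod_univ_zero,
      Matrix.cons_val_zero, Matrix.cons_val_succ]
    ring
  · intro σ
    obtain ⟨τ, h1, h2, h3⟩ := exists_normal_form σ
    have := congrArg (Int.cast : ℤ → ℂ) (h τ h1 h2)
    rw [card_stabilizer_perm σ τ h3]
    simp only [h3] at this
    push_cast at this
    simpa [Nat.factorial] using this

theorem comm_of_card_four {P : Type*} [Group P] (h : Nat.card P = 4) (a b : P) :
    a * b = b * a := by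
  have : Fact (Nat.Prime 2) := ⟨Nat.prime_two⟩
  exact (IsPGroup.isMulCommutative_of_card_eq_prime_sq (p := 2) h).is_comm.comm a b

theorem comm_of_card_two {P : Type*} [Group P] (h : Nat.card P = 2) (a b : P) :
    a * b = b * a := by
  have : Fact (Nat.Prime 2) := ⟨Nat.prime_two⟩
  have : IsCyclic P := isCyclic_of_prime_card h
  exact (IsCyclic.isMulCommutative (α := P)).is_comm.comm a b

theorem comm_of_card_one {P : Type*} [Group P] (h : Nat.card P = 1) (a b : P) :
    a * b = b * a := by
  have := (Nat.card_eq_one_iff_unique.1 h).1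
  exact Subsingleton.elim _ _

/-- By Cauchy's theorem a subgroup of order six has elements of orders two and three; if it were
commutative they would form a pair excluded by `hG`. -/
theorem not_comm_of_card_six {G : Type*} [Group G] [Finite G]
    (hG : ∀ a b : G, a * b = b * a ∧ a ^ 2 = 1 ∧ b ^ 3 = 1 → a = 1 ∨ b = 1)
    (K : Subgroup G) (h : Nat.card K = 6) : ¬∀ a b : K, a * b = b * a := by
  intro hc
  have : Fact (Nat.Prime 2) := ⟨Nat.prime_two⟩
  have : Fact (Nat.Prime 3) := ⟨Nat.prime_three⟩
  obtain ⟨a, ha⟩ := exists_prime_orderOf_dvd_card' (G := K) 2 (by rw [h]; norm_num)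
  obtain ⟨b, hb⟩ := exists_prime_orderOf_dvd_card' (G := K) 3 (by rw [h]; norm_num)
  rcases hG a b ⟨congrArg Subtype.val (hc a b),
    by have := pow_orderOf_eq_one a; rw [ha] at this; exact congrArg Subtype.val this,
    by have := pow_orderOf_eq_one b; rw [hb] at this; exact congrArg Subtype.val this⟩ with h1 | h1
  · rw [OneMemClass.coe_eq_one] at h1
    rw [h1, orderOf_one] at ha
    omega
  · rw [OneMemClass.coe_eq_one] at h1
    rw [h1, orderOf_one] at hb
    omega

theorem perm_three_commuting : ∀ a b : Equiv.Perm (Fin 3), a * b = b * a ∧ a ^ 2 = 1 ∧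
    b ^ 3 = 1 → a = 1 ∨ b = 1 := by
  decide +kernel

theorem zetaSeries_wreath_symGp_three (hH : Rigid H) :
    Rigid (Wreath H (Fin 3) (SymGp 3)) ∧
      zetaSeries (Wreath H (Fin 3) (SymGp 3)) =
        ((6 : ℂ)⁻¹ • powNeg 6) * zetaSeriesAt H 1 ^ 3 +
          (-((2 : ℂ)⁻¹ • powNeg 6) + (2 : ℂ) • powNeg 3) *
            (zetaSeriesAt H 2 * zetaSeriesAt H 1) +
          ((3 : ℂ)⁻¹ • powNeg 6 - (2 : ℂ) • powNeg 3 + powNeg 2 + 2) * zetaSeriesAt H 3 := by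
  have hQ : Nat.card (SymGp 3) = 6 := by
    rw [Nat.card_eq_fintype_card, Fintype.card_perm, Fintype.card_fin]
    rfl
  have hA : ∀ σ : Fin 3 → IrrDual H,
      Nat.card (MulAction.stabilizer (SymGp 3) σ) ∈ ({1, 2, 6} : Finset ℕ) := by
    intro σ
    obtain ⟨τ, h1, h2, h3⟩ := exists_normal_form σ
    rw [card_stabilizer_perm σ τ h3]
    revert τ
    have : ∀ τ : Fin 3 → Fin 3, (∀ i, τ i ≤ i) → (∀ i, τ (τ i) = τ i) →
      (invPerms τ).card ∈ ({1, 2, 6} : Finset ℕ) := by decide +kernel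
    exact fun τ h1 h2 _ => this τ h1 h2
  -- Families are labelled by the order `e` of the stabilizer; the orbit then has `6 / e` elements,
  -- and `e` also determines the zeta series of the stabilizer.
  have h1 := wreath_zetaSeries (Q := SymGp 3) hH {1, 2, 6}
    (fun σ => Nat.card (MulAction.stabilizer (SymGp 3) σ)) hA
    (fun e => (((6 / e : ℕ) : ℂ)⁻¹ • powNeg (6 / e)) *
      if e = 6 then 2 + powNeg 2 else (e : ArithmeticFunction ℂ)) fun σ => by
      rw [card_orbit_eq_div, hQ]
      congr 1
      have h2 := hA σ
      simp only [Finset.mem_insert, Finset.mem_singleton] at h2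
      rcases h2 with h2 | h2 | h2
      · rw [if_neg (by omega), finZeta_of_comm _ (comm_of_card_one h2)]
      · rw [if_neg (by omega), finZeta_of_comm _ (comm_of_card_two h2)]
      · rw [if_pos h2, finZeta_of_card_six _ h2 (not_comm_of_card_six perm_three_commuting _ h2)]
  refine ⟨h1.1, h1.2.trans ?_⟩
  -- The coefficients come from inclusion–exclusion over set partitions: orders 1, 2, 6 mean all
  -- entries distinct, exactly two equal, all equal.
  rw [Finset.sum_insert (by decide), Finset.sum_insert (by decide), Finset.sum_singleton,
    dser_card_stabilizer_three hH 1 1 (-3) 2 (by decide +kernel),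
    dser_card_stabilizer_three hH 2 0 3 (-3) (by decide +kernel),
    dser_card_stabilizer_three hH 6 0 0 1 (by decide +kernel)]
  -- Scalar multiples of `powNeg` are atoms for `ring`, so those in the statement are first written
  -- as integer multiples of those in the sum.
  have e1 : (3 : ℂ)⁻¹ • powNeg 6 = 2 * ((6 : ℂ)⁻¹ • powNeg 6) := by
    rw [two_mul, ← add_smul]; norm_num
  have e2 : (2 : ℂ)⁻¹ • powNeg 6 = 3 * ((6 : ℂ)⁻¹ • powNeg 6) := by
    rw [show (3 : ArithmeticFunction ℂ) = 1 + 1 + 1 by norm_num, add_mul, add_mul, one_mul,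
      ← add_smul, ← add_smul]; norm_num
  have e3 : (2 : ℂ) • powNeg 3 = 6 * ((3 : ℂ)⁻¹ • powNeg 3) := by
    rw [show (6 : ArithmeticFunction ℂ) = 1 + 1 + 1 + 1 + 1 + 1 by norm_num]
    simp only [add_mul, one_mul, ← add_smul]; norm_num
  rw [e1, e2, e3]
  simp only [Nat.reduceDiv, Nat.reduceEqDiff, if_true, if_false, Nat.cast_ofNat, Nat.cast_one,
    inv_one, one_smul, powNeg_one]
  push_cast
  ring

theorem perm_four_commuting : ∀ a b : Equiv.Perm (Fin 4), a * b = b * a ∧ a ^ 2 = 1 ∧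
    b ^ 3 = 1 → a = 1 ∨ b = 1 := by
  decide +kernel

/-- Stabilizers are Young subgroups, and the orders 1, 2, 4, 6, 24 separate the five partitions of
4. Order 4 comes from the pattern `2 + 2`, order 6 from `3 + 1`; only the orders 6 and 24 have
nonlinear representations. -/
theorem zetaSeries_wreath_symGp_four (hH : Rigid H) :
    Rigid (Wreath H (Fin 4) (SymGp 4)) ∧
      zetaSeries (Wreath H (Fin 4) (SymGp 4)) =
        ((24 : ℂ)⁻¹ • powNeg 24) *
            (zetaSeriesAt H 1 ^ 4 - 6 * (zetaSeriesAt H 1 ^ 2 * zetaSeriesAt H 2) +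
              8 * (zetaSeriesAt H 1 * zetaSeriesAt H 3) + 3 * zetaSeriesAt H 2 ^ 2 -
              6 * zetaSeriesAt H 4) +
          6 * ((12 : ℂ)⁻¹ • powNeg 12) * 2 *
            (zetaSeriesAt H 1 ^ 2 * zetaSeriesAt H 2 -
              2 * (zetaSeriesAt H 1 * zetaSeriesAt H 3) - zetaSeriesAt H 2 ^ 2 +
              2 * zetaSeriesAt H 4) +
          4 * ((4 : ℂ)⁻¹ • powNeg 4) * (2 + powNeg 2) *
            (zetaSeriesAt H 1 * zetaSeriesAt H 3 - zetaSeriesAt H 4) +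
          3 * ((6 : ℂ)⁻¹ • powNeg 6) * 4 * (zetaSeriesAt H 2 ^ 2 - zetaSeriesAt H 4) +
          (2 + powNeg 2 + 2 * powNeg 3) * zetaSeriesAt H 4 := by
  have hQ : Nat.card (SymGp 4) = 24 := by
    rw [Nat.card_eq_fintype_card, Fintype.card_perm, Fintype.card_fin]
    rfl
  have hA : ∀ σ : Fin 4 → IrrDual H,
      Nat.card (MulAction.stabilizer (SymGp 4) σ) ∈ ({1, 2, 4, 6, 24} : Finset ℕ) := by
    intro σ
    obtain ⟨τ, h1, h2, h3⟩ := exists_normal_form σ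
    rw [card_stabilizer_perm σ τ h3]
    revert τ
    have : ∀ τ : Fin 4 → Fin 4, (∀ i, τ i ≤ i) → (∀ i, τ (τ i) = τ i) →
      (invPerms τ).card ∈ ({1, 2, 4, 6, 24} : Finset ℕ) := by decide +kernel
    exact fun τ h1 h2 _ => this τ h1 h2
  have h1 := wreath_zetaSeries (Q := SymGp 4) hH {1, 2, 4, 6, 24}
    (fun σ => Nat.card (MulAction.stabilizer (SymGp 4) σ)) hA
    (fun e => (((24 / e : ℕ) : ℂ)⁻¹ • powNeg (24 / e)) *
      if e = 24 then 2 + powNeg 2 + 2 * powNeg 3 else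
      if e = 6 then 2 + powNeg 2 else (e : ArithmeticFunction ℂ)) fun σ => by
      rw [card_orbit_eq_div, hQ]
      congr 1
      have h2 := hA σ
      simp only [Finset.mem_insert, Finset.mem_singleton] at h2
      rcases h2 with h2 | h2 | h2 | h2 | h2
      · rw [if_neg (by omega), if_neg (by omega), finZeta_of_comm _ (comm_of_card_one h2)]
      · rw [if_neg (by omega), if_neg (by omega), finZeta_of_comm _ (comm_of_card_two h2)]
      · rw [if_neg (by omega), if_neg (by omega), finZeta_of_comm _ (comm_of_card_four h2)]
      · rw [if_neg (by omega), if_pos h2,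
          finZeta_of_card_six _ h2 (not_comm_of_card_six perm_four_commuting _ h2)]
      · have h3 : MulAction.stabilizer (SymGp 4) σ = ⊤ :=
          Subgroup.eq_top_of_card_eq _ (h2.trans hQ.symm)
        rw [if_pos h2, finZeta_of_perm_four _
          (Subgroup.topEquiv.symm.trans (MulEquiv.subgroupCongr h3.symm))]
  refine ⟨h1.1, h1.2.trans ?_⟩
  rw [Finset.sum_insert (by decide), Finset.sum_insert (by decide), Finset.sum_insert (by decide),
    Finset.sum_insert (by decide), Finset.sum_singleton,
    dser_card_stabilizer_four hH 1 1 (-6) 8 3 (-6) (by decide +kernel),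
    dser_card_stabilizer_four hH 2 0 6 (-12) (-6) 12 (by decide +kernel),
    dser_card_stabilizer_four hH 4 0 0 0 3 (-3) (by decide +kernel),
    dser_card_stabilizer_four hH 6 0 0 4 0 (-4) (by decide +kernel),
    dser_card_stabilizer_four hH 24 0 0 0 0 1 (by decide +kernel)]
  simp only [Nat.reduceDiv, Nat.reduceEqDiff, if_true, if_false, Nat.cast_ofNat, Nat.cast_one,
    inv_one, one_smul, powNeg_one]
  push_cast
  ring

end Patterns


/-! ### Cyclic groups and Möbius inversion -/

section Cyclic

/-- With `k = e m` and `f = e g`, the sum becomes that of `μ(g)` over `g ∣ m`. Divisors of `k` are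
divisors of `d`, so none is missed. -/
theorem sum_moebius_div (d e k : ℕ) (hd : d ≠ 0) (hk : k ∣ d) :
    ∑ f ∈ d.divisors with e ∣ f, ArithmeticFunction.moebius (f / e) * (if f ∣ k then 1 else 0) =
      if k = e then 1 else 0 := by
  have hk0 : k ≠ 0 := ne_zero_of_dvd_ne_zero hd hk
  by_cases he : e ∣ k
  · obtain ⟨m, rfl⟩ := he
    have he0 : e ≠ 0 := left_ne_zero_of_mul hk0
    have hm0 : m ≠ 0 := right_ne_zero_of_mul hk0
    have h1 : (ArithmeticFunction.moebius * (ArithmeticFunction.zeta : ArithmeticFunction ℤ)) m =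
        (1 : ArithmeticFunction ℤ) m := by rw [ArithmeticFunction.moebius_mul_coe_zeta]
    rw [ArithmeticFunction.coe_mul_zeta_apply, ArithmeticFunction.one_apply] at h1
    simp only [mul_ite, mul_one, mul_zero]
    rw [← Finset.sum_filter, show (if e * m = e then (1 : ℤ) else 0) = if m = 1 then 1 else 0 by
      simp [he0], ← h1]
    symm
    refine Finset.sum_bij (fun g _ => e * g) ?_ ?_ ?_ ?_
    · intro g hg
      have hg := Nat.dvd_of_mem_divisors hg
      simp only [Finset.mem_filter, Nat.mem_divisors]
      exact ⟨⟨⟨(mul_dvd_mul_left e hg).trans hk, hd⟩, dvd_mul_right _ _⟩, mul_dvd_mul_left e hg⟩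
    · intro g _ g' _ h
      exact Nat.eq_of_mul_eq_mul_left (Nat.pos_of_ne_zero he0) h
    · intro f hf
      simp only [Finset.mem_filter, Nat.mem_divisors] at hf
      obtain ⟨⟨_, g, rfl⟩, hg⟩ := hf
      exact ⟨g, Nat.mem_divisors.2 ⟨Nat.dvd_of_mul_dvd_mul_left (Nat.pos_of_ne_zero he0) hg, hm0⟩,
        rfl⟩
    · intro g _
      rw [Nat.mul_div_cancel_left _ (Nat.pos_of_ne_zero he0)]
  · rw [if_neg fun h : k = e => he (h ▸ dvd_rfl)]
    refine Finset.sum_eq_zero fun f hf => ?_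
    rw [if_neg fun h => he ((Finset.mem_filter.1 hf).2.trans h), mul_zero]

theorem finRotate_pow_apply {d : ℕ} [NeZero d] (k : ℕ) (i : Fin d) :
    ((finRotate d ^ k) i : ℕ) = (i + k) % d := by
  induction k with
  | zero => simp [Nat.mod_eq_of_lt i.2]
  | succ k ih =>
    rw [pow_succ', Equiv.Perm.mul_apply, finRotate_apply, Fin.val_add, ih, Fin.val_one']
    simp [add_assoc]

theorem card_cycGp {d : ℕ} [NeZero d] : Nat.card (CycGp d) = d := by
  rw [Nat.card_zpowers]
  refine (orderOf_eq_iff (NeZero.pos d)).2 ⟨?_, fun m hm hm0 h => ?_⟩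
  · ext i
    rw [finRotate_pow_apply]
    simp [Nat.mod_eq_of_lt i.2]
  · have := congrArg Fin.val (Equiv.congr_fun h (0 : Fin d))
    rw [finRotate_pow_apply] at this
    simp [Nat.mod_eq_of_lt hm] at this
    omega

/-- In a cyclic group `x ^ |K| = 1` has at most `|K|` solutions, so `K` consists of all of them; the
indicated power of `g` has order exactly `f`. -/
theorem dvd_card_subgroup_iff {G : Type*} [Group G] [Finite G] (g : G)
    (hg : ∀ x, x ∈ Subgroup.zpowers g) (K : Subgroup G) {f : ℕ} (hf : f ∣ Nat.card G) :
    f ∣ Nat.card K ↔ g ^ (Nat.card G / f) ∈ K := by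
  have hG : Nat.card G ≠ 0 := Nat.card_pos.ne'
  have ho : orderOf g = Nat.card G := orderOf_eq_card_of_forall_mem_zpowers hg
  obtain ⟨k, hk⟩ := hf
  have hf0 : f ≠ 0 := left_ne_zero_of_mul (hk ▸ hG)
  have hk0 : k ≠ 0 := right_ne_zero_of_mul (hk ▸ hG)
  have hd : Nat.card G / f = k := by rw [hk, Nat.mul_div_cancel_left _ (Nat.pos_of_ne_zero hf0)]
  have hof : orderOf (g ^ k) = f := by
    rw [orderOf_pow_of_dvd hk0 (by rw [ho, hk]; exact dvd_mul_left _ _), ho, hk,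
      Nat.mul_div_cancel _ (Nat.pos_of_ne_zero hk0)]
  rw [hd]
  constructor
  · intro h
    classical
    have := Fintype.ofFinite G
    have hc : IsCyclic G := ⟨g, hg⟩
    have h1 := IsCyclic.card_pow_eq_one_le (α := G) (n := Nat.card K) Nat.card_pos
    have h2 : (K : Set G).toFinset ⊆ Finset.univ.filter fun x : G => x ^ Nat.card K = 1 := by
      intro x hx
      have hx : x ∈ K := by simpa using hx
      rw [Finset.mem_filter]
      refine ⟨Finset.mem_univ _, ?_⟩
      have := pow_card_eq_one' (x := (⟨x, hx⟩ : K))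
      exact congrArg Subtype.val this
    have h3 : (K : Set G).toFinset.card = Nat.card K := by
      rw [Set.toFinset_card, Nat.card_eq_fintype_card]; rfl
    have h4 := Finset.eq_of_subset_of_card_le h2 (by rw [h3]; exact h1)
    have h5 : g ^ k ∈ (K : Set G).toFinset := by
      rw [h4, Finset.mem_filter]
      exact ⟨Finset.mem_univ _, orderOf_dvd_iff_pow_eq_one.1 (hof ▸ h)⟩
    simpa using h5
  · intro h
    rw [← hof]
    exact Subgroup.orderOf_dvd_natCard K h

/-- Extended `d`-periodically to `ℕ`, a family fixed by rotation through `k` is `k`-periodic. -/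
theorem pow_mem_stabilizer_iff {S : Type*} {d k : ℕ} [NeZero d] (hk : k ∣ d) (σ : Fin d → S) :
    (⟨finRotate d, Subgroup.mem_zpowers _⟩ : CycGp d) ^ k ∈ MulAction.stabilizer (CycGp d) σ ↔
      ∀ i j : Fin d, (i : ℕ) % k = j % k → σ i = σ j := by
  have h1 : (⟨finRotate d, Subgroup.mem_zpowers _⟩ : CycGp d) ^ k ∈
      MulAction.stabilizer (CycGp d) σ ↔ ∀ i : Fin d, σ i = σ ((finRotate d ^ k) i) := by
    rw [← inv_mem_iff, MulAction.mem_stabilizer_iff, funext_iff]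
    refine forall_congr' fun i => ?_
    change σ ((((⟨finRotate d, _⟩ : CycGp d) ^ k)⁻¹)⁻¹ • i) = _ ↔ _
    rw [inv_inv]
    exact eq_comm
  rw [h1]
  constructor
  · intro h
    let s : ℕ → S := fun n => σ ⟨n % d, Nat.mod_lt _ (NeZero.pos d)⟩
    have hs : Function.Periodic s k := by
      intro n
      have := h ⟨n % d, Nat.mod_lt _ (NeZero.pos d)⟩
      simp only [s]
      rw [this]
      congr 1
      ext
      rw [finRotate_pow_apply]
      simp
    have hv : ∀ i : Fin d, σ i = s (i % k) := by
      intro i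
      rw [hs.map_mod_nat]
      simp only [s]
      congr 1
      ext
      exact (Nat.mod_eq_of_lt i.2).symm
    intro i j hij
    rw [hv i, hv j, hij]
  · intro h i
    refine h _ _ ?_
    rw [finRotate_pow_apply, Nat.mod_mod_of_dvd _ hk, Nat.add_mod_right]

theorem card_filter_mod {f k : ℕ} (y : Fin k) :
    (Finset.univ.filter fun i : Fin (f * k) =>
      (⟨i % k, Nat.mod_lt _ y.pos⟩ : Fin k) = y).card = f := by
  have : (Finset.univ.filter fun i : Fin (f * k) =>
      (⟨i % k, Nat.mod_lt _ y.pos⟩ : Fin k) = y) =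
      Finset.univ.image fun j : Fin f => finProdFinEquiv (j, y) := by
    ext i
    simp only [Finset.mem_filter, Finset.mem_univ, true_and, Finset.mem_image]
    constructor
    · intro h
      refine ⟨(finProdFinEquiv.symm i).1, ?_⟩
      rw [← Equiv.eq_symm_apply]
      refine Prod.ext rfl ?_
      rw [← h]
      rfl
    · rintro ⟨j, rfl⟩
      ext
      simp [Nat.mod_eq_of_lt y.2]
  rw [this, Finset.card_image_of_injective _ fun j j' h => by simpa using h]
  simp

variable {H : Type*} [Group H] [TopologicalSpace H]

/-- Divisibility by `f` means period `k = d / f`: the family is constant on each of the `k` residue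
classes mod `k`, and each class has `f` elements. -/
theorem dser_dvd_card_stabilizer (hH : Rigid H) {d f : ℕ} [NeZero d] (hf : f ∣ d) :
    dser famDeg (fun σ : Fin d → IrrDual H =>
      if f ∣ Nat.card (MulAction.stabilizer (CycGp d) σ) then 1 else 0) =
      zetaSeriesAt H f ^ (d / f) := by
  obtain ⟨k, rfl⟩ := hf
  have h0 := NeZero.ne (f * k)
  have hf0 : 0 < f := Nat.pos_of_ne_zero (left_ne_zero_of_mul h0)
  have hk0 : 0 < k := Nat.pos_of_ne_zero (right_ne_zero_of_mul h0)
  have hgen : ∀ x : CycGp (f * k), x ∈ Subgroup.zpowers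
      (⟨finRotate (f * k), Subgroup.mem_zpowers _⟩ : CycGp (f * k)) := by
    rintro ⟨x, m, rfl⟩
    exact ⟨m, rfl⟩
  have hdiv : f * k / f = k := Nat.mul_div_cancel_left _ hf0
  rw [hdiv]
  have := dser_constant_on_fibers hH
    (fun i : Fin (f * k) => (⟨i % k, Nat.mod_lt _ hk0⟩ : Fin k)) (fun y => by
      have h1 := card_filter_mod (f := f) y
      have h2 : (Finset.univ.filter fun i : Fin (f * k) =>
        (⟨i % k, Nat.mod_lt _ y.pos⟩ : Fin k) = y).Nonempty := by
        rw [← Finset.card_pos, h1]; exact hf0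
      obtain ⟨i, hi⟩ := h2
      exact ⟨i, (Finset.mem_filter.1 hi).2⟩)
    (fun σ => f ∣ Nat.card (MulAction.stabilizer (CycGp (f * k)) σ)) (fun σ => by
      rw [dvd_card_subgroup_iff _ hgen _ (by rw [card_cycGp]; exact dvd_mul_right _ _), card_cycGp,
        hdiv, pow_mem_stabilizer_iff (dvd_mul_left _ _)]
      simp only [Fin.mk.injEq])
  refine this.trans ?_
  rw [Finset.prod_congr rfl fun y _ => by rw [card_filter_mod], Finset.prod_const,
    Finset.card_univ, Fintype.card_fin]

theorem cycGp_comm {d : ℕ} (K : Subgroup (CycGp d)) : ∀ a b : K, a * b = b * a := by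
  rintro ⟨⟨_, i, rfl⟩, _⟩ ⟨⟨_, j, rfl⟩, _⟩
  exact Subtype.ext (Subtype.ext ((Commute.refl (finRotate d)).zpow_zpow i j))

theorem zetaSeries_wreath_cycGp (hH : Rigid H) {d : ℕ} (hd : d ≠ 0) :
    Rigid (Wreath H (Fin d) (CycGp d)) ∧
      zetaSeries (Wreath H (Fin d) (CycGp d)) =
        ∑ e ∈ d.divisors, ((((d / e : ℕ) : ℂ)⁻¹ * (e : ℂ)) • powNeg (d / e)) *
          ∑ f ∈ d.divisors with e ∣ f,
            ((ArithmeticFunction.moebius (f / e) : ℤ) : ℂ) • zetaSeriesAt H f ^ (d / f) := by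
  have : NeZero d := ⟨hd⟩
  have hcard : ∀ σ : Fin d → IrrDual H, Nat.card (MulAction.stabilizer (CycGp d) σ) ∣ d := by
    intro σ
    have := Subgroup.card_subgroup_dvd_card (MulAction.stabilizer (CycGp d) σ)
    rwa [card_cycGp] at this
  have h1 := wreath_zetaSeries (Q := CycGp d) hH d.divisors
    (fun σ => Nat.card (MulAction.stabilizer (CycGp d) σ))
    (fun σ => Nat.mem_divisors.2 ⟨hcard σ, hd⟩)
    (fun e => (((d / e : ℕ) : ℂ)⁻¹ * (e : ℂ)) • powNeg (d / e)) fun σ => by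
      rw [card_orbit_eq_div, card_cycGp, finZeta_of_comm _ (cycGp_comm _), mul_comm _
        (Nat.cast _), ← nsmul_eq_mul, ← Nat.cast_smul_eq_nsmul ℂ, smul_smul, mul_comm]
  refine ⟨h1.1, h1.2.trans (Finset.sum_congr rfl fun e he => ?_)⟩
  congr 1
  have h2 : (fun σ : Fin d → IrrDual H =>
      if Nat.card (MulAction.stabilizer (CycGp d) σ) = e then (1 : ℂ) else 0) = fun σ =>
      ∑ f ∈ d.divisors with e ∣ f, ((ArithmeticFunction.moebius (f / e) : ℤ) : ℂ) *
        (if f ∣ Nat.card (MulAction.stabilizer (CycGp d) σ) then 1 else 0) := by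
    funext σ
    have := congrArg (Int.cast : ℤ → ℂ) (sum_moebius_div d e _ hd (hcard σ))
    push_cast at this
    exact this.symm
  rw [h2, dser_sum (isGraded_famDeg hH d)]
  refine Finset.sum_congr rfl fun f hf => ?_
  rw [dser_dvd_card_stabilizer hH (Nat.dvd_of_mem_divisors (Finset.mem_filter.1 hf).1)]

end Cyclic

/-! ### From formal identities to convergent series -/

section Analytic

variable {f g : ArithmeticFunction ℂ} {s a b : ℂ}

/-- The Dirichlet series `f` converges absolutely at `s`, with sum `a`. -/
def SumsTo (f : ArithmeticFunction ℂ) (s a : ℂ) : Prop := LSeriesHasSum f s a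

theorem SumsTo.add (hf : SumsTo f s a) (hg : SumsTo g s b) : SumsTo (f + g) s (a + b) :=
  LSeriesHasSum.add hf hg

theorem SumsTo.sub (hf : SumsTo f s a) (hg : SumsTo g s b) : SumsTo (f - g) s (a - b) :=
  LSeriesHasSum.sub hf hg

theorem SumsTo.neg (hf : SumsTo f s a) : SumsTo (-f) s (-a) := LSeriesHasSum.neg hf

theorem SumsTo.smul (c : ℂ) (hf : SumsTo f s a) : SumsTo (c • f) s (c * a) :=
  LSeriesHasSum.smul c hf

theorem SumsTo.mul (hf : SumsTo f s a) (hg : SumsTo g s b) : SumsTo (f * g) s (a * b) := by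
  have h1 := ArithmeticFunction.LSeriesSummable_mul hf.LSeriesSummable hg.LSeriesSummable
  have h2 := ArithmeticFunction.LSeries_mul' hf.LSeriesSummable hg.LSeriesSummable
  rw [hf.LSeries_eq, hg.LSeries_eq] at h2
  exact h2 ▸ h1.LSeriesHasSum

theorem SumsTo.powNeg {k : ℕ} (hk : k ≠ 0) : SumsTo (powNeg k) s ((k : ℂ) ^ (-s)) := by
  have h1 : ∀ n, n ≠ k → LSeries.term (RepZeta.powNeg k) s n = 0 := by
    intro n hn
    by_cases h0 : n = 0
    · rw [h0, LSeries.term_zero]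
    rw [LSeries.term_of_ne_zero h0]
    change (if n = k ∧ n ≠ 0 then (1 : ℂ) else 0) / _ = 0
    rw [if_neg fun h => hn h.1, zero_div]
  have h2 := hasSum_single k h1
  rw [LSeries.term_of_ne_zero hk] at h2
  change HasSum _ ((if k = k ∧ k ≠ 0 then (1 : ℂ) else 0) / _) at h2
  rwa [if_pos ⟨rfl, hk⟩, one_div, ← Complex.cpow_neg] at h2

theorem SumsTo.one : SumsTo 1 s 1 := by
  have h := SumsTo.powNeg (s := s) one_ne_zero
  rwa [powNeg_one, Nat.cast_one, Complex.one_cpow] at h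

theorem SumsTo.pow (hf : SumsTo f s a) (n : ℕ) : SumsTo (f ^ n) s (a ^ n) := by
  induction n with
  | zero => simpa using SumsTo.one
  | succ n ih => rw [pow_succ, pow_succ]; exact ih.mul hf

theorem SumsTo.natCast (n : ℕ) : SumsTo (n : ArithmeticFunction ℂ) s n := by
  have := SumsTo.smul (n : ℂ) (SumsTo.one (s := s))
  rwa [Nat.cast_smul_eq_nsmul, nsmul_eq_mul, mul_one, mul_one] at this

theorem SumsTo.ofNat (n : ℕ) [n.AtLeastTwo] :
    SumsTo (OfNat.ofNat n : ArithmeticFunction ℂ) s (OfNat.ofNat n) := SumsTo.natCast n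

theorem SumsTo.sum {ι : Type*} (A : Finset ι) {F : ι → ArithmeticFunction ℂ} {v : ι → ℂ}
    (h : ∀ i ∈ A, SumsTo (F i) s (v i)) : SumsTo (∑ i ∈ A, F i) s (∑ i ∈ A, v i) := by
  classical
  induction A using Finset.induction_on with
  | empty => simpa using SumsTo.natCast 0
  | insert i A hi ih =>
    rw [Finset.sum_insert hi, Finset.sum_insert hi]
    exact (h i (Finset.mem_insert_self _ _)).add
      (ih fun j hj => h j (Finset.mem_insert_of_mem hj))

theorem SumsTo.inv_smul_powNeg {k : ℕ} (hk : k ≠ 0) :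
    SumsTo ((k : ℂ)⁻¹ • RepZeta.powNeg k) s ((k : ℂ) ^ (-1 - s)) := by
  have := (SumsTo.powNeg (s := s) hk).smul (k : ℂ)⁻¹
  rwa [show (k : ℂ)⁻¹ * (k : ℂ) ^ (-s) = (k : ℂ) ^ (-1 - s) by
    rw [sub_eq_add_neg, Complex.cpow_add _ _ (Nat.cast_ne_zero.2 hk), Complex.cpow_neg_one]] at this

theorem dilate_pow_apply {k : ℕ} (hk : k ≠ 0) {n : ℕ} (hn : n ≠ 0) :
    dilate k f (n ^ k) = f n := by
  change ∑ m ∈ (n ^ k).divisors with m ^ k = n ^ k, f m = f n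
  rw [Finset.sum_eq_single n]
  · intro m hm hmn
    exact absurd (Nat.pow_left_injective hk (Finset.mem_filter.1 hm).2) hmn
  · intro h
    refine absurd ?_ h
    rw [Finset.mem_filter, Nat.mem_divisors]
    exact ⟨⟨dvd_pow_self n hk, pow_ne_zero k hn⟩, rfl⟩

/-- The dilated series is supported on `k`-th powers, where its terms at `s` are those of `f` at `k
s`. -/
theorem SumsTo.dilate {k : ℕ} (hk : k ≠ 0) (h : SumsTo f (k * s) a) :
    SumsTo (dilate k f) s a := by
  have hinj : Function.Injective fun n : ℕ => n ^ k :=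
    Nat.pow_left_injective hk
  refine (hinj.hasSum_iff ?_).1 ?_
  · intro m hm
    by_cases h0 : m = 0
    · rw [h0, LSeries.term_zero]
    rw [LSeries.term_of_ne_zero h0]
    change (∑ n ∈ m.divisors with n ^ k = m, f n) / _ = 0
    rw [Finset.filter_false_of_mem fun n _ hn => hm ⟨n, hn⟩, Finset.sum_empty, zero_div]
  · have hcomp : LSeries.term (RepZeta.dilate k f) s ∘ (fun n : ℕ => n ^ k) =
        LSeries.term f (k * s) := funext fun n => ?_
    · exact hcomp ▸ h
    change LSeries.term (RepZeta.dilate k f) s (n ^ k) = LSeries.term f (k * s) n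
    by_cases h0 : n = 0
    · rw [h0, zero_pow hk, LSeries.term_zero, LSeries.term_zero]
    rw [LSeries.term_of_ne_zero h0, LSeries.term_of_ne_zero (pow_ne_zero k h0),
      dilate_pow_apply hk h0, Nat.cast_pow, Complex.natCast_cpow_natCast_mul]

variable {H : Type*} [Group H] [TopologicalSpace H]

/-- For `Re s ≥ 0` the real part does not decrease. For `Re s < 0` the coefficients are natural
numbers, so nonzero terms have norm at least one; summability leaves finitely many, and the series
then converges everywhere. -/
theorem ZetaConverges.nat_mul (h : ZetaConverges H s) {k : ℕ} (hk : k ≠ 0) :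
    ZetaConverges H (k * s) := by
  have hk1 : (1 : ℝ) ≤ k := by exact_mod_cast Nat.one_le_iff_ne_zero.2 hk
  have hre : ((k : ℂ) * s).re = k * s.re := by simp
  by_cases hs : 0 ≤ s.re
  · refine LSeriesSummable.of_re_le_re ?_ h
    rw [hre]
    nlinarith
  · push Not at hs
    have h1 : ∀ n, LSeries.term (zetaSeries H) s n ≠ 0 → 1 ≤ ‖LSeries.term (zetaSeries H) s n‖ := by
      intro n hn
      have h0 : n ≠ 0 := fun h0 => hn (by rw [h0, LSeries.term_zero])
      rw [LSeries.term_of_ne_zero h0] at hn ⊢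
      have h2 : zetaSeries H n = ((repCount H n).toNat : ℂ) := if_neg h0
      rw [h2] at hn ⊢
      have h3 : (repCount H n).toNat ≠ 0 := fun h3 => hn (by rw [h3, Nat.cast_zero, zero_div])
      rw [norm_div, Complex.norm_natCast, Complex.norm_natCast_cpow_of_pos (Nat.pos_of_ne_zero h0)]
      have h4 : (n : ℝ) ^ s.re ≤ 1 :=
        Real.rpow_le_one_of_one_le_of_nonpos (by exact_mod_cast Nat.one_le_iff_ne_zero.2 h0) hs.le
      have h5 : (0 : ℝ) < (n : ℝ) ^ s.re := Real.rpow_pos_of_pos (by positivity) _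
      rw [one_le_div h5]
      exact h4.trans (by exact_mod_cast Nat.one_le_iff_ne_zero.2 h3)
    have h2 : {n | ¬‖LSeries.term (zetaSeries H) s n‖ < 1}.Finite := by
      have := (tendsto_norm_zero.comp h.tendsto_cofinite_zero).eventually (gt_mem_nhds one_pos)
      exact this
    refine summable_of_hasFiniteSupport (h2.subset fun n hn => ?_)
    rw [Set.mem_ofPred_eq, not_lt]
    refine h1 n fun h3 => hn ?_
    by_cases h0 : n = 0
    · rw [h0, LSeries.term_zero]
    rw [LSeries.term_of_ne_zero h0] at h3 ⊢
    have h4 : (n : ℂ) ^ s ≠ 0 := by simp [Complex.cpow_eq_zero_iff, h0]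
    rw [(div_eq_zero_iff.1 h3).resolve_right h4, zero_div]

theorem SumsTo.zetaSeriesAt (h : ZetaConverges H s) {k : ℕ} (hk : k ≠ 0) :
    SumsTo (zetaSeriesAt H k) s (zeta H (k * s)) :=
  SumsTo.dilate hk (h.nat_mul hk).LSeriesHasSum

theorem SumsTo.zeta {G : Type*} [Group G] [TopologicalSpace G] (h : SumsTo (zetaSeries G) s a) :
    ZetaConverges G s ∧ zeta G s = a :=
  ⟨h.LSeriesSummable, h.LSeries_eq⟩

end Analytic

/-! ### Cyclic groups of prime order and of order four -/

section Cyclic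

variable {H : Type*} [Group H] [TopologicalSpace H]

theorem zetaSeries_wreath_cycGp_prime (hH : Rigid H) {p : ℕ} (hp : p.Prime) :
    zetaSeries (Wreath H (Fin p) (CycGp p)) =
      ((p : ℂ)⁻¹ • powNeg p) * (zetaSeriesAt H 1 ^ p - zetaSeriesAt H p) +
        (p : ℂ) • zetaSeriesAt H p := by
  have h1 := hp.one_lt.ne'
  have h0 := hp.ne_zero
  rw [(zetaSeries_wreath_cycGp hH h0).2, hp.divisors, Finset.sum_pair h1.symm,
    Finset.filter_true_of_mem (by simp), Finset.sum_pair h1.symm,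
    Finset.filter_insert, if_neg (by simpa using h1), Finset.filter_singleton, if_pos dvd_rfl,
    Finset.sum_singleton]
  simp [Nat.div_self hp.pos, ArithmeticFunction.moebius_apply_prime hp, powNeg_one,
    sub_eq_add_neg]

theorem zetaSeries_wreath_cycGp_four (hH : Rigid H) :
    zetaSeries (Wreath H (Fin 4) (CycGp 4)) =
      ((4 : ℂ)⁻¹ • powNeg 4) * (zetaSeriesAt H 1 ^ 4 - zetaSeriesAt H 2 ^ 2) +
        powNeg 2 * (zetaSeriesAt H 2 ^ 2 - zetaSeriesAt H 4) + (4 : ℂ) • zetaSeriesAt H 4 := by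
  have hd : Nat.divisors 4 = {1, 2, 4} := by decide
  have h1 : (({1, 2, 4} : Finset ℕ).filter fun f => 1 ∣ f) = {1, 2, 4} := by decide
  have h2 : (({1, 2, 4} : Finset ℕ).filter fun f => 2 ∣ f) = {2, 4} := by decide
  have h4 : (({1, 2, 4} : Finset ℕ).filter fun f => 4 ∣ f) = {4} := by decide
  have hm2 : ArithmeticFunction.moebius 2 = -1 :=
    ArithmeticFunction.moebius_apply_prime Nat.prime_two
  have hm4 : ArithmeticFunction.moebius 4 = 0 :=
    ArithmeticFunction.moebius_eq_zero_of_not_squarefree (by decide)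
  rw [(zetaSeries_wreath_cycGp hH four_ne_zero).2, hd, Finset.sum_insert (by decide),
    Finset.sum_insert (by decide), Finset.sum_singleton, h1, h2, h4,
    Finset.sum_insert (by decide), Finset.sum_insert (by decide), Finset.sum_singleton,
    Finset.sum_insert (by decide), Finset.sum_singleton, Finset.sum_singleton]
  simp [hm2, hm4, powNeg_one, sub_eq_add_neg]
  ring

end Cyclic

end

end RepZeta

/-! ### Formal and analytic identities together -/

theorem proposition6 (H : Type*) [Group H] [TopologicalSpace H] [IsTopologicalGroup H]
    (hH : Rigid H) :
    -- the cyclic group of order `d`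
    (∀ d : ℕ, 2 ≤ d →
      Rigid (Wreath H (Fin d) (CycGp d)) ∧
      zetaSeries (Wreath H (Fin d) (CycGp d)) =
        ∑ e ∈ d.divisors, ((((d / e : ℕ) : ℂ)⁻¹ * (e : ℂ)) • powNeg (d / e)) *
          ∑ f ∈ d.divisors with e ∣ f,
            ((ArithmeticFunction.moebius (f / e) : ℤ) : ℂ) • zetaSeriesAt H f ^ (d / f) ∧
      ∀ s : ℂ, ZetaConverges H s →
        ZetaConverges (Wreath H (Fin d) (CycGp d)) s ∧
        zeta (Wreath H (Fin d) (CycGp d)) s =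
          ∑ e ∈ d.divisors, ((d / e : ℕ) : ℂ) ^ (-1 - s) * (e : ℂ) *
            ∑ f ∈ d.divisors with e ∣ f,
              ((ArithmeticFunction.moebius (f / e) : ℤ) : ℂ) * zeta H (f * s) ^ (d / f)) ∧
    -- the cyclic group of prime order `p`
    (∀ p : ℕ, p.Prime →
      zetaSeries (Wreath H (Fin p) (CycGp p)) =
        ((p : ℂ)⁻¹ • powNeg p) * (zetaSeriesAt H 1 ^ p - zetaSeriesAt H p) +
          (p : ℂ) • zetaSeriesAt H p ∧
      ∀ s : ℂ, ZetaConverges H s →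
        zeta (Wreath H (Fin p) (CycGp p)) s =
          (p : ℂ) ^ (-1 - s) * (zeta H s ^ p - zeta H (p * s)) + p * zeta H (p * s)) ∧
    -- the cyclic group of order `4`
    (zetaSeries (Wreath H (Fin 4) (CycGp 4)) =
        ((4 : ℂ)⁻¹ • powNeg 4) * (zetaSeriesAt H 1 ^ 4 - zetaSeriesAt H 2 ^ 2) +
          powNeg 2 * (zetaSeriesAt H 2 ^ 2 - zetaSeriesAt H 4) + (4 : ℂ) • zetaSeriesAt H 4 ∧
      ∀ s : ℂ, ZetaConverges H s →
        zeta (Wreath H (Fin 4) (CycGp 4)) s =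
          (4 : ℂ) ^ (-1 - s) * (zeta H s ^ 4 - zeta H (2 * s) ^ 2) +
            (2 : ℂ) ^ (-s) * (zeta H (2 * s) ^ 2 - zeta H (4 * s)) + 4 * zeta H (4 * s)) ∧
    -- the symmetric group on three objects
    (Rigid (Wreath H (Fin 3) (SymGp 3)) ∧
      zetaSeries (Wreath H (Fin 3) (SymGp 3)) =
        ((6 : ℂ)⁻¹ • powNeg 6) * zetaSeriesAt H 1 ^ 3 +
          (-((2 : ℂ)⁻¹ • powNeg 6) + (2 : ℂ) • powNeg 3) *
            (zetaSeriesAt H 2 * zetaSeriesAt H 1) +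
          ((3 : ℂ)⁻¹ • powNeg 6 - (2 : ℂ) • powNeg 3 + powNeg 2 + 2) * zetaSeriesAt H 3 ∧
      ∀ s : ℂ, ZetaConverges H s →
        ZetaConverges (Wreath H (Fin 3) (SymGp 3)) s ∧
        zeta (Wreath H (Fin 3) (SymGp 3)) s =
          (6 : ℂ) ^ (-1 - s) * zeta H s ^ 3 +
            (-((6 : ℂ) ^ (-s) / 2) + 2 * (3 : ℂ) ^ (-s)) * (zeta H (2 * s) * zeta H s) +
            ((6 : ℂ) ^ (-s) / 3 - 2 * (3 : ℂ) ^ (-s) + (2 : ℂ) ^ (-s) + 2) * zeta H (3 * s)) ∧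
    -- the symmetric group on four objects
    (Rigid (Wreath H (Fin 4) (SymGp 4)) ∧
      zetaSeries (Wreath H (Fin 4) (SymGp 4)) =
        ((24 : ℂ)⁻¹ • powNeg 24) *
            (zetaSeriesAt H 1 ^ 4 - 6 * (zetaSeriesAt H 1 ^ 2 * zetaSeriesAt H 2) +
              8 * (zetaSeriesAt H 1 * zetaSeriesAt H 3) + 3 * zetaSeriesAt H 2 ^ 2 -
              6 * zetaSeriesAt H 4) +
          6 * ((12 : ℂ)⁻¹ • powNeg 12) * 2 *
            (zetaSeriesAt H 1 ^ 2 * zetaSeriesAt H 2 -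
              2 * (zetaSeriesAt H 1 * zetaSeriesAt H 3) - zetaSeriesAt H 2 ^ 2 +
              2 * zetaSeriesAt H 4) +
          4 * ((4 : ℂ)⁻¹ • powNeg 4) * (2 + powNeg 2) *
            (zetaSeriesAt H 1 * zetaSeriesAt H 3 - zetaSeriesAt H 4) +
          3 * ((6 : ℂ)⁻¹ • powNeg 6) * 4 * (zetaSeriesAt H 2 ^ 2 - zetaSeriesAt H 4) +
          (2 + powNeg 2 + 2 * powNeg 3) * zetaSeriesAt H 4 ∧
      ∀ s : ℂ, ZetaConverges H s →
        ZetaConverges (Wreath H (Fin 4) (SymGp 4)) s ∧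
        zeta (Wreath H (Fin 4) (SymGp 4)) s =
          (24 : ℂ) ^ (-1 - s) *
              (zeta H s ^ 4 - 6 * (zeta H s ^ 2 * zeta H (2 * s)) +
                8 * (zeta H s * zeta H (3 * s)) + 3 * zeta H (2 * s) ^ 2 -
                6 * zeta H (4 * s)) +
            6 * (12 : ℂ) ^ (-1 - s) * 2 *
              (zeta H s ^ 2 * zeta H (2 * s) - 2 * (zeta H s * zeta H (3 * s)) -
                zeta H (2 * s) ^ 2 + 2 * zeta H (4 * s)) +
            4 * (4 : ℂ) ^ (-1 - s) * (2 + (2 : ℂ) ^ (-s)) *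
              (zeta H s * zeta H (3 * s) - zeta H (4 * s)) +
            3 * (6 : ℂ) ^ (-1 - s) * 4 * (zeta H (2 * s) ^ 2 - zeta H (4 * s)) +
            (2 + (2 : ℂ) ^ (-s) + 2 * (3 : ℂ) ^ (-s)) * zeta H (4 * s)) := by
  have z1 : ∀ {s : ℂ}, ZetaConverges H s → SumsTo (zetaSeriesAt H 1) s (zeta H s) := by
    intro s hs
    simpa using SumsTo.zetaSeriesAt hs one_ne_zero
  have z2 : ∀ {s : ℂ}, ZetaConverges H s → SumsTo (zetaSeriesAt H 2) s (zeta H (2 * s)) :=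
    fun hs => SumsTo.zetaSeriesAt hs two_ne_zero
  have z3 : ∀ {s : ℂ}, ZetaConverges H s → SumsTo (zetaSeriesAt H 3) s (zeta H (3 * s)) :=
    fun hs => SumsTo.zetaSeriesAt hs three_ne_zero
  have z4 : ∀ {s : ℂ}, ZetaConverges H s → SumsTo (zetaSeriesAt H 4) s (zeta H (4 * s)) :=
    fun hs => SumsTo.zetaSeriesAt hs four_ne_zero
  refine ⟨fun d hd => ?_, fun p hp => ?_, ?_, ?_, ?_⟩
  · have hd0 : d ≠ 0 := by omega
    obtain ⟨h1, h2⟩ := zetaSeries_wreath_cycGp hH hd0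
    refine ⟨h1, h2, fun s hs => SumsTo.zeta ?_⟩
    rw [h2]
    refine SumsTo.sum _ fun e he => SumsTo.mul ?_ (SumsTo.sum _ fun f hf => ?_)
    · have he := Nat.dvd_of_mem_divisors he
      rw [mul_comm, mul_smul, mul_comm]
      exact (SumsTo.inv_smul_powNeg
        (Nat.div_ne_zero_iff_of_dvd he |>.2 ⟨hd0, ne_zero_of_dvd_ne_zero hd0 he⟩)).smul _
    · have hf := Nat.dvd_of_mem_divisors (Finset.mem_filter.1 hf).1
      exact ((SumsTo.zetaSeriesAt hs (ne_zero_of_dvd_ne_zero hd0 hf)).pow _).smul _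
  · have h := zetaSeries_wreath_cycGp_prime hH hp
    refine ⟨h, fun s hs => (SumsTo.zeta ?_).2⟩
    rw [h]
    have zp := SumsTo.zetaSeriesAt hs hp.ne_zero
    exact ((SumsTo.inv_smul_powNeg hp.ne_zero).mul (((z1 hs).pow p).sub zp)).add (zp.smul _)
  · have h := zetaSeries_wreath_cycGp_four hH
    refine ⟨h, fun s hs => (SumsTo.zeta ?_).2⟩
    rw [h]
    exact (((SumsTo.inv_smul_powNeg four_ne_zero).mul (((z1 hs).pow 4).sub ((z2 hs).pow 2))).add
      ((SumsTo.powNeg two_ne_zero).mul (((z2 hs).pow 2).sub (z4 hs)))).add ((z4 hs).smul _)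
  · obtain ⟨h1, h2⟩ := zetaSeries_wreath_symGp_three hH
    refine ⟨h1, h2, fun s hs => SumsTo.zeta ?_⟩
    rw [h2]
    have x2 : SumsTo (powNeg 2) s ((2 : ℂ) ^ (-s)) := SumsTo.powNeg two_ne_zero
    have x3 : SumsTo (powNeg 3) s ((3 : ℂ) ^ (-s)) := SumsTo.powNeg three_ne_zero
    have x6 : SumsTo (powNeg 6) s ((6 : ℂ) ^ (-s)) := SumsTo.powNeg (by norm_num)
    have y6 : SumsTo ((6 : ℂ)⁻¹ • powNeg 6) s ((6 : ℂ) ^ (-1 - s)) :=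
      SumsTo.inv_smul_powNeg (by norm_num)
    -- Brings the quotients by 2 and 3 into the form produced by `SumsTo.smul`.
    rw [div_eq_inv_mul, div_eq_inv_mul]
    exact ((y6.mul ((z1 hs).pow 3)).add
      (((x6.smul _).neg.add (x3.smul _)).mul ((z2 hs).mul (z1 hs)))).add
      (((((x6.smul _).sub (x3.smul _)).add x2).add (SumsTo.ofNat 2)).mul (z3 hs))
  · obtain ⟨h1, h2⟩ := zetaSeries_wreath_symGp_four hH
    refine ⟨h1, h2, fun s hs => SumsTo.zeta ?_⟩
    rw [h2]
    have x2 : SumsTo (powNeg 2) s ((2 : ℂ) ^ (-s)) := SumsTo.powNeg two_ne_zero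
    have x3 : SumsTo (powNeg 3) s ((3 : ℂ) ^ (-s)) := SumsTo.powNeg three_ne_zero
    have y4 : SumsTo ((4 : ℂ)⁻¹ • powNeg 4) s ((4 : ℂ) ^ (-1 - s)) :=
      SumsTo.inv_smul_powNeg four_ne_zero
    have y6 : SumsTo ((6 : ℂ)⁻¹ • powNeg 6) s ((6 : ℂ) ^ (-1 - s)) :=
      SumsTo.inv_smul_powNeg (by norm_num)
    have y12 : SumsTo ((12 : ℂ)⁻¹ • powNeg 12) s ((12 : ℂ) ^ (-1 - s)) :=
      SumsTo.inv_smul_powNeg (by norm_num)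
    have y24 : SumsTo ((24 : ℂ)⁻¹ • powNeg 24) s ((24 : ℂ) ^ (-1 - s)) :=
      SumsTo.inv_smul_powNeg (by norm_num)
    have c : ∀ (n : ℕ) [n.AtLeastTwo],
      SumsTo (OfNat.ofNat n : ArithmeticFunction ℂ) s (OfNat.ofNat n) := @SumsTo.ofNat s
    have w1 := z1 hs
    have w2 := z2 hs
    have w3 := z3 hs
    have w4 := z4 hs
    refine SumsTo.add (SumsTo.add (SumsTo.add (SumsTo.add ?_ ?_) ?_) ?_) ?_
    · exact y24.mul (((((w1.pow 4).sub ((c 6).mul ((w1.pow 2).mul w2))).add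
        ((c 8).mul (w1.mul w3))).add ((c 3).mul (w2.pow 2))).sub ((c 6).mul w4))
    · exact (((c 6).mul y12).mul (c 2)).mul (((((w1.pow 2).mul w2).sub
        ((c 2).mul (w1.mul w3))).sub (w2.pow 2)).add ((c 2).mul w4))
    · exact (((c 4).mul y4).mul ((c 2).add x2)).mul ((w1.mul w3).sub w4)
    · exact (((c 3).mul y6).mul (c 4)).mul ((w2.pow 2).sub w4)
    · exact (((c 2).add x2).add ((c 2).mul x3)).mul w4
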